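/- Let $k\ge 1$ be an integer. Let $d_k(n)$ denote the number of ordered factorizations of $n$ into $k$ positive integers, let $c_q(n)=\sum_{1\le a\le q,\ (a,q)=1} e^{2\pi i an/q}$ be the Ramanujan sum, and let $\phi$ be Euler's function. For an integer $q\ge 1$ put $$F_q(s):=\prod_{p^a\Vert q,\ a\ge 1}\Big(1-\frac1{p^s}\Big)^k\Big(-\frac{d_k(p^{a-1})}{p^{(a-1)(s-1)}}+\phi(p^a)\sum_{b\ge a}\frac{d_k(p^b)}{p^{bs}}\Big),$$ a finite product over the primes $p$ dividing $q$, where $p^a$ is the exact power of $p$ dividing $q$. 1. $F_q(s)$ converges absolutely for $\mathrm{Re}(s)>0$; that is, for every prime power $p^a\Vert q$ with $a\ge1$, the series $\sum_{b\ge a}d_k(p^b)p^{-bs}$ converges absolutely for $\mathrm{Re}(s)>0$. 2. For $\mathrm{Re}(s)>1$, $$\sum_{n=1}^\infty\frac{d_k(n)c_q(n)}{n^s}=\zeta(s)^kF_q(s),$$ where the series on the left converges absolutely. 3. For every $\epsilon>0$ there is a constant $C=C(k,\epsilon)$ such that for all integers $q\ge1$ and all real $N\ge q$, the function $\zeta(s)^kF_q(s)N^s/s$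 has at most a pole at $s=1$, and $$\Big|\sum_{n\le N}d_k(n)c_q(n)-\mathop{\mathrm{Res}}_{s=1}\Big(\zeta(s)^kF_q(s)\frac{N^s}{s}\Big)\Big|\le C\,N^{1+\epsilon}\Big(\frac qN\Big)^{\frac{2}{k+2}}.$$ -/

import Mathlib

namespace DivisorRamanujan

/-- The `k`-divisor function `d_k`: the `k`-fold Dirichlet convolution power of the constant
function `1`, so that `d_k(n)` is the number of ordered factorizations of `n ≥ 1` into `k`
positive integers. -/
def divisorFn (k n : ℕ) : ℕ :=
  (ArithmeticFunction.zeta ^ k) n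

/-- The Ramanujan sum `c_q(n) = ∑ e(an/q)`, over the reduced residue classes `a` modulo `q`,
where `e(θ) = exp(2πiθ)`. -/
noncomputable def ramanujanSum (q n : ℕ) : ℂ :=
  ∑ a ∈ (Finset.range q).filter (fun a => Nat.Coprime a q),
    Complex.exp (2 * Real.pi * Complex.I * (a * n / q))

/-- The term `d_k(p^b) / p^(bs)`. -/
noncomputable def localTerm (k p b : ℕ) (s : ℂ) : ℂ :=
  (divisorFn k (p ^ b) : ℂ) / (p : ℂ) ^ ((b : ℂ) * s)

/-- The factor of `F_q(s)` at a prime `p` with `p^a ∥ q`, `a ≥ 1`. The sum over `b ≥ a` is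
written with `b = a + j`. -/
noncomputable def localFactor (k p a : ℕ) (s : ℂ) : ℂ :=
  (1 - 1 / (p : ℂ) ^ s) ^ k *
    (-((divisorFn k (p ^ (a - 1)) : ℂ) / (p : ℂ) ^ (((a : ℂ) - 1) * (s - 1))) +
      (Nat.totient (p ^ a) : ℂ) * ∑' j : ℕ, localTerm k p (a + j) s)

/-- The product `F_q(s)` over the prime powers `p^a ∥ q` with `a ≥ 1`. -/
noncomputable def eulerF (k q : ℕ) (s : ℂ) : ℂ :=
  ∏ p ∈ q.primeFactors, localFactor k p (q.factorization p) s

/-- `f` is holomorphic or has a pole at `c`, and `ρ` is its residue there, that is, the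
coefficient of `(z - c)⁻¹` in its Laurent expansion: near `c`, `f` is the sum of the principal
part `∑_{j ≤ m} a_j (z - c)^(-(j+1))`, with `a_0 = ρ`, and of a function analytic at `c`. -/
def HasResidueAt (f : ℂ → ℂ) (c ρ : ℂ) : Prop :=
  ∃ (m : ℕ) (a : ℕ → ℂ) (g : ℂ → ℂ), AnalyticAt ℂ g c ∧ a 0 = ρ ∧
    ∀ᶠ z in nhdsWithin c {c}ᶜ,
      f z = ∑ j ∈ Finset.range (m + 1), a j / (z - c) ^ (j + 1) + g z

end DivisorRamanujan

/-! ### The divisor function at prime powers -/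

namespace DivisorRamanujan
open Finset

/-! Everything reduces to q = 1 through a finite convolution identity. The series ∑ d_k(p^b) X^b
equals (1-X)^(-k), while c_{p^a}(p^b) is 0 for b < a-1, -p^(a-1) for b = a-1 and φ(p^a) for b ≥ a.
Hence (1-X)^k ∑ d_k(p^b) c_{p^a}(p^b) X^b is a polynomial P (`localPoly`) of degree less than a+k,
and P(p^(-s)) is the factor of F_q at p^a. For p not dividing q, multiplicativity shows that n ↦
d_k(n) c_{p^a q}(n) is the convolution of n ↦ d_k(n) c_q(n) with the coefficients of P placed at the
powers of p (`twistedDivisor_prime_pow_mul`). Adding one prime power at a time gives the Dirichlet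
series (`LSeriesHasSum_twistedDivisor`) and transports the residue and the error term from q = 1 to
q (`exists_residue_twistedDivisor`). An error O(x^τ) is multiplied by the product over p^a ∥ q of ∑
|P_i| p^(-iτ), which is O(q^(1-τ+δ)). With τ = k/(k+2) + δ the result is N^(1+δ) (q/N)^(2/(k+2)).

For q = 1 this requires the k-divisor problem with exponent k/(k+2) + δ
(`norm_divisorSum_sub_mainTerm_le`). Put x = e^y. After subtraction of the main term and of the
constant ζ(0)^k, the error on y > 0 has as Laplace transform the entire function H, namely ζ(s)^k/s
without its principal parts at 0 and 1. Averaging the error 2k+2 times over windows of length η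
multiplies the transform by ((e^(ηs)-1)/(ηs))^(2k+2), enough decay to invert on Re s = 2 and to move
the line to Re s = 0 (`iterate_shiftAvg_eq_integral`). There the functional equation and ζ(1+it) =
O(|t|^ε) give ζ(it) = O(|t|^(1/2+ε)), so the averages are O(η^(-k/2)) up to ε in the exponent.

Since the summatory function of d_k is monotone, the error lies between its averages up to the
variation of the main term, O(η x^(1+δ)). The choice η ≍ x^(-2/(k+2)) balances the two bounds. -/

theorem divisorFn_mul (k : ℕ) {m n : ℕ} (h : Nat.Coprime m n) :
    divisorFn k (m * n) = divisorFn k m * divisorFn k n :=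
  (ArithmeticFunction.isMultiplicative_zeta.pow).map_mul_of_coprime h

theorem divisorFn_one (k : ℕ) : divisorFn k 1 = 1 :=
  (ArithmeticFunction.isMultiplicative_zeta.pow).map_one

theorem divisorFn_succ_prime_pow (k : ℕ) {p : ℕ} (hp : p.Prime) (b : ℕ) :
    divisorFn (k + 1) (p ^ b) = ∑ i ∈ range (b + 1), divisorFn k (p ^ i) := by
  unfold divisorFn
  rw [pow_succ, ArithmeticFunction.mul_zeta_apply, Nat.sum_divisors_prime_pow hp]

theorem divisorFn_prime_pow_le (k : ℕ) {p : ℕ} (hp : p.Prime) (b : ℕ) :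
    divisorFn k (p ^ b) ≤ (b + 1) ^ k := by
  induction k generalizing b with
  | zero =>
    unfold divisorFn
    rw [pow_zero, ArithmeticFunction.one_apply]
    split_ifs <;> simp
  | succ k ih =>
    rw [divisorFn_succ_prime_pow k hp]
    calc _ ≤ ∑ i ∈ range (b + 1), (b + 1) ^ k := by
          refine sum_le_sum fun i hi => (ih i).trans (Nat.pow_le_pow_left ?_ k)
          have := mem_range.1 hi; omega
      _ = _ := by simp [pow_succ, mul_comm]

/-- The generating power series `∑ d_k(p^b) X^b`. -/
noncomputable def divisorSeries (k p : ℕ) : PowerSeries ℂ :=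
  PowerSeries.mk fun b => (divisorFn k (p ^ b) : ℂ)

/-- Each Dirichlet convolution with the constant 1 turns coefficients at prime powers into partial
sums, that is, multiplies the series by 1/(1-X). -/
theorem one_sub_pow_mul_divisorSeries (k : ℕ) {p : ℕ} (hp : p.Prime) :
    (1 - PowerSeries.X) ^ k * divisorSeries k p = 1 := by
  induction k with
  | zero =>
    rw [pow_zero, one_mul]
    ext b
    rw [divisorSeries, PowerSeries.coeff_mk, PowerSeries.coeff_one]
    unfold divisorFn
    rw [pow_zero, ArithmeticFunction.one_apply]
    by_cases hb : b = 0
    · simp [hb]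
    · simp [hb, hp.one_lt.ne']
  | succ k ih =>
    have h : divisorSeries (k + 1) p = divisorSeries k p * PowerSeries.mk 1 := by
      ext b
      rw [divisorSeries, PowerSeries.coeff_mk, divisorFn_succ_prime_pow k hp, PowerSeries.coeff_mul,
        Nat.sum_antidiagonal_eq_sum_range_succ_mk]
      simp [divisorSeries]
    calc _ = ((1 - PowerSeries.X) ^ k * divisorSeries k p) *
          (PowerSeries.mk 1 * (1 - PowerSeries.X)) := by rw [h]; ring
      _ = 1 := by rw [ih, PowerSeries.mk_one_mul_one_sub_eq_one, one_mul]

/-! ### Ramanujan sums -/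

theorem sum_range_exp (q n : ℕ) (hq : 0 < q) :
    ∑ a ∈ range q, Complex.exp (2 * Real.pi * Complex.I * (a * n / q)) =
      if q ∣ n then (q : ℂ) else 0 := by
  have hq0 : (q : ℂ) ≠ 0 := by exact_mod_cast hq.ne'
  set z : ℂ := Complex.exp (2 * Real.pi * Complex.I * (n / q)) with hz
  have h1 : ∀ a : ℕ, Complex.exp (2 * Real.pi * Complex.I * (a * n / q)) = z ^ a := by
    intro a
    rw [hz, ← Complex.exp_nat_mul]
    congr 1; ring
  simp_rw [h1]
  have hpi : (2 * Real.pi * Complex.I : ℂ) ≠ 0 := Complex.two_pi_I_ne_zero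
  have hzq : z ^ q = 1 := by
    rw [hz, ← Complex.exp_nat_mul, Complex.exp_eq_one_iff]
    exact ⟨n, by field_simp; push_cast; ring⟩
  split_ifs with h
  · obtain ⟨m, rfl⟩ := h
    have : z = 1 := by
      rw [hz, Complex.exp_eq_one_iff]
      exact ⟨m, by push_cast; field_simp⟩
    simp [this]
  · have hz1 : z ≠ 1 := by
      intro hz1
      rw [hz, Complex.exp_eq_one_iff] at hz1
      obtain ⟨m, hm⟩ := hz1
      have h2 : (n : ℂ) / q = m := by
        apply mul_left_cancel₀ hpi
        rw [hm]; ring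
      rw [div_eq_iff hq0] at h2
      have h3 : (n : ℤ) = m * q := by exact_mod_cast h2
      exact h (by exact_mod_cast (Dvd.intro_left m h3.symm : (q : ℤ) ∣ n))
    rw [geom_sum_eq hz1, hzq, sub_self, zero_div]

/-- The fractions a/q with 0 ≤ a < q, sorted by their reduced denominator d = q/gcd(a,q), split the
full exponential sum into the sums c_d(n). -/
theorem sum_divisors_ramanujanSum (q n : ℕ) (hq : 0 < q) :
    ∑ d ∈ q.divisors, ramanujanSum d n = if q ∣ n then (q : ℂ) else 0 := by
  rw [← sum_range_exp q n hq]
  rw [← sum_fiberwise_of_maps_to (s := range q) (t := q.divisors)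
    (g := fun a => q / Nat.gcd a q)]
  · refine sum_congr rfl fun d hd => ?_
    obtain ⟨⟨e, rfl⟩, -⟩ := (Nat.mem_divisors.1 hd)
    have hd0 : 0 < d := Nat.pos_of_mul_pos_right hq
    have he0 : 0 < e := Nat.pos_of_mul_pos_left hq
    unfold ramanujanSum
    refine sum_nbij' (fun b => b * e) (fun a => a / e) ?_ ?_ ?_ ?_ ?_
    · intro b hb
      simp only [mem_filter, mem_range] at hb ⊢
      refine ⟨Nat.mul_lt_mul_of_pos_right hb.1 he0, ?_⟩
      rw [Nat.gcd_mul_right, hb.2.gcd_eq_one, one_mul, Nat.mul_div_cancel _ he0]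
    · intro a ha
      simp only [mem_filter, mem_range] at ha ⊢
      have hg : Nat.gcd a (d * e) = e := by
        have h1 : d * e = d * Nat.gcd a (d * e) := by
          conv_lhs => rw [← Nat.div_mul_cancel (Nat.gcd_dvd_right a (d * e)), ha.2]
        exact (Nat.eq_of_mul_eq_mul_left hd0 h1).symm
      obtain ⟨c, rfl⟩ : e ∣ a := hg ▸ Nat.gcd_dvd_left a (d * e)
      rw [Nat.mul_div_cancel_left _ he0]
      rw [mul_comm e c, Nat.gcd_mul_right] at hg
      refine ⟨?_, Nat.eq_of_mul_eq_mul_right he0 (hg.trans (one_mul e).symm)⟩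
      have := ha.1
      rw [mul_comm e c] at this
      exact lt_of_mul_lt_mul_right this he0.le
    · intro b _
      exact Nat.mul_div_cancel _ he0
    · intro a ha
      simp only [mem_filter, mem_range] at ha
      have hg : Nat.gcd a (d * e) = e := by
        have h1 : d * e = d * Nat.gcd a (d * e) := by
          conv_lhs => rw [← Nat.div_mul_cancel (Nat.gcd_dvd_right a (d * e)), ha.2]
        exact (Nat.eq_of_mul_eq_mul_left hd0 h1).symm
      exact Nat.div_mul_cancel (hg ▸ Nat.gcd_dvd_left a (d * e))
    · intro b _
      congr 2
      have : (e : ℂ) ≠ 0 := by exact_mod_cast he0.ne'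
      have : (d : ℂ) ≠ 0 := by exact_mod_cast hd0.ne'
      push_cast
      field_simp
  · intro a _
    exact Nat.mem_divisors.2 ⟨Nat.div_dvd_of_dvd (Nat.gcd_dvd_right a q), hq.ne'⟩

/-- The arithmetic function `d ↦ d · [d ∣ n]`. -/
noncomputable def dvdWeight (n : ℕ) : ArithmeticFunction ℂ :=
  ⟨fun d => if d ∣ n then (d : ℂ) else 0, by simp⟩

theorem dvdWeight_apply (n d : ℕ) : dvdWeight n d = if d ∣ n then (d : ℂ) else 0 := rfl

theorem dvdWeight_isMultiplicative (n : ℕ) : (dvdWeight n).IsMultiplicative := by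
  rw [ArithmeticFunction.IsMultiplicative.iff_ne_zero]
  refine ⟨by simp [dvdWeight_apply], fun {a b} _ _ hab => ?_⟩
  have hdvd : a * b ∣ n ↔ a ∣ n ∧ b ∣ n :=
    ⟨fun h => ⟨dvd_of_mul_right_dvd h, dvd_of_mul_left_dvd h⟩,
      fun h => hab.mul_dvd_of_dvd_of_dvd h.1 h.2⟩
  simp only [dvdWeight_apply, hdvd]
  by_cases h1 : a ∣ n <;> by_cases h2 : b ∣ n <;> simp [h1, h2]

/-- Möbius inversion of the divisor sum. It exhibits c_q(n) as a convolution of multiplicative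
functions of q, whence multiplicativity in q. -/
theorem ramanujanSum_eq_moebius_mul (q n : ℕ) (hq : 0 < q) :
    ramanujanSum q n = ((ArithmeticFunction.moebius : ArithmeticFunction ℂ) * dvdWeight n) q := by
  have := (ArithmeticFunction.sum_eq_iff_sum_mul_moebius_eq
    (f := fun d => ramanujanSum d n) (g := fun d => dvdWeight n d)).1
    (fun m hm => sum_divisors_ramanujanSum m n hm) q hq
  rw [← this, ArithmeticFunction.mul_apply]
  rfl

theorem ramanujanSum_mul {q r : ℕ} (n : ℕ) (hq : 0 < q) (hr : 0 < r) (h : Nat.Coprime q r) :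
    ramanujanSum (q * r) n = ramanujanSum q n * ramanujanSum r n := by
  rw [ramanujanSum_eq_moebius_mul _ _ hq, ramanujanSum_eq_moebius_mul _ _ hr,
    ramanujanSum_eq_moebius_mul _ _ (Nat.mul_pos hq hr)]
  exact ((ArithmeticFunction.isMultiplicative_moebius.intCast).mul
    (dvdWeight_isMultiplicative n)).map_mul_of_coprime h

/-- The Möbius formula sees n only through the divisors of q that divide n. This lets the part of n
prime to q be discarded. -/
theorem ramanujanSum_congr {q m n : ℕ} (hq : 0 < q) (h : ∀ d, d ∣ q → (d ∣ m ↔ d ∣ n)) :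
    ramanujanSum q m = ramanujanSum q n := by
  rw [ramanujanSum_eq_moebius_mul _ _ hq, ramanujanSum_eq_moebius_mul _ _ hq,
    ArithmeticFunction.mul_apply, ArithmeticFunction.mul_apply]
  refine sum_congr rfl fun x hx => ?_
  have := h x.2 (Dvd.intro_left _ (Nat.mem_divisorsAntidiagonal.1 hx).1)
  simp only [dvdWeight_apply, this]

theorem ramanujanSum_one (n : ℕ) : ramanujanSum 1 n = 1 := by
  simp [ramanujanSum]

theorem ramanujanSum_prime_pow {p : ℕ} (hp : p.Prime) (a n : ℕ) :
    ramanujanSum (p ^ (a + 1)) n =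
      (if p ^ (a + 1) ∣ n then (p : ℂ) ^ (a + 1) else 0) -
        if p ^ a ∣ n then (p : ℂ) ^ a else 0 := by
  have h1 := sum_divisors_ramanujanSum (p ^ (a + 1)) n (pow_pos hp.pos _)
  have h2 := sum_divisors_ramanujanSum (p ^ a) n (pow_pos hp.pos _)
  rw [Nat.sum_divisors_prime_pow hp] at h1 h2
  rw [sum_range_succ, h2] at h1
  push_cast at h1
  rw [← h1]; ring

/-! ### The local polynomial and the finite convolution identity -/

/-- The polynomial in `X = p^{-s}` equal to the factor of `F_q(s)` at `p^a ∥ q`. -/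
noncomputable def localPoly (k p a : ℕ) : Polynomial ℂ :=
  - Polynomial.C ((p : ℂ) ^ (a - 1) * divisorFn k (p ^ (a - 1))) * Polynomial.X ^ (a - 1) *
      (1 - Polynomial.X) ^ k +
    Polynomial.C ((Nat.totient (p ^ a) : ℕ) : ℂ) *
      (1 - (1 - Polynomial.X) ^ k *
        ∑ b ∈ range a, Polynomial.C (divisorFn k (p ^ b) : ℂ) * Polynomial.X ^ b)

theorem natDegree_one_sub_X_pow_le (k : ℕ) :
    ((1 - Polynomial.X : Polynomial ℂ) ^ k).natDegree ≤ k := by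
  refine Polynomial.natDegree_pow_le_of_le k (?_ : _ ≤ 1) |>.trans (by simp)
  exact (Polynomial.natDegree_sub_le _ _).trans (by simp)

theorem natDegree_localPoly_lt (k p : ℕ) {a : ℕ} (ha : 1 ≤ a) :
    (localPoly k p a).natDegree < a + k := by
  refine lt_of_le_of_lt (b := a - 1 + k) ?_ (by omega)
  unfold localPoly
  refine Polynomial.natDegree_add_le_of_degree_le ?_ ?_
  · refine Polynomial.natDegree_mul_le_of_le ?_ (natDegree_one_sub_X_pow_le k)
    rw [neg_mul, Polynomial.natDegree_neg]
    exact Polynomial.natDegree_C_mul_X_pow_le _ _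
  · refine (Polynomial.natDegree_C_mul_le _ _).trans ?_
    refine (Polynomial.natDegree_sub_le _ _).trans (max_le (by simp) ?_)
    rw [add_comm]
    refine Polynomial.natDegree_mul_le_of_le (natDegree_one_sub_X_pow_le k) ?_
    refine Polynomial.natDegree_sum_le_of_forall_le _ _ fun b hb => ?_
    refine (Polynomial.natDegree_C_mul_X_pow_le _ _).trans ?_
    have := mem_range.1 hb; omega

theorem coeff_localPoly_eq_zero (k p : ℕ) {a i : ℕ} (ha : 1 ≤ a) (hi : a + k ≤ i) :
    (localPoly k p a).coeff i = 0 :=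
  Polynomial.coeff_eq_zero_of_natDegree_lt ((natDegree_localPoly_lt k p ha).trans_le hi)

/-- The generating power series `∑ d_k(p^b) c_{p^a}(p^b) X^b`. -/
noncomputable def ramanujanSeries (k p a : ℕ) : PowerSeries ℂ :=
  PowerSeries.mk fun b => (divisorFn k (p ^ b) : ℂ) * ramanujanSum (p ^ a) (p ^ b)

/-- The divisor series cancels (1-X)^k. What remains is a monomial at X^(a-1) plus φ(p^a) times the
tail from X^a on, which is the pattern of values of c_{p^a} at powers of p. -/
theorem localPoly_mul_divisorSeries (k : ℕ) {p a : ℕ} (hp : p.Prime) (ha : 1 ≤ a) :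
    (localPoly k p a : PowerSeries ℂ) * divisorSeries k p = ramanujanSeries k p a := by
  obtain ⟨a, rfl⟩ : ∃ c, a = c + 1 := ⟨a - 1, by omega⟩
  have hD := one_sub_pow_mul_divisorSeries k hp
  have h1 : (localPoly k p (a + 1) : PowerSeries ℂ) * divisorSeries k p =
      - PowerSeries.C ((p : ℂ) ^ a * divisorFn k (p ^ a)) * PowerSeries.X ^ a +
      PowerSeries.C ((Nat.totient (p ^ (a + 1)) : ℕ) : ℂ) * (divisorSeries k p -
        ∑ b ∈ range (a + 1), PowerSeries.C (divisorFn k (p ^ b) : ℂ) * PowerSeries.X ^ b) := by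
    have hs : ((∑ b ∈ range (a + 1), Polynomial.C (divisorFn k (p ^ b) : ℂ) * Polynomial.X ^ b :
        Polynomial ℂ) : PowerSeries ℂ) =
        ∑ b ∈ range (a + 1), PowerSeries.C (divisorFn k (p ^ b) : ℂ) * PowerSeries.X ^ b := by
      rw [← Polynomial.coeToPowerSeries.ringHom_apply, map_sum]
      refine sum_congr rfl fun b _ => ?_
      rw [Polynomial.coeToPowerSeries.ringHom_apply, Polynomial.coe_mul, Polynomial.coe_pow,
        Polynomial.coe_C, Polynomial.coe_X]
    have h2 : (localPoly k p (a + 1) : PowerSeries ℂ) =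
      - PowerSeries.C ((p : ℂ) ^ a * divisorFn k (p ^ a)) * PowerSeries.X ^ a *
        (1 - PowerSeries.X) ^ k +
      PowerSeries.C ((Nat.totient (p ^ (a + 1)) : ℕ) : ℂ) * (1 - (1 - PowerSeries.X) ^ k *
        ∑ b ∈ range (a + 1), PowerSeries.C (divisorFn k (p ^ b) : ℂ) * PowerSeries.X ^ b) := by
      rw [← hs, localPoly]
      simp only [Polynomial.coe_sub, Polynomial.coe_neg, Polynomial.coe_add, Polynomial.coe_mul,
        Polynomial.coe_pow, Polynomial.coe_C, Polynomial.coe_X, Polynomial.coe_one,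
        Nat.add_sub_cancel]
    rw [h2]
    linear_combination (- PowerSeries.C ((p : ℂ) ^ a * divisorFn k (p ^ a)) * PowerSeries.X ^ a -
      PowerSeries.C ((Nat.totient (p ^ (a + 1)) : ℕ) : ℂ) * ∑ b ∈ range (a + 1),
        PowerSeries.C (divisorFn k (p ^ b) : ℂ) * PowerSeries.X ^ b) * hD
  rw [h1]
  ext b
  have hdvd : ∀ i j : ℕ, p ^ i ∣ p ^ j ↔ i ≤ j := fun i j => Nat.pow_dvd_pow_iff_le_right hp.one_lt
  have htot : ((Nat.totient (p ^ (a + 1)) : ℕ) : ℂ) = (p : ℂ) ^ (a + 1) - (p : ℂ) ^ a := by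
    rw [Nat.totient_prime_pow_succ hp]
    push_cast [hp.one_le]
    ring
  have hsum : (PowerSeries.coeff b) (∑ c ∈ range (a + 1),
      PowerSeries.C (divisorFn k (p ^ c) : ℂ) * PowerSeries.X ^ c) =
      if b ≤ a then (divisorFn k (p ^ b) : ℂ) else 0 := by
    rw [map_sum]
    simp only [PowerSeries.coeff_C_mul, PowerSeries.coeff_X_pow, mul_ite, mul_one, mul_zero,
      sum_ite_eq, mem_range, Nat.lt_succ_iff]
  rw [map_add, neg_mul, map_neg, PowerSeries.coeff_C_mul, PowerSeries.coeff_C_mul, map_sub, hsum,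
    PowerSeries.coeff_X_pow, ramanujanSeries, divisorSeries, PowerSeries.coeff_mk,
    PowerSeries.coeff_mk, ramanujanSum_prime_pow hp, htot]
  simp only [hdvd]
  rcases lt_trichotomy b a with h | h | h
  · simp [h.ne, h.le, show ¬ a ≤ b by omega, show ¬ a + 1 ≤ b by omega]
  · subst h
    simp
    ring
  · simp [h.ne', show ¬ b ≤ a by omega, show a ≤ b by omega, show a + 1 ≤ b by omega]
    ring

theorem sum_coeff_localPoly (k : ℕ) {p a : ℕ} (hp : p.Prime) (ha : 1 ≤ a) (b : ℕ) :
    ∑ i ∈ range (b + 1), (localPoly k p a).coeff i * (divisorFn k (p ^ (b - i)) : ℂ) =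
      (divisorFn k (p ^ b) : ℂ) * ramanujanSum (p ^ a) (p ^ b) := by
  have h := congrArg (PowerSeries.coeff b) (localPoly_mul_divisorSeries k hp ha)
  rw [PowerSeries.coeff_mul, Nat.sum_antidiagonal_eq_sum_range_succ_mk] at h
  simpa [ramanujanSeries, divisorSeries] using h

/-- The function `n ↦ d_k(n) c_q(n)`. -/
noncomputable def twistedDivisor (k q n : ℕ) : ℂ := (divisorFn k n : ℂ) * ramanujanSum q n

/-- Write n = p^b m with p not dividing m. Then c_{p^a} sees only p^b and c_q only m, so the
identity reduces to comparing coefficients of X^b in `localPoly_mul_divisorSeries`. -/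
theorem twistedDivisor_prime_pow_mul (k : ℕ) {p a q n : ℕ} (hp : p.Prime) (ha : 1 ≤ a)
    (hpq : ¬ p ∣ q) (hn : n ≠ 0) :
    twistedDivisor k (p ^ a * q) n = ∑ i ∈ range (a + k),
      (localPoly k p a).coeff i * if p ^ i ∣ n then twistedDivisor k q (n / p ^ i) else 0 := by
  have hq : 0 < q := Nat.pos_of_ne_zero fun h => hpq (h ▸ dvd_zero p)
  obtain ⟨b, m, hpm, rfl⟩ := Nat.exists_eq_pow_mul_and_not_dvd hn p hp.ne_one
  have hcop : ∀ j, Nat.Coprime (p ^ j) m := fun j =>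
    Nat.Coprime.pow_left _ ((Nat.Prime.coprime_iff_not_dvd hp).2 hpm)
  have hcopq : ∀ j, Nat.Coprime (p ^ j) q := fun j =>
    Nat.Coprime.pow_left _ ((Nat.Prime.coprime_iff_not_dvd hp).2 hpq)
  have hdvd : ∀ i, p ^ i ∣ p ^ b * m ↔ i ≤ b := fun i => by
    rw [(hcop i).dvd_mul_right, Nat.pow_dvd_pow_iff_le_right hp.one_lt]
  have hcq : ∀ j, ramanujanSum q (p ^ j * m) = ramanujanSum q m := fun j =>
    ramanujanSum_congr hq fun d hd =>
      (Nat.Coprime.dvd_mul_left (Nat.Coprime.coprime_dvd_left hd (hcopq j).symm))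
  have hcp : ramanujanSum (p ^ a) (p ^ b * m) = ramanujanSum (p ^ a) (p ^ b) :=
    ramanujanSum_congr (pow_pos hp.pos _) fun d hd => by
      obtain ⟨i, -, rfl⟩ := (Nat.dvd_prime_pow hp).1 hd
      exact (hcop i).dvd_mul_right
  have hterm : ∀ i, (if p ^ i ∣ p ^ b * m then twistedDivisor k q (p ^ b * m / p ^ i) else 0) =
      if i ≤ b then (divisorFn k (p ^ (b - i)) : ℂ) * twistedDivisor k q m else 0 := by
    intro i
    simp only [hdvd]
    split_ifs with hi
    · have : p ^ b * m / p ^ i = p ^ (b - i) * m := by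
        rw [← Nat.pow_div hi hp.pos, Nat.div_mul_right_comm (Nat.pow_dvd_pow p hi)]
      rw [this, twistedDivisor, twistedDivisor, hcq, divisorFn_mul k (hcop _)]
      push_cast; ring
    · rfl
  simp_rw [hterm]
  have h1 : ∑ i ∈ range (a + k), (localPoly k p a).coeff i *
      (if i ≤ b then (divisorFn k (p ^ (b - i)) : ℂ) * twistedDivisor k q m else 0) =
      (∑ i ∈ range (b + 1), (localPoly k p a).coeff i * (divisorFn k (p ^ (b - i)) : ℂ)) *
        twistedDivisor k q m := by
    rw [sum_mul]
    -- The ranges a+k and b+1 are not comparable, so both sums are extended to a common length: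
    -- beyond a+k the coefficients vanish, beyond b the divisibility condition fails.
    have : ∀ N, a + k ≤ N → b + 1 ≤ N → ∑ i ∈ range (a + k), (localPoly k p a).coeff i *
      (if i ≤ b then (divisorFn k (p ^ (b - i)) : ℂ) * twistedDivisor k q m else 0) =
      ∑ i ∈ range (b + 1), (localPoly k p a).coeff i * (divisorFn k (p ^ (b - i)) : ℂ) *
        twistedDivisor k q m := by
      intro N h1 h2
      rw [sum_subset (range_subset_range.2 h1), ← sum_subset (range_subset_range.2 h2)
        (f := fun i => (localPoly k p a).coeff i * (if i ≤ b then
          (divisorFn k (p ^ (b - i)) : ℂ) * twistedDivisor k q m else 0))]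
      · refine sum_congr rfl fun i hi => ?_
        rw [if_pos (Nat.lt_succ_iff.1 (mem_range.1 hi)), mul_assoc]
      · intro i _ hi
        rw [if_neg (by simpa using hi), mul_zero]
      · intro i _ hi
        rw [coeff_localPoly_eq_zero k p ha (by simpa using hi), zero_mul]
    exact this (a + k + b + 1) (by omega) (by omega)
  rw [h1, sum_coeff_localPoly k hp ha, twistedDivisor, twistedDivisor,
    ramanujanSum_mul _ (pow_pos hp.pos _) hq (hcopq a), hcp, hcq, divisorFn_mul k (hcop b)]
  push_cast; ring

end DivisorRamanujan

/-! ### Convergence of the local factors and the Dirichlet series -/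

namespace DivisorRamanujan
open Finset

theorem norm_prime_cpow_neg_lt_one {p : ℕ} (hp : p.Prime) {s : ℂ} (hs : 0 < s.re) :
    ‖(p : ℂ) ^ (-s)‖ < 1 := by
  rw [Complex.norm_natCast_cpow_of_pos hp.pos]
  exact Real.rpow_lt_one_of_one_lt_of_neg (by exact_mod_cast hp.one_lt) (by simpa using hs)

theorem localTerm_eq (k p b : ℕ) (s : ℂ) :
    localTerm k p b s = (divisorFn k (p ^ b) : ℂ) * ((p : ℂ) ^ (-s)) ^ b := by
  rw [localTerm, Complex.cpow_nat_mul, Complex.cpow_neg, inv_pow, div_eq_mul_inv]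

theorem summable_divisorFn_prime_pow (k : ℕ) {p : ℕ} (hp : p.Prime) {x : ℂ} (hx : ‖x‖ < 1) :
    Summable fun b : ℕ => ‖(divisorFn k (p ^ b) : ℂ) * x ^ b‖ := by
  have h1 : Summable fun b : ℕ => ((b : ℝ) + 1) ^ k * ‖x‖ ^ b := by
    have h2 : Summable fun b : ℕ => ((b : ℝ) ^ k * ‖x‖ ^ b) :=
      summable_pow_mul_geometric_of_norm_lt_one k (by simpa using hx)
    by_cases hx0 : ‖x‖ = 0
    · refine summable_of_ne_finset_zero (s := {0}) fun b hb => ?_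
      rw [hx0, zero_pow (by simpa using hb), mul_zero]
    · have h3 := ((summable_nat_add_iff 1).2 h2).mul_right (‖x‖⁻¹)
      refine h3.congr fun b => ?_
      push_cast
      rw [pow_succ]
      field_simp
  refine Summable.of_nonneg_of_le (fun _ => norm_nonneg _) (fun b => ?_) h1
  rw [norm_mul, norm_pow, Complex.norm_natCast]
  gcongr
  exact_mod_cast divisorFn_prime_pow_le k hp b

theorem one_sub_pow_mul_tsum (k : ℕ) {p : ℕ} (hp : p.Prime) {x : ℂ} (hx : ‖x‖ < 1) :
    (1 - x) ^ k * ∑' b : ℕ, (divisorFn k (p ^ b) : ℂ) * x ^ b = 1 := by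
  induction k with
  | zero =>
    rw [tsum_eq_single 0]
    · simp [divisorFn_one]
    · intro b hb
      have : divisorFn 0 (p ^ b) = 0 := by
        unfold divisorFn
        rw [pow_zero, ArithmeticFunction.one_apply, if_neg]
        simp [hp.one_lt.ne', hb]
      rw [this]; simp
  | succ k ih =>
    have hs := (summable_divisorFn_prime_pow (k + 1) hp hx).of_norm
    have hs' := (summable_divisorFn_prime_pow k hp hx).of_norm
    rw [pow_succ, mul_assoc]
    refine Eq.trans ?_ ih
    congr 1
    have h1 : (1 - x) * ∑' b : ℕ, (divisorFn (k + 1) (p ^ b) : ℂ) * x ^ b =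
        (∑' b : ℕ, (divisorFn (k + 1) (p ^ b) : ℂ) * x ^ b) -
          ∑' b : ℕ, x * ((divisorFn (k + 1) (p ^ b) : ℂ) * x ^ b) := by
      rw [tsum_mul_left]; ring
    rw [h1, hs.tsum_eq_zero_add, hs'.tsum_eq_zero_add, add_sub_assoc,
      ← Summable.tsum_sub ((summable_nat_add_iff 1).2 hs) (hs.mul_left x)]
    congr 1
    · simp [divisorFn_one]
    · refine tsum_congr fun b => ?_
      rw [divisorFn_succ_prime_pow k hp (b + 1), sum_range_succ, ← divisorFn_succ_prime_pow k hp b]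
      push_cast; ring

/-- With x = p^(-s) and |x| < 1, the tail over b ≥ a is (1-x)^(-k) minus a finite sum; multiplying
by (1-x)^k leaves a polynomial in x. -/
theorem localFactor_eq_eval (k : ℕ) {p a : ℕ} (hp : p.Prime) (ha : 1 ≤ a) {s : ℂ}
    (hs : 0 < s.re) : localFactor k p a s = (localPoly k p a).eval ((p : ℂ) ^ (-s)) := by
  obtain ⟨a, rfl⟩ : ∃ c, a = c + 1 := ⟨a - 1, by omega⟩
  have hx := norm_prime_cpow_neg_lt_one hp hs
  have hp0 : (p : ℂ) ≠ 0 := by exact_mod_cast hp.ne_zero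
  have hsum := (summable_divisorFn_prime_pow k hp hx).of_norm
  have hD := one_sub_pow_mul_tsum k hp hx
  have hpow : (p : ℂ) ^ ((((a + 1 : ℕ) : ℂ) - 1) * (s - 1)) =
      ((p : ℂ) ^ a * ((p : ℂ) ^ (-s)) ^ a)⁻¹ := by
    have : ((a + 1 : ℕ) : ℂ) - 1 = a := by push_cast; ring
    rw [this, Complex.cpow_nat_mul, ← mul_pow, ← inv_pow, Complex.cpow_sub _ _ hp0,
      Complex.cpow_one, Complex.cpow_neg, mul_inv, inv_inv, div_eq_mul_inv, mul_comm]
  rw [localFactor, hpow]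
  simp_rw [localTerm_eq]
  have h1 : (1 : ℂ) / (p : ℂ) ^ s = (p : ℂ) ^ (-s) := by rw [Complex.cpow_neg, one_div]
  rw [h1]
  set x := (p : ℂ) ^ (-s)
  have h2 := hsum.sum_add_tsum_nat_add (a + 1)
  have h3 : ∑' j : ℕ, (divisorFn k (p ^ (a + 1 + j)) : ℂ) * x ^ (a + 1 + j) =
      ∑' j : ℕ, (divisorFn k (p ^ (j + (a + 1))) : ℂ) * x ^ (j + (a + 1)) := by
    simp_rw [add_comm]
  rw [h3]
  rw [← h2] at hD
  simp only [localPoly, Polynomial.eval_add, Polynomial.eval_mul, Polynomial.eval_neg,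
    Polynomial.eval_C, Polynomial.eval_pow, Polynomial.eval_X, Polynomial.eval_sub,
    Polynomial.eval_one, Polynomial.eval_finsetSum, Nat.add_sub_cancel, div_eq_mul_inv, inv_inv]
  linear_combination ((Nat.totient (p ^ (a + 1)) : ℕ) : ℂ) * hD

theorem localFactor_eq_sum (k : ℕ) {p a : ℕ} (hp : p.Prime) (ha : 1 ≤ a) {s : ℂ}
    (hs : 0 < s.re) : localFactor k p a s =
      ∑ i ∈ range (a + k), (localPoly k p a).coeff i * ((p ^ i : ℕ) : ℂ) ^ (-s) := by
  rw [localFactor_eq_eval k hp ha hs, Polynomial.eval_eq_sum_range' (natDegree_localPoly_lt k p ha)]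
  refine sum_congr rfl fun i _ => ?_
  rw [Nat.cast_pow, ← Complex.natCast_cpow_natCast_mul, Complex.cpow_nat_mul]

theorem eulerF_one (k : ℕ) (s : ℂ) : eulerF k 1 s = 1 := by
  simp [eulerF]

/-- Stated for arbitrary local data because it serves both the Euler product and the product of
local constants in the error bound. -/
theorem prod_primeFactors_prime_pow_mul {M : Type*} [CommMonoid M] (F : ℕ → ℕ → M) {p a q : ℕ}
    (hp : p.Prime) (ha : 1 ≤ a) (hpq : ¬ p ∣ q) :
    ∏ r ∈ (p ^ a * q).primeFactors, F r ((p ^ a * q).factorization r) =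
      F p a * ∏ r ∈ q.primeFactors, F r (q.factorization r) := by
  have hq : q ≠ 0 := fun h => hpq (h ▸ dvd_zero p)
  have hpa : p ^ a ≠ 0 := pow_ne_zero _ hp.ne_zero
  have hfac : ∀ r, (p ^ a * q).factorization r = (Finsupp.single p a) r + q.factorization r := by
    intro r
    rw [Nat.factorization_mul hpa hq, hp.factorization_pow]; rfl
  rw [Nat.primeFactors_mul hpa hq, Nat.primeFactors_prime_pow (by omega) hp,
    ← insert_eq, prod_insert fun h => hpq (Nat.dvd_of_mem_primeFactors h), hfac,
    Finsupp.single_eq_same, Nat.factorization_eq_zero_of_not_dvd hpq, add_zero]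
  congr 1
  refine prod_congr rfl fun r hr => ?_
  have hne : r ≠ p := fun h => hpq (h ▸ Nat.dvd_of_mem_primeFactors hr)
  rw [hfac, Finsupp.single_eq_of_ne hne, zero_add]

theorem eulerF_prime_pow_mul (k : ℕ) {p a q : ℕ} (hp : p.Prime) (ha : 1 ≤ a) (hpq : ¬ p ∣ q)
    (s : ℂ) : eulerF k (p ^ a * q) s = localFactor k p a s * eulerF k q s :=
  prod_primeFactors_prime_pow_mul (fun r b => localFactor k r b s) hp ha hpq

theorem induction_prime_pow_mul {P : ℕ → Prop} (h1 : P 1)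
    (step : ∀ p a q : ℕ, p.Prime → 1 ≤ a → ¬ p ∣ q → P q → P (p ^ a * q)) :
    ∀ q : ℕ, 1 ≤ q → P q := by
  intro q
  induction q using Nat.strong_induction_on with
  | _ q ih =>
    intro hq
    rcases hq.eq_or_lt with rfl | hq1
    · exact h1
    · have hp := Nat.minFac_prime hq1.ne'
      obtain ⟨a, m, hm, hqm⟩ := Nat.exists_eq_pow_mul_and_not_dvd (by omega : q ≠ 0) _ hp.ne_one
      have hm0 : 1 ≤ m := Nat.pos_of_ne_zero fun h => hm (h ▸ dvd_zero _)
      have ha : 1 ≤ a := by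
        by_contra h
        have : a = 0 := by omega
        rw [this, pow_zero, one_mul] at hqm
        exact hm (hqm ▸ Nat.minFac_dvd q)
      have hlt : m < q := by
        conv_rhs => rw [hqm]
        exact lt_mul_of_one_lt_left hm0 (Nat.one_lt_pow (by omega) hp.one_lt)
      rw [hqm]
      exact step _ a m hp ha hm (ih m hlt hm0)

theorem LSeriesHasSum_divisorFn (k : ℕ) {s : ℂ} (hs : 1 < s.re) :
    LSeriesHasSum (fun n => (divisorFn k n : ℂ)) s (riemannZeta s ^ k) := by
  induction k with
  | zero =>
    rw [pow_zero, LSeriesHasSum]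
    convert hasSum_ite_eq (1 : ℕ) (1 : ℂ) using 2 with n
    rw [LSeries.term_def]
    unfold divisorFn
    rw [pow_zero, ArithmeticFunction.one_apply]
    by_cases h0 : n = 0
    · simp [h0]
    · by_cases h1 : n = 1 <;> simp [h0, h1]
  | succ k ih =>
    have h := ArithmeticFunction.LSeriesHasSum_mul
      (f := ((ArithmeticFunction.zeta ^ k : ArithmeticFunction ℕ) : ArithmeticFunction ℂ))
      (g := ((ArithmeticFunction.zeta : ArithmeticFunction ℕ) : ArithmeticFunction ℂ))
      (a := riemannZeta s ^ k) (by exact ih)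
      (by exact ArithmeticFunction.LSeriesHasSum_zeta hs)
    rw [← ArithmeticFunction.natCoe_mul, ← pow_succ, ← pow_succ] at h
    exact h

/-- Convolution with a point mass at m multiplies a Dirichlet series by m^(-s); the convolution
identity is a linear combination of such dilations. -/
theorem LSeriesHasSum_dilate {f : ℕ → ℂ} {s A : ℂ} (h : LSeriesHasSum f s A) {m : ℕ} (hm : 0 < m) :
    LSeriesHasSum (fun n => if m ∣ n then f (n / m) else 0) s ((m : ℂ) ^ (-s) * A) := by
  have hinj : Function.Injective fun n : ℕ => m * n := fun a b hab =>
    Nat.eq_of_mul_eq_mul_left hm hab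
  rw [LSeriesHasSum, ← hinj.hasSum_iff]
  · have hfun : (LSeries.term (fun n => if m ∣ n then f (n / m) else 0) s ∘ fun n => m * n) =
        fun n => (m : ℂ) ^ (-s) * LSeries.term f s n := by
      funext n
      rw [Function.comp_apply, LSeries.term_def, LSeries.term_def]
      by_cases hn : n = 0
      · simp [hn]
      · rw [if_neg (Nat.mul_ne_zero hm.ne' hn), if_neg hn, if_pos (Dvd.intro _ rfl),
          Nat.mul_div_cancel_left _ hm, Nat.cast_mul, Complex.natCast_mul_natCast_cpow,
          Complex.cpow_neg]
        have : (m : ℂ) ^ s ≠ 0 := by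
          rw [Ne, Complex.cpow_eq_zero_iff]
          exact fun h => hm.ne' (by exact_mod_cast h.1)
        field_simp
    rw [hfun]
    exact h.mul_left _
  · intro n hn
    have hd : ¬ m ∣ n := fun ⟨c, hc⟩ => hn ⟨c, hc.symm⟩
    rw [LSeries.term_def, if_neg hd, zero_div, ite_self]

theorem LSeriesHasSum_twistedDivisor (k : ℕ) {s : ℂ} (hs : 1 < s.re) (q : ℕ) (hq : 1 ≤ q) :
    LSeriesHasSum (twistedDivisor k q) s (riemannZeta s ^ k * eulerF k q s) := by
  refine induction_prime_pow_mul (P := fun q => LSeriesHasSum (twistedDivisor k q) s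
    (riemannZeta s ^ k * eulerF k q s)) ?_ ?_ q hq
  · rw [eulerF_one, mul_one]
    refine (LSeriesHasSum_congr s _ fun {n} _ => ?_).1 (LSeriesHasSum_divisorFn k hs)
    rw [twistedDivisor, ramanujanSum_one, mul_one]
  · intro p a q hp ha hpq ih
    rw [eulerF_prime_pow_mul k hp ha hpq, localFactor_eq_sum k hp ha (by linarith)]
    refine (LSeriesHasSum_congr s _ fun {n} hn =>
      (twistedDivisor_prime_pow_mul k hp ha hpq hn).symm).1 ?_
    have := LSeriesHasSum.sum (S := range (a + k)) fun i _ =>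
      (LSeriesHasSum_dilate ih (pow_pos hp.pos i)).smul ((localPoly k p a).coeff i)
    convert this using 1
    · ext n
      rw [Finset.sum_apply]
      rfl
    · rw [sum_mul, mul_sum]
      refine sum_congr rfl fun i _ => ?_
      ring

end DivisorRamanujan

/-! ### Residues and the principal parts of ζ(s)^k/s -/

namespace DivisorRamanujan
open Finset

theorem HasResidueAt.congr {f g : ℂ → ℂ} {c ρ : ℂ} (h : HasResidueAt f c ρ)
    (hfg : ∀ᶠ z in nhdsWithin c {c}ᶜ, g z = f z) : HasResidueAt g c ρ := by
  obtain ⟨m, a, φ, hφ, ha, he⟩ := h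
  refine ⟨m, a, φ, hφ, ha, ?_⟩
  filter_upwards [hfg, he] with z h1 h2
  rw [h1, h2]

theorem HasResidueAt.const_mul {f : ℂ → ℂ} {c ρ : ℂ} (h : HasResidueAt f c ρ) (b : ℂ) :
    HasResidueAt (fun z => b * f z) c (b * ρ) := by
  obtain ⟨m, a, φ, hφ, ha, he⟩ := h
  refine ⟨m, fun j => b * a j, fun z => b * φ z, analyticAt_const.mul hφ, by simp [ha], ?_⟩
  filter_upwards [he] with z h1
  rw [h1, mul_add, mul_sum]
  simp only [mul_div_assoc]

theorem HasResidueAt.of_analyticAt {f : ℂ → ℂ} {c : ℂ} (h : AnalyticAt ℂ f c) :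
    HasResidueAt f c 0 :=
  ⟨0, fun _ => 0, f, h, rfl, Filter.Eventually.of_forall fun z => by simp⟩

theorem HasResidueAt.add {f g : ℂ → ℂ} {c ρ σ : ℂ} (hf : HasResidueAt f c ρ)
    (hg : HasResidueAt g c σ) : HasResidueAt (fun z => f z + g z) c (ρ + σ) := by
  obtain ⟨m, a, φ, hφ, ha, he⟩ := hf
  obtain ⟨n, b, ψ, hψ, hb, he'⟩ := hg
  -- Principal parts of different lengths are padded with zeros to a common length before being
  -- added.
  have hpad : ∀ (m N : ℕ) (a : ℕ → ℂ) (z : ℂ), m ≤ N →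
      ∑ j ∈ range (m + 1), a j / (z - c) ^ (j + 1) =
        ∑ j ∈ range (N + 1), (if j < m + 1 then a j else 0) / (z - c) ^ (j + 1) := by
    intro m N a z hmN
    rw [← sum_subset (range_subset_range.2 (Nat.succ_le_succ hmN))]
    · exact sum_congr rfl fun j hj => by rw [if_pos (mem_range.1 hj)]
    · intro j _ hj
      rw [if_neg (by simpa using hj), zero_div]
  refine ⟨m + n, fun j => (if j < m + 1 then a j else 0) + if j < n + 1 then b j else 0,
    fun z => φ z + ψ z, hφ.add hψ, by simp [ha, hb], ?_⟩
  filter_upwards [he, he'] with z h1 h2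
  rw [h1, h2, hpad m (m + n) a z (by omega), hpad n (m + n) b z (by omega)]
  simp only [add_div, sum_add_distrib]
  ring

theorem HasResidueAt.sum {ι : Type*} (s : Finset ι) {f : ι → ℂ → ℂ} {c : ℂ} {ρ : ι → ℂ}
    (h : ∀ i ∈ s, HasResidueAt (f i) c (ρ i)) :
    HasResidueAt (fun z => ∑ i ∈ s, f i z) c (∑ i ∈ s, ρ i) := by
  classical
  induction s using Finset.induction_on with
  | empty => simpa using HasResidueAt.of_analyticAt (analyticAt_const (v := (0 : ℂ)) (x := c))
  | insert i s hi ih =>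
    simp only [sum_insert hi]
    exact (h i (mem_insert_self i s)).add (ih fun j hj => h j (mem_insert_of_mem hj))

theorem exists_eq_sum_add_pow_mul {f : ℂ → ℂ} (hf : Differentiable ℂ f) (c : ℂ) (n : ℕ) :
    ∃ (b : ℕ → ℂ) (g : ℂ → ℂ), Differentiable ℂ g ∧
      ∀ z, f z = ∑ j ∈ range n, b j * (z - c) ^ j + (z - c) ^ n * g z := by
  induction n with
  | zero => exact ⟨fun _ => 0, f, hf, fun z => by simp⟩
  | succ n ih =>
    obtain ⟨b, g, hg, h⟩ := ih
    refine ⟨fun j => if j < n then b j else g c, dslope g c, ?_, fun z => ?_⟩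
    · rw [← differentiableOn_univ] at hg ⊢
      exact (Complex.differentiableOn_dslope Filter.univ_mem).2 hg
    · have h1 := sub_smul_dslope g c z
      rw [smul_eq_mul] at h1
      have h2 : ∑ j ∈ range n, (if j < n then b j else g c) * (z - c) ^ j =
          ∑ j ∈ range n, b j * (z - c) ^ j :=
        sum_congr rfl fun j hj => by rw [if_pos (mem_range.1 hj)]
      rw [h z, sum_range_succ, h2]
      simp only [lt_irrefl, if_false]
      linear_combination (-(z - c) ^ n) * h1

/-- The Taylor expansion of `exp (w * L)` at `w = 0` with an entire remainder. -/
theorem exists_exp_mul_eq (L : ℂ) (n : ℕ) : ∃ g : ℂ → ℂ, Differentiable ℂ g ∧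
    ∀ w, Complex.exp (w * L) = ∑ j ∈ range n, (L ^ j / j.factorial) * w ^ j + w ^ n * g w := by
  induction n with
  | zero =>
    refine ⟨fun w => Complex.exp (w * L), by fun_prop, fun w => by simp⟩
  | succ n ih =>
    obtain ⟨g, hg, h⟩ := ih
    -- The induction hypothesis does not specify g(0). It is the next Taylor coefficient, recovered
    -- as a limit from the standard bound for the remainder of the exponential series.
    have hg0 : g 0 = L ^ n / n.factorial := by
      have hlim : Filter.Tendsto g (nhdsWithin 0 {0}ᶜ) (nhds (g 0)) :=
        hg.continuous.continuousAt.tendsto.mono_left nhdsWithin_le_nhds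
      have hlim' : Filter.Tendsto g (nhdsWithin 0 {0}ᶜ) (nhds (L ^ n / n.factorial)) := by
        rw [tendsto_iff_norm_sub_tendsto_zero]
        have hb : Filter.Tendsto (fun w : ℂ => ‖w‖ * (‖L‖ ^ (n + 1) * Real.exp ‖w * L‖))
            (nhdsWithin 0 {0}ᶜ) (nhds 0) := by
          have : Continuous fun w : ℂ => ‖w‖ * (‖L‖ ^ (n + 1) * Real.exp ‖w * L‖) := by fun_prop
          simpa using (this.tendsto 0).mono_left nhdsWithin_le_nhds
        refine squeeze_zero' (Filter.Eventually.of_forall fun _ => norm_nonneg _) ?_ hb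
        filter_upwards [self_mem_nhdsWithin] with w hw
        have hw0 : w ≠ 0 := hw
        have h1 := Complex.norm_exp_sub_sum_le_norm_mul_exp (w * L) (n + 1)
        have h2 : Complex.exp (w * L) - ∑ m ∈ range (n + 1), (w * L) ^ m / m.factorial =
            w ^ n * (g w - L ^ n / n.factorial) := by
          rw [h w, sum_range_succ]
          have : ∀ m ∈ range n, (w * L) ^ m / (m.factorial : ℂ) = L ^ m / m.factorial * w ^ m :=
            fun m _ => by rw [mul_pow]; ring
          rw [sum_congr rfl this, mul_pow]
          ring
        rw [h2, norm_mul, norm_pow, norm_mul, mul_pow, pow_succ] at h1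
        have h3 : 0 < ‖w‖ ^ n := pow_pos (norm_pos_iff.2 hw0) n
        refine le_of_mul_le_mul_left (h1.trans (le_of_eq ?_)) h3
        rw [norm_mul]; ring
      exact tendsto_nhds_unique hlim hlim'
    refine ⟨dslope g 0, ?_, fun w => ?_⟩
    · rw [← differentiableOn_univ] at hg ⊢
      exact (Complex.differentiableOn_dslope Filter.univ_mem).2 hg
    · have h1 := sub_smul_dslope g 0 w
      rw [smul_eq_mul, sub_zero, hg0] at h1
      rw [h w, sum_range_succ]
      linear_combination (-w ^ n) * h1

theorem hasResidueAt_exp_div_pow (L c : ℂ) (j : ℕ) :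
    HasResidueAt (fun z => Complex.exp ((z - c) * L) / (z - c) ^ (j + 1)) c
      (L ^ j / j.factorial) := by
  obtain ⟨g, hg, h⟩ := exists_exp_mul_eq L (j + 1)
  refine ⟨j, fun i => L ^ (j - i) / (j - i).factorial, fun z => g (z - c), ?_, by simp, ?_⟩
  · have : Differentiable ℂ fun z => g (z - c) := hg.comp (by fun_prop)
    exact this.analyticAt c
  · filter_upwards [self_mem_nhdsWithin] with z hz
    have hz0 : z - c ≠ 0 := sub_ne_zero.2 hz
    rw [h, add_div, mul_div_cancel_left₀ _ (pow_ne_zero _ hz0), sum_div, ← sum_range_reflect]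
    congr 1
    refine sum_congr rfl fun i hi => ?_
    have hij : i ≤ j := Nat.lt_succ_iff.1 (mem_range.1 hi)
    have h1 : j + 1 - 1 - i = j - i := by omega
    have h2 : (z - c) ^ (j + 1) = (z - c) ^ (j - i) * (z - c) ^ (i + 1) := by
      rw [← pow_add]; congr 1; omega
    rw [h1, h2]
    field_simp

/-- `ζ(s)^k / s` minus its principal parts at `0` and `1` is entire. -/
theorem exists_zeta_pow_div_eq (k : ℕ) : ∃ (c : ℂ) (a : ℕ → ℂ) (H : ℂ → ℂ), Differentiable ℂ H ∧
    ∀ s, s ≠ 0 → s ≠ 1 → riemannZeta s ^ k / s =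
      c / s + ∑ j ∈ range k, a j / (s - 1) ^ (j + 1) + H s := by
  set Z : ℂ → ℂ := fun s => riemannZeta₁ s ^ k with hZ
  have hZd : Differentiable ℂ Z := differentiable_riemannZeta₁.pow k
  have hZs : ∀ s, s ≠ 1 → Z s = (s - 1) ^ k * riemannZeta s ^ k := by
    intro s hs
    rw [hZ]
    have h1 := riemannZeta_eq_inv_sub_mul hs
    have : s - 1 ≠ 0 := sub_ne_zero.2 hs
    simp only
    rw [h1, ← mul_pow]
    field_simp
  -- The residue of ζ(s)^k/s at s = 0. Subtracting c(s-1)^k makes ((s-1)ζ(s))^k vanish at 0, so the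
  -- difference is s·G(s) with G entire.
  set c := riemannZeta 0 ^ k
  obtain ⟨b0, G, hG, hG'⟩ := exists_eq_sum_add_pow_mul
    (f := fun s => Z s - c * (s - 1) ^ k) (by fun_prop) 0 1
  have hb0 : b0 0 = 0 := by
    have := hG' 0
    rw [hZs 0 zero_ne_one] at this
    simp at this
    rw [← this]; ring
  obtain ⟨b, H, hH, hH'⟩ := exists_eq_sum_add_pow_mul hG 1 k
  -- Dividing the Taylor expansion of G at 1 by (s-1)^k turns its first k terms into the principal
  -- part, in reversed order.
  refine ⟨c, fun j => b (k - 1 - j), H, hH, fun s h0 h1 => ?_⟩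
  have hs1 : s - 1 ≠ 0 := sub_ne_zero.2 h1
  have hpow : (s - 1) ^ k ≠ 0 := pow_ne_zero k hs1
  have e1 := hG' s
  have e2 := hH' s
  have e3 := hZs s h1
  simp only [sum_range_one, hb0, sub_zero, zero_mul, pow_one, zero_add] at e1
  rw [← sum_range_reflect]
  have e4 : ∑ j ∈ range k, b (k - 1 - (k - 1 - j)) / (s - 1) ^ (k - 1 - j + 1) =
      (∑ j ∈ range k, b j * (s - 1) ^ j) / (s - 1) ^ k := by
    rw [sum_div]
    refine sum_congr rfl fun j hj => ?_
    have hj := mem_range.1 hj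
    have h1 : k - 1 - (k - 1 - j) = j := by omega
    have h2 : (s - 1) ^ k = (s - 1) ^ (k - 1 - j + 1) * (s - 1) ^ j := by
      rw [← pow_add]; congr 1; omega
    rw [h1, h2]
    field_simp
  rw [e4]
  have e5 : riemannZeta s ^ k = Z s / (s - 1) ^ k := by
    rw [e3]; field_simp
  have e6 : Z s = c * (s - 1) ^ k + s * G s := by linear_combination e1
  rw [e5, e6, e2]
  field_simp
  ring

/-- The residue at `s = 1` of `ζ(s)^k x^s / s`, where `a` lists the polar coefficients of
`ζ(s)^k / s`. -/
noncomputable def mainTerm (k : ℕ) (a : ℕ → ℂ) (x : ℝ) : ℂ :=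
  x * ∑ j ∈ range k, a j * ((Real.log x : ℂ) ^ j / j.factorial)

/-- Near s = 1 the terms c/s and H are analytic. In the others, x^s = x·exp((s-1) log x) pairs the
pole of order j+1 with the coefficient (log x)^j/j!. -/
theorem hasResidueAt_mainTerm {k : ℕ} {c : ℂ} {a : ℕ → ℂ} {H : ℂ → ℂ} (hH : Differentiable ℂ H)
    (h : ∀ s, s ≠ 0 → s ≠ 1 → riemannZeta s ^ k / s =
      c / s + ∑ j ∈ range k, a j / (s - 1) ^ (j + 1) + H s) {x : ℝ} (hx : 0 < x) :
    HasResidueAt (fun s : ℂ => riemannZeta s ^ k * ((x : ℂ) ^ s / s)) 1 (mainTerm k a x) := by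
  have hx0 : (x : ℂ) ≠ 0 := by exact_mod_cast hx.ne'
  have hexp : ∀ s : ℂ, (x : ℂ) ^ s = x * Complex.exp ((s - 1) * Real.log x) := by
    intro s
    rw [Complex.cpow_def_of_ne_zero hx0, ← Complex.ofReal_log hx.le]
    nth_rewrite 2 [← Real.exp_log hx]
    rw [Complex.ofReal_exp, ← Complex.exp_add]
    congr 1; ring
  have hd : DifferentiableOn ℂ (fun s : ℂ => (x : ℂ) ^ s * (c / s + H s)) {0}ᶜ := by
    intro s hs
    have hs0 : s ≠ 0 := hs
    refine DifferentiableAt.differentiableWithinAt ?_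
    refine DifferentiableAt.mul ?_ ?_
    · exact DifferentiableAt.const_cpow differentiableAt_id (Or.inl hx0)
    · exact (DifferentiableAt.div (by fun_prop) (by fun_prop) hs0).add (hH s)
  have han : AnalyticAt ℂ (fun s : ℂ => (x : ℂ) ^ s * (c / s + H s)) 1 :=
    hd.analyticAt (isOpen_compl_singleton.mem_nhds (by simp))
  have h1 := (HasResidueAt.of_analyticAt han).add ((HasResidueAt.sum (range k) fun j _ =>
    (hasResidueAt_exp_div_pow (Real.log x) 1 j).const_mul (a j)).const_mul x)
  rw [zero_add] at h1
  refine h1.congr ?_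
  have hne : ∀ᶠ s : ℂ in nhdsWithin 1 {1}ᶜ, s ≠ 0 :=
    (continuousAt_id.eventually_ne one_ne_zero).filter_mono nhdsWithin_le_nhds
  filter_upwards [self_mem_nhdsWithin, hne] with s hs1 hs0
  have e := h s hs0 hs1
  calc riemannZeta s ^ k * ((x : ℂ) ^ s / s) = (x : ℂ) ^ s * (riemannZeta s ^ k / s) := by ring
    _ = (x : ℂ) ^ s * (c / s + H s) +
        (x : ℂ) ^ s * ∑ j ∈ range k, a j / (s - 1) ^ (j + 1) := by rw [e]; ring
    _ = _ := by
      congr 1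
      rw [hexp s, mul_assoc, mul_sum]
      congr 1
      refine sum_congr rfl fun j _ => ?_
      ring

end DivisorRamanujan

/-! ### Growth of ζ by the trapezoidal rule -/

namespace DivisorRamanujan
open Finset

/-- `(s - 1)` times the trapezoidal error of `∫_{m+1}^{m+2} x^{-s} dx`. -/
noncomputable def trapezoidTerm (m : ℕ) (s : ℂ) : ℂ :=
  (s - 1) * ((((m : ℂ) + 1) ^ (-s) + ((m : ℂ) + 1 + 1) ^ (-s)) / 2) +
    (((m : ℂ) + 1 + 1) ^ (1 - s) - ((m : ℂ) + 1) ^ (1 - s))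

theorem hasDerivAt_add_ofReal_cpow {a h : ℝ} (hah : 0 < a + h) (r : ℂ) :
    HasDerivAt (fun x : ℝ => ((a : ℂ) + x) ^ r) (r * ((a : ℂ) + h) ^ (r - 1)) h := by
  have h1 : HasDerivAt (fun z : ℂ => (a : ℂ) + z) 1 (h : ℂ) := (hasDerivAt_id _).const_add _
  have h2 : (a : ℂ) + (h : ℂ) ∈ Complex.slitPlane := by
    left
    simpa using hah
  simpa using (h1.cpow_const (c := r) h2).comp_ofReal

theorem norm_add_ofReal_cpow {a h : ℝ} (hah : 0 < a + h) (r : ℂ) :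
    ‖((a : ℂ) + h) ^ r‖ = (a + h) ^ r.re := by
  rw [← Complex.ofReal_add, Complex.norm_cpow_eq_rpow_re_of_pos hah]

/-- Regarded as a function of the length x of the panel, the error vanishes at x = 0, and so does
the bracket in its derivative. The derivative of that bracket is s(s+1)x(a+x)^(-s-2), so two
applications of the mean value inequality suffice. -/
theorem norm_trapezoidTerm_le (m : ℕ) {s : ℂ} (hs : -2 ≤ s.re) :
    ‖trapezoidTerm m s‖ ≤ ‖s - 1‖ * (‖s‖ * ‖s + 1‖) * ((m : ℝ) + 1) ^ (-(s.re + 2)) := by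
  set a : ℝ := (m : ℝ) + 1 with ha
  have ha0 : 0 < a := by positivity
  have hac : ((m : ℂ) + 1) = (a : ℂ) := by rw [ha]; push_cast; rfl
  set B := ‖s‖ * ‖s + 1‖ * a ^ (-(s.re + 2)) with hB
  have hB0 : 0 ≤ B := by positivity
  have hψ : ∀ h ∈ Set.Icc (0 : ℝ) 1,
      ‖(a : ℂ) ^ (-s) - ((a : ℂ) + h) ^ (-s) - s * h * ((a : ℂ) + h) ^ (-s - 1)‖ ≤ B := by
    intro h hh
    have hd : ∀ x ∈ Set.Icc (0 : ℝ) 1, HasDerivWithinAt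
        (fun x : ℝ => (a : ℂ) ^ (-s) - ((a : ℂ) + x) ^ (-s) - s * x * ((a : ℂ) + x) ^ (-s - 1))
        (s * (s + 1) * x * ((a : ℂ) + x) ^ (-s - 1 - 1)) (Set.Icc (0 : ℝ) 1) x := by
      intro x hx
      have hax : 0 < a + x := by linarith [hx.1]
      have h1 := hasDerivAt_add_ofReal_cpow hax (-s)
      have h2 := hasDerivAt_add_ofReal_cpow hax (-s - 1)
      have h3 : HasDerivAt (fun x : ℝ => s * (x : ℂ)) s x := by
        simpa using (Complex.ofRealCLM.hasDerivAt (x := x)).const_mul s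
      refine (((h1.const_sub _).sub (h3.mul h2)).congr_deriv ?_).hasDerivWithinAt
      ring
    have hb : ∀ x ∈ Set.Ico (0 : ℝ) 1, ‖s * (s + 1) * x * ((a : ℂ) + x) ^ (-s - 1 - 1)‖ ≤ B := by
      intro x hx
      have hax : 0 < a + x := by linarith [hx.1]
      rw [norm_mul, norm_mul, norm_mul, norm_add_ofReal_cpow hax, Complex.norm_real,
        Real.norm_of_nonneg hx.1, hB]
      have hre : (-s - 1 - 1).re = -(s.re + 2) := by simp; ring
      rw [hre]
      have h1 : (a + x) ^ (-(s.re + 2)) ≤ a ^ (-(s.re + 2)) :=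
        Real.rpow_le_rpow_of_nonpos ha0 (by linarith [hx.1]) (by linarith)
      calc ‖s‖ * ‖s + 1‖ * x * (a + x) ^ (-(s.re + 2))
          ≤ ‖s‖ * ‖s + 1‖ * 1 * a ^ (-(s.re + 2)) := by gcongr; exact hx.2.le
        _ = _ := by ring
    have := norm_image_sub_le_of_norm_deriv_le_segment' hd hb h hh
    simp only [Complex.ofReal_zero, add_zero, sub_self, mul_zero, zero_mul, sub_zero] at this
    exact this.trans (mul_le_of_le_one_right hB0 hh.2)
  have hd : ∀ x ∈ Set.Icc (0 : ℝ) 1, HasDerivWithinAt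
      (fun x : ℝ => (s - 1) * (x * (((a : ℂ) ^ (-s) + ((a : ℂ) + x) ^ (-s)) / 2)) +
        (((a : ℂ) + x) ^ (1 - s) - (a : ℂ) ^ (1 - s)))
      ((s - 1) / 2 * ((a : ℂ) ^ (-s) - ((a : ℂ) + x) ^ (-s) - s * x * ((a : ℂ) + x) ^ (-s - 1)))
      (Set.Icc (0 : ℝ) 1) x := by
    intro x hx
    have hax : 0 < a + x := by linarith [hx.1]
    have h1 := hasDerivAt_add_ofReal_cpow hax (-s)
    have h2 := hasDerivAt_add_ofReal_cpow hax (1 - s)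
    have h3 : HasDerivAt (fun x : ℝ => (x : ℂ)) 1 x := Complex.ofRealCLM.hasDerivAt
    refine ((((h3.mul ((h1.const_add _).div_const 2)).const_mul (s - 1)).add
      (h2.sub_const _)).congr_deriv ?_).hasDerivWithinAt
    have : 1 - s - 1 = -s := by ring
    rw [this]
    ring
  have hb : ∀ x ∈ Set.Ico (0 : ℝ) 1, ‖(s - 1) / 2 *
      ((a : ℂ) ^ (-s) - ((a : ℂ) + x) ^ (-s) - s * x * ((a : ℂ) + x) ^ (-s - 1))‖ ≤
      ‖s - 1‖ * B := by
    intro x hx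
    rw [norm_mul, norm_div]
    have h1 := hψ x ⟨hx.1, hx.2.le⟩
    have h2 : ‖s - 1‖ / ‖(2 : ℂ)‖ ≤ ‖s - 1‖ := by
      rw [Complex.norm_ofNat]; linarith [norm_nonneg (s - 1)]
    gcongr
  have := norm_image_sub_le_of_norm_deriv_le_segment_01' hd hb
  rw [trapezoidTerm, hac]
  simp only [Complex.ofReal_zero, add_zero, sub_self, mul_zero, zero_mul, sub_zero,
    Complex.ofReal_one, one_mul] at this
  refine this.trans (le_of_eq ?_)
  rw [hB]; ring

theorem sum_trapezoidTerm (N : ℕ) (s : ℂ) : ∑ m ∈ range N, trapezoidTerm m s =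
    (s - 1) * (∑ m ∈ range N, ((m : ℂ) + 1) ^ (-s) - 1 / 2 + ((N : ℂ) + 1) ^ (-s) / 2) +
      ((N : ℂ) + 1) ^ (1 - s) - 1 := by
  induction N with
  | zero => simp
  | succ N ih =>
    rw [sum_range_succ, ih, sum_range_succ, trapezoidTerm]
    push_cast
    ring

theorem differentiable_trapezoidTerm (m : ℕ) : Differentiable ℂ (trapezoidTerm m) := by
  have h1 : ((m : ℂ) + 1) ≠ 0 := by exact_mod_cast Nat.succ_ne_zero m
  have h2 : ((m : ℂ) + 1 + 1) ≠ 0 := by exact_mod_cast Nat.succ_ne_zero (m + 1)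
  have hp : ∀ (c : ℂ) (f : ℂ → ℂ), c ≠ 0 → Differentiable ℂ f →
      Differentiable ℂ fun s => c ^ (f s) := fun c f hc hf s =>
    (hf s).const_cpow (Or.inl hc)
  unfold trapezoidTerm
  refine Differentiable.add (Differentiable.mul (by fun_prop) (Differentiable.div_const
    (Differentiable.add ?_ ?_) 2)) (Differentiable.sub ?_ ?_) <;>
  exact hp _ _ (by assumption) (by fun_prop)

theorem summable_add_one_rpow {c : ℝ} (hc : 1 < c) :
    Summable fun m : ℕ => ((m : ℝ) + 1) ^ (-c) := by
  have := (summable_nat_add_iff 1).2 (Real.summable_nat_rpow.2 (by linarith : -c < -1))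
  simpa using this

theorem summable_trapezoidTerm {s : ℂ} (hs : -1 < s.re) :
    Summable fun m => trapezoidTerm m s :=
  Summable.of_norm_bounded ((summable_add_one_rpow (by linarith : 1 < s.re + 2)).mul_left _)
    fun m => norm_trapezoidTerm_le m (by linarith)

theorem differentiableAt_tsum_trapezoidTerm {s : ℂ} (hs : -1 < s.re) :
    DifferentiableAt ℂ (fun s => ∑' m, trapezoidTerm m s) s := by
  obtain ⟨δ, hδ, hδs⟩ := exists_between hs
  set R : ℝ := ‖s‖ + 1
  set U : Set ℂ := {z | δ < z.re} ∩ Metric.ball 0 R with hU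
  have hUo : IsOpen U := (isOpen_lt continuous_const Complex.continuous_re).inter Metric.isOpen_ball
  have hsU : s ∈ U := ⟨hδs, by simp [R]⟩
  refine (Complex.differentiableOn_tsum_of_summable_norm
    (u := fun m : ℕ => (R + 1) * (R * (R + 1)) * ((m : ℝ) + 1) ^ (-(δ + 2)))
    ((summable_add_one_rpow (by linarith : 1 < δ + 2)).mul_left _)
    (fun m => (differentiable_trapezoidTerm m).differentiableOn) hUo ?_).differentiableAt
    (hUo.mem_nhds hsU)
  intro m w hw
  have hw1 : δ < w.re := hw.1
  have hw2 : ‖w‖ ≤ R := by simpa using (Metric.mem_ball.1 hw.2).le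
  refine (norm_trapezoidTerm_le m (by linarith)).trans ?_
  have h1 : ‖w - 1‖ ≤ R + 1 := (norm_sub_le _ _).trans (by simpa using hw2)
  have h2 : ‖w + 1‖ ≤ R + 1 := (norm_add_le _ _).trans (by simpa using hw2)
  have h3 : ((m : ℝ) + 1) ^ (-(w.re + 2)) ≤ ((m : ℝ) + 1) ^ (-(δ + 2)) :=
    Real.rpow_le_rpow_of_exponent_le (by linarith [Nat.cast_nonneg (α := ℝ) m]) (by linarith)
  have hR : 0 ≤ R := by positivity
  gcongr

theorem natCast_add_one_eq (m : ℕ) : (m : ℂ) + 1 = (((m : ℝ) + 1 : ℝ) : ℂ) := by push_cast; rfl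

theorem norm_natCast_add_one_cpow (m : ℕ) (s : ℂ) :
    ‖((m : ℂ) + 1) ^ s‖ = ((m : ℝ) + 1) ^ s.re := by
  rw [natCast_add_one_eq, Complex.norm_cpow_eq_rpow_re_of_pos (by positivity)]

theorem tendsto_natCast_add_one_cpow {s : ℂ} (hs : s.re < 0) :
    Filter.Tendsto (fun N : ℕ => ((N : ℂ) + 1) ^ s) Filter.atTop (nhds 0) := by
  rw [tendsto_zero_iff_norm_tendsto_zero]
  simp_rw [norm_natCast_add_one_cpow]
  have h := (tendsto_rpow_neg_atTop (by linarith : 0 < -s.re)).comp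
    (Filter.tendsto_atTop_add_const_right _ (1 : ℝ) (tendsto_natCast_atTop_atTop (R := ℝ)))
  simpa [Function.comp_def] using h

theorem riemannZeta₁_eq_tsum_of_one_lt_re {s : ℂ} (hs : 1 < s.re) :
    riemannZeta₁ s = (s - 1) / 2 + 1 + ∑' m, trapezoidTerm m s := by
  have hs1 : s ≠ 1 := fun h => by simp [h] at hs
  have hz : riemannZeta₁ s = (s - 1) * riemannZeta s := by
    rw [riemannZeta_eq_inv_sub_mul hs1, mul_inv_cancel_left₀ (sub_ne_zero.2 hs1)]
  have hsum : HasSum (fun m : ℕ => ((m : ℂ) + 1) ^ (-s)) (riemannZeta s) := by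
    rw [zeta_eq_tsum_one_div_nat_add_one_cpow hs]
    have h1 : Summable fun m : ℕ => ((m : ℂ) + 1) ^ (-s) :=
      Summable.of_norm_bounded (summable_add_one_rpow hs) fun m => by
        rw [norm_natCast_add_one_cpow, Complex.neg_re]
    simpa [Complex.cpow_neg] using h1.hasSum
  have h1 := (summable_trapezoidTerm (by linarith : -1 < s.re)).hasSum.tendsto_sum_nat
  simp_rw [sum_trapezoidTerm] at h1
  have h2 := ((((hsum.tendsto_sum_nat.sub_const (1 / 2)).add
    ((tendsto_natCast_add_one_cpow (s := -s) (by simp; linarith)).div_const 2)).const_mul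
      (s - 1)).add (tendsto_natCast_add_one_cpow (s := 1 - s) (by simp; linarith))).sub_const 1
  rw [tendsto_nhds_unique h1 h2, hz]
  ring

/-- The series of trapezoidal errors is holomorphic for Re s > -1, so the formula extends from Re s
> 1 by the identity theorem. -/
theorem riemannZeta₁_eq_tsum {s : ℂ} (hs : -1 < s.re) :
    riemannZeta₁ s = (s - 1) / 2 + 1 + ∑' m, trapezoidTerm m s := by
  set U : Set ℂ := {z | -1 < z.re}
  have hUo : IsOpen U := isOpen_lt continuous_const Complex.continuous_re
  have hpre : IsPreconnected U := (convex_halfSpace_re_gt (-1)).isPreconnected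
  have hf : AnalyticOnNhd ℂ riemannZeta₁ U :=
    differentiable_riemannZeta₁.differentiableOn.analyticOnNhd hUo
  have hg : AnalyticOnNhd ℂ (fun s => (s - 1) / 2 + 1 + ∑' m, trapezoidTerm m s) U := by
    refine DifferentiableOn.analyticOnNhd (fun z hz => ?_) hUo
    exact (DifferentiableAt.add (by fun_prop)
      (differentiableAt_tsum_trapezoidTerm hz)).differentiableWithinAt
  refine hf.eqOn_of_preconnected_of_eventuallyEq hg hpre (z₀ := 2) ?_ ?_ hs
  · change (-1 : ℝ) < (2 : ℂ).re
    norm_num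
  · have : {z : ℂ | 1 < z.re} ∈ nhds (2 : ℂ) :=
      (isOpen_lt continuous_const Complex.continuous_re).mem_nhds (by norm_num)
    filter_upwards [this] with z hz
    exact riemannZeta₁_eq_tsum_of_one_lt_re hz

theorem riemannZeta₁_eq_sum_add_tsum (N : ℕ) {s : ℂ} (hs : -1 < s.re) :
    riemannZeta₁ s = (s - 1) * (∑ m ∈ range N, ((m : ℂ) + 1) ^ (-s) + ((N : ℂ) + 1) ^ (-s) / 2) +
      ((N : ℂ) + 1) ^ (1 - s) + ∑' m, trapezoidTerm (m + N) s := by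
  rw [riemannZeta₁_eq_tsum hs, ← (summable_trapezoidTerm hs).sum_add_tsum_nat_add N,
    sum_trapezoidTerm]
  ring

/-- The exponent Re s + 2 is split: a part c > 1 makes the sum over m converge, and the rest gives
decay in N. -/
theorem norm_tsum_trapezoidTerm_le (N : ℕ) {s : ℂ} {c : ℝ} (hc : 1 < c) (hs : c ≤ s.re + 2) :
    ‖∑' m, trapezoidTerm (m + N) s‖ ≤ ‖s - 1‖ * (‖s‖ * ‖s + 1‖) *
      (((N : ℝ) + 1) ^ (-(s.re + 2 - c)) * ∑' m : ℕ, ((m : ℝ) + 1) ^ (-c)) := by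
  rw [← tsum_mul_left, ← tsum_mul_left]
  have hsum := (((summable_add_one_rpow hc).mul_left
    (((N : ℝ) + 1) ^ (-(s.re + 2 - c)))).mul_left (‖s - 1‖ * (‖s‖ * ‖s + 1‖)))
  refine tsum_of_norm_bounded hsum.hasSum fun m => ?_
  refine (norm_trapezoidTerm_le (m + N) (by linarith)).trans ?_
  gcongr
  have h1 : -(s.re + 2) = -(s.re + 2 - c) + -c := by ring
  have hm : (0 : ℝ) ≤ m := Nat.cast_nonneg m
  have hN : (0 : ℝ) ≤ N := Nat.cast_nonneg N
  push_cast
  rw [h1, Real.rpow_add (by positivity)]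
  refine mul_le_mul ?_ ?_ (by positivity) (by positivity)
  · exact Real.rpow_le_rpow_of_nonpos (by positivity) (by linarith) (by linarith)
  · exact Real.rpow_le_rpow_of_nonpos (by positivity) (by linarith) (by linarith)

theorem ne_one_of_one_le_abs_im {s : ℂ} (hs : 1 ≤ |s.im|) : s ≠ 1 := by
  rintro rfl
  norm_num at hs

/-- A crude bound, needed only to make the horizontal sides negligible when the contour is moved. -/
theorem norm_riemannZeta_le_sq : ∃ C : ℝ, ∀ s : ℂ, 0 ≤ s.re → s.re ≤ 2 → 1 ≤ |s.im| →
    ‖riemannZeta s‖ ≤ C * |s.im| ^ 2 := by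
  set K : ℝ := ∑' m : ℕ, ((m : ℝ) + 1) ^ (-2 : ℝ) with hK
  have hK0 : 0 ≤ K := tsum_nonneg fun m => by positivity
  refine ⟨2 + 12 * K, fun s h0 h2 ht => ?_⟩
  have hs1 := ne_one_of_one_le_abs_im ht
  have hn1 : 1 ≤ ‖s - 1‖ := ht.trans (by simpa using Complex.abs_im_le_norm (s - 1))
  have hns : ‖s‖ ≤ 3 * |s.im| := by
    have := Complex.norm_le_abs_re_add_abs_im s
    rw [abs_of_nonneg h0] at this
    linarith
  have hns' : ‖s + 1‖ ≤ 4 * |s.im| := by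
    have := norm_add_le s 1
    rw [norm_one] at this
    linarith
  have h1 := norm_tsum_trapezoidTerm_le 0 (s := s) one_lt_two (by linarith)
  simp only [Nat.cast_zero, zero_add, Real.one_rpow, one_mul, add_zero] at h1
  rw [riemannZeta_eq_inv_sub_mul hs1, norm_mul, norm_inv, riemannZeta₁_eq_tsum (by linarith),
    inv_mul_le_iff₀ (by linarith)]
  have hsq : 1 ≤ |s.im| ^ 2 := one_le_pow₀ ht
  calc ‖(s - 1) / 2 + 1 + ∑' m, trapezoidTerm m s‖
      ≤ ‖(s - 1) / 2‖ + ‖(1 : ℂ)‖ + ‖∑' m, trapezoidTerm m s‖ := norm_add₃_le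
    _ ≤ ‖s - 1‖ + ‖s - 1‖ + ‖s - 1‖ * ((3 * |s.im|) * (4 * |s.im|)) * K := by
      refine add_le_add (add_le_add ?_ (by simpa using hn1)) (h1.trans ?_)
      · rw [norm_div, Complex.norm_ofNat]; linarith
      · gcongr
    _ = ‖s - 1‖ * (2 + 12 * K * |s.im| ^ 2) := by ring
    _ ≤ ‖s - 1‖ * ((2 + 12 * K) * |s.im| ^ 2) := by
      gcongr
      nlinarith

/-- Cutting at N = ⌊|t|⌋ makes the tail factor |s||s+1|(N+1)^(ε-2) of size |t|^ε, and the first N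
terms are bounded by ∑ 1/n over n ≤ N. -/
theorem norm_riemannZeta_one_add_le {ε : ℝ} (hε : 0 < ε) (hε1 : ε ≤ 1) :
    ∃ C : ℝ, ∀ s : ℂ, s.re = 1 → 1 ≤ |s.im| → ‖riemannZeta s‖ ≤ C * |s.im| ^ ε := by
  set K : ℝ := ∑' m : ℕ, ((m : ℝ) + 1) ^ (-(1 + ε)) with hK
  have hKs := summable_add_one_rpow (by linarith : 1 < 1 + ε)
  have hK0 : 0 ≤ K := tsum_nonneg fun m => by positivity
  refine ⟨2 * K + 2 + 12 * K, fun s hs ht => ?_⟩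
  have hs1 := ne_one_of_one_le_abs_im ht
  set t := |s.im| with hteq
  have ht0 : 0 < t := by linarith
  have hn1 : t ≤ ‖s - 1‖ := by simpa using Complex.abs_im_le_norm (s - 1)
  have hns : ‖s‖ ≤ 2 * t := by
    have := Complex.norm_le_abs_re_add_abs_im s
    rw [hs, abs_one] at this
    linarith
  have hns' : ‖s + 1‖ ≤ 3 * t := by
    have := norm_add_le s 1
    rw [norm_one] at this
    linarith
  set N := ⌊t⌋₊ with hN
  have hN1 : (N : ℝ) ≤ t := Nat.floor_le ht0.le
  have hN2 : t < (N : ℝ) + 1 := Nat.lt_floor_add_one t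
  have h1 := norm_tsum_trapezoidTerm_le N (s := s) (by linarith : 1 < 1 + ε) (by linarith)
  rw [riemannZeta_eq_inv_sub_mul hs1, norm_mul, norm_inv,
    riemannZeta₁_eq_sum_add_tsum N (by linarith), inv_mul_le_iff₀ (by linarith)]
  have hte : 1 ≤ t ^ ε := Real.one_le_rpow ht hε.le
  have hA : ‖∑ m ∈ range N, ((m : ℂ) + 1) ^ (-s)‖ ≤ t ^ ε * K := by
    refine (norm_sum_le _ _).trans ?_
    rw [hK]
    refine le_trans ?_ (mul_le_mul_of_nonneg_left
      (hKs.sum_le_tsum (range N) fun m _ => by positivity) (by positivity))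
    rw [mul_sum]
    refine sum_le_sum fun m hm => ?_
    have hm' : (m : ℝ) + 1 ≤ N := by exact_mod_cast mem_range.1 hm
    rw [norm_natCast_add_one_cpow, Complex.neg_re, hs]
    have : (-1 : ℝ) = ε + -(1 + ε) := by ring
    rw [this, Real.rpow_add (by positivity)]
    gcongr
    linarith
  have hBd : ‖((N : ℂ) + 1) ^ (-s) / 2‖ ≤ 1 := by
    rw [norm_div, norm_natCast_add_one_cpow, Complex.neg_re, hs, Complex.norm_ofNat]
    have : ((N : ℝ) + 1) ^ (-1 : ℝ) ≤ 1 :=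
      Real.rpow_le_one_of_one_le_of_nonpos (by linarith) (by norm_num)
    linarith
  have hCd : ‖((N : ℂ) + 1) ^ (1 - s)‖ = 1 := by
    rw [norm_natCast_add_one_cpow, Complex.sub_re, hs]
    simp
  have hD : ((N : ℝ) + 1) ^ (-(s.re + 2 - (1 + ε))) ≤ t ^ ε * (t * t)⁻¹ := by
    refine (Real.rpow_le_rpow_of_nonpos ht0 hN2.le (by linarith)).trans (le_of_eq ?_)
    have : -(s.re + 2 - (1 + ε)) = ε - 2 := by rw [hs]; ring
    rw [this, Real.rpow_sub ht0, div_eq_mul_inv]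
    norm_num [sq]
  calc _ ≤ ‖(s - 1) * (∑ m ∈ range N, ((m : ℂ) + 1) ^ (-s) + ((N : ℂ) + 1) ^ (-s) / 2)‖ +
        ‖((N : ℂ) + 1) ^ (1 - s)‖ + ‖∑' m, trapezoidTerm (m + N) s‖ := norm_add₃_le
    _ ≤ ‖s - 1‖ * (t ^ ε * K + 1) + ‖s - 1‖ * 1 +
        ‖s - 1‖ * ((2 * t) * (3 * t)) * (t ^ ε * (t * t)⁻¹ * K) := by
      refine add_le_add (add_le_add ?_ ?_) (h1.trans ?_)
      · rw [norm_mul]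
        gcongr
        exact (norm_add_le _ _).trans (add_le_add hA hBd)
      · rw [hCd]; linarith
      · gcongr
    _ = ‖s - 1‖ * (t ^ ε * K + 2 + 6 * K * t ^ ε) := by field_simp; ring
    _ ≤ _ := by
      gcongr
      nlinarith [mul_nonneg hK0 (by linarith : 0 ≤ t ^ ε)]

/-! ### The functional equation on the imaginary axis -/

/-- Reflection at it, combined with Γ(1+it) = it·Γ(it) and the fact that Γ(1+it) is the conjugate of
Γ(1-it). -/
theorem norm_Gamma_one_sub_mul_I_sq {t : ℝ} (ht : t ≠ 0) :
    ‖Complex.Gamma (1 - t * Complex.I)‖ ^ 2 = Real.pi * t / Real.sinh (Real.pi * t) := by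
  have hz : (t * Complex.I : ℂ) ≠ 0 := mul_ne_zero (by exact_mod_cast ht) Complex.I_ne_zero
  have h1 := Complex.Gamma_mul_Gamma_one_sub (t * Complex.I)
  have h2 := Complex.Gamma_add_one (t * Complex.I) hz
  have h3 : (t * Complex.I + 1 : ℂ) = (starRingEnd ℂ) (1 - t * Complex.I) := by
    simp [add_comm]
  rw [h3, Complex.Gamma_conj] at h2
  have h4 : Complex.sin (Real.pi * (t * Complex.I)) = Real.sinh (Real.pi * t) * Complex.I := by
    rw [← mul_assoc, Complex.sin_mul_I]; push_cast; rfl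
  rw [h4] at h1
  have h5 : (starRingEnd ℂ) (Complex.Gamma (1 - t * Complex.I)) * Complex.Gamma (1 - t * Complex.I)
      = ((Real.pi * t / Real.sinh (Real.pi * t) : ℝ) : ℂ) := by
    rw [h2, mul_assoc, h1]
    have hsh : (Real.sinh (Real.pi * t) : ℂ) ≠ 0 := by
      rw [Complex.ofReal_ne_zero, Ne, Real.sinh_eq_zero]
      exact mul_ne_zero Real.pi_ne_zero ht
    push_cast at hsh ⊢
    field_simp
  rw [Complex.conj_mul'] at h5
  exact_mod_cast h5

/-- The functional equation gives exactly |ζ(it)|² = (t/2π) tanh(πt/2) |ζ(1-it)|², and |tanh| ≤ 1.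
-/
theorem norm_riemannZeta_mul_I_sq_le {t : ℝ} (ht : t ≠ 0) :
    ‖riemannZeta (t * Complex.I)‖ ^ 2 ≤ |t| * ‖riemannZeta (1 - t * Complex.I)‖ ^ 2 := by
  have hre : (1 - t * Complex.I : ℂ).re = 1 := by simp
  have h := riemannZeta_one_sub (s := 1 - t * Complex.I)
    (fun n hn => by
      have := congrArg Complex.re hn
      rw [hre] at this
      simp at this
      have h0 : (0 : ℝ) ≤ n := Nat.cast_nonneg n
      linarith)
    (fun h1 => by
      have := congrArg Complex.im h1
      simp at this
      exact ht this)
  rw [sub_sub_cancel] at h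
  have hcos : Complex.cos (Real.pi * (1 - t * Complex.I) / 2) =
      Real.sinh (Real.pi * t / 2) * Complex.I := by
    have : (Real.pi * (1 - t * Complex.I) / 2 : ℂ) =
        Real.pi / 2 - ((Real.pi * t / 2 : ℝ) : ℂ) * Complex.I := by push_cast; ring
    rw [this, Complex.cos_pi_div_two_sub, Complex.sin_mul_I]
    push_cast; rfl
  have hpow : ‖(2 * (Real.pi : ℂ)) ^ (-(1 - t * Complex.I))‖ = (2 * Real.pi)⁻¹ := by
    have : (2 * (Real.pi : ℂ)) = ((2 * Real.pi : ℝ) : ℂ) := by push_cast; rfl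
    rw [this, Complex.norm_cpow_eq_rpow_re_of_pos (by positivity), Complex.neg_re, hre,
      Real.rpow_neg_one]
  rw [h, hcos, norm_mul, norm_mul, norm_mul, norm_mul, hpow, norm_mul, Complex.norm_I,
    Complex.norm_ofNat, Complex.norm_real, mul_pow, mul_pow, mul_pow,
    norm_Gamma_one_sub_mul_I_sq ht, mul_one, Real.norm_eq_abs, sq_abs]
  refine mul_le_mul_of_nonneg_right ?_ (sq_nonneg _)
  have hsinh : Real.sinh (Real.pi * t) =
      2 * Real.sinh (Real.pi * t / 2) * Real.cosh (Real.pi * t / 2) := by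
    rw [← Real.sinh_two_mul]; congr 1; ring
  set u := Real.pi * t / 2 with hu
  have hu0 : u ≠ 0 := by
    rw [hu]; exact div_ne_zero (mul_ne_zero Real.pi_ne_zero ht) two_ne_zero
  have hsh : Real.sinh u ≠ 0 := fun h => hu0 (Real.sinh_eq_zero.1 h)
  have hch : 0 < Real.cosh u := Real.cosh_pos u
  have habs : |Real.sinh u| ≤ Real.cosh u := by
    rw [Real.abs_sinh]
    have := (Real.sinh_lt_cosh |u|).le
    rwa [Real.cosh_abs] at this
  have hpi := Real.pi_gt_three
  have e : (2 * (2 * Real.pi)⁻¹) ^ 2 * (Real.pi * t / Real.sinh (Real.pi * t)) * Real.sinh u ^ 2 =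
      t * (Real.sinh u / Real.cosh u) / (2 * Real.pi) := by
    rw [hsinh]; field_simp
  rw [e]
  calc t * (Real.sinh u / Real.cosh u) / (2 * Real.pi)
      ≤ |t * (Real.sinh u / Real.cosh u)| / (2 * Real.pi) := by gcongr; exact le_abs_self _
    _ = |t| * (|Real.sinh u| / Real.cosh u) / (2 * Real.pi) := by
      rw [abs_mul, abs_div, abs_of_pos hch]
    _ ≤ |t| * 1 / 1 := by
      gcongr
      · exact (div_le_one hch).2 habs
      · linarith
    _ = |t| := by ring

theorem norm_riemannZeta_mul_I_le {ε : ℝ} (hε : 0 < ε) (hε1 : ε ≤ 1) :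
    ∃ C : ℝ, ∀ t : ℝ, 1 ≤ |t| → ‖riemannZeta (t * Complex.I)‖ ≤ C * |t| ^ (1 / 2 + ε) := by
  obtain ⟨C, hC⟩ := norm_riemannZeta_one_add_le hε hε1
  refine ⟨C, fun t ht => ?_⟩
  have ht0 : t ≠ 0 := fun h => by rw [h] at ht; norm_num at ht
  have h1 := norm_riemannZeta_mul_I_sq_le ht0
  have h2 := hC (1 - t * Complex.I) (by simp) (by simpa using ht)
  have him : |(1 - t * Complex.I : ℂ).im| = |t| := by simp
  rw [him] at h2
  have h3 : 0 ≤ C * |t| ^ ε := (norm_nonneg _).trans h2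
  have h4 : C * |t| ^ (1 / 2 + ε) = |t| ^ (1 / 2 : ℝ) * (C * |t| ^ ε) := by
    rw [Real.rpow_add (by linarith)]; ring
  rw [h4]
  refine abs_le_of_sq_le_sq (h1.trans ?_) (by positivity) |> (le_abs_self _).trans
  rw [mul_pow, ← Real.sqrt_eq_rpow, Real.sq_sqrt (abs_nonneg t)]
  gcongr

end DivisorRamanujan

/-! ### Iterated averages and Fourier inversion -/

namespace DivisorRamanujan
open Finset MeasureTheory
open scoped FourierTransform Convolution

/-- The entire function `(e^z - 1) / z`. -/
noncomputable def expSlope : ℂ → ℂ := dslope Complex.exp 0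

theorem differentiable_expSlope : Differentiable ℂ expSlope := by
  rw [← differentiableOn_univ]
  exact (Complex.differentiableOn_dslope Filter.univ_mem).2
    Complex.differentiable_exp.differentiableOn

theorem expSlope_of_ne {z : ℂ} (hz : z ≠ 0) : expSlope z = (Complex.exp z - 1) / z := by
  rw [expSlope, dslope_of_ne _ hz, slope_def_field, Complex.exp_zero, sub_zero]

theorem norm_expSlope_le {z : ℂ} (hz : z ≠ 0) :
    ‖expSlope z‖ ≤ (Real.exp z.re + 1) / ‖z‖ := by
  rw [expSlope_of_ne hz, norm_div]
  gcongr
  exact (norm_sub_le _ _).trans (by rw [Complex.norm_exp, norm_one])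

theorem norm_expSlope_mul_I_le_one (t : ℝ) : ‖expSlope (t * Complex.I)‖ ≤ 1 := by
  by_cases ht : t = 0
  · rw [ht, Complex.ofReal_zero, zero_mul, expSlope, dslope_same, Complex.deriv_exp,
      Complex.exp_zero, norm_one]
  · have hz : (t * Complex.I : ℂ) ≠ 0 := mul_ne_zero (by exact_mod_cast ht) Complex.I_ne_zero
    rw [expSlope_of_ne hz, norm_div, mul_comm]
    have h := Real.norm_exp_I_mul_ofReal_sub_one_le (x := t)
    have h1 : ‖Complex.I * (t : ℂ)‖ = ‖t‖ := by simp
    rw [h1]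
    exact div_le_one_of_le₀ h (norm_nonneg _)

theorem norm_expSlope_mul_I_le (t : ℝ) (ht : t ≠ 0) : ‖expSlope (t * Complex.I)‖ ≤ 2 / |t| := by
  have hz : (t * Complex.I : ℂ) ≠ 0 := mul_ne_zero (by exact_mod_cast ht) Complex.I_ne_zero
  have := norm_expSlope_le hz
  simp only [Complex.mul_re, Complex.ofReal_re, Complex.I_re, mul_zero, Complex.ofReal_im,
    Complex.I_im, mul_one, sub_zero, Real.exp_zero, norm_mul, Complex.norm_real, Complex.norm_I,
    Real.norm_eq_abs] at this
  norm_num at this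
  exact this

/-- The average of `f` over `[y, y + η]`. -/
noncomputable def shiftAvg (η : ℝ) (f : ℝ → ℂ) (y : ℝ) : ℂ :=
  (η : ℂ)⁻¹ * ∫ v in (0 : ℝ)..η, f (y + v)

/-- `f` weighted by `e^{-2y}`. -/
noncomputable def expWeight (f : ℝ → ℂ) (y : ℝ) : ℂ := Complex.exp (-(2 * y)) * f y

/-- The convolution kernel of `shiftAvg` acting on functions weighted by `e^{-2y}`. -/
noncomputable def avgKernel (η : ℝ) : ℝ → ℂ :=
  (Set.Ioc (-η) 0).indicator fun t => (η : ℂ)⁻¹ * Complex.exp (-(2 * t))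

theorem integrable_avgKernel (η : ℝ) : Integrable (avgKernel η) := by
  rw [avgKernel, integrable_indicator_iff measurableSet_Ioc]
  exact (Continuous.integrableOn_Icc (by fun_prop)).mono_set Set.Ioc_subset_Icc_self

/-- The average looks forward, over [y, y+η], so the kernel lives on (-η, 0]; its factor e^(-2t)
compensates the weight at y - t against the weight at y. -/
theorem avgKernel_convolution {η : ℝ} (hη : 0 < η) (f : ℝ → ℂ) :
    avgKernel η ⋆[ContinuousLinearMap.mul ℂ ℂ] expWeight f = expWeight (shiftAvg η f) := by
  ext y
  rw [convolution_def]
  have h1 : ∀ t : ℝ, (ContinuousLinearMap.mul ℂ ℂ) (avgKernel η t) (expWeight f (y - t)) =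
      (Set.Ioc (-η) 0).indicator
        (fun t => Complex.exp (-(2 * y)) * (η : ℂ)⁻¹ * f (y - t)) t := by
    intro t
    rw [ContinuousLinearMap.mul_apply', avgKernel, expWeight]
    by_cases ht : t ∈ Set.Ioc (-η) 0
    · rw [Set.indicator_of_mem ht, Set.indicator_of_mem ht]
      have : Complex.exp (-(2 * y)) = Complex.exp (-(2 * t)) * Complex.exp (-(2 * (y - t))) := by
        rw [← Complex.exp_add]; congr 1; ring
      rw [this]
      push_cast
      ring
    · rw [Set.indicator_of_notMem ht, Set.indicator_of_notMem ht, zero_mul]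
  simp_rw [h1]
  rw [integral_indicator measurableSet_Ioc, ← intervalIntegral.integral_of_le (by linarith),
    intervalIntegral.integral_const_mul, intervalIntegral.integral_comp_sub_left, expWeight,
    shiftAvg, intervalIntegral.integral_comp_add_left]
  simp only [sub_zero, add_zero, sub_neg_eq_add]
  ring

theorem integrable_expWeight_shiftAvg {η : ℝ} (hη : 0 < η) {f : ℝ → ℂ}
    (hf : Integrable (expWeight f)) : Integrable (expWeight (shiftAvg η f)) := by
  rw [← avgKernel_convolution hη]
  exact (integrable_avgKernel η).integrable_convolution _ hf

/-- At s = 2 + 2πiξ one average multiplies the transform by (e^(ηs)-1)/(ηs), a gain of one power of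
|s|. -/
theorem fourier_avgKernel {η : ℝ} (hη : 0 < η) (ξ : ℝ) :
    𝓕 (avgKernel η) ξ = expSlope (η * (2 + 2 * Real.pi * ξ * Complex.I)) := by
  set s : ℂ := 2 + 2 * Real.pi * ξ * Complex.I with hs
  have hs0 : s ≠ 0 := by
    intro h
    have := congrArg Complex.re h
    simp [hs] at this
  have hη0 : (η : ℂ) ≠ 0 := by exact_mod_cast hη.ne'
  rw [Real.fourier_real_eq_integral_exp_smul]
  have h1 : ∀ v : ℝ, Complex.exp (↑(-2 * Real.pi * v * ξ) * Complex.I) • avgKernel η v =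
      (Set.Ioc (-η) 0).indicator (fun t : ℝ => (η : ℂ)⁻¹ * Complex.exp (-s * t)) v := by
    intro v
    rw [avgKernel, smul_eq_mul]
    by_cases hv : v ∈ Set.Ioc (-η) 0
    · rw [Set.indicator_of_mem hv, Set.indicator_of_mem hv, mul_left_comm, ← Complex.exp_add]
      congr 2
      rw [hs]; push_cast; ring
    · rw [Set.indicator_of_notMem hv, Set.indicator_of_notMem hv, mul_zero]
  simp_rw [h1]
  rw [integral_indicator measurableSet_Ioc, ← intervalIntegral.integral_of_le (by linarith),
    intervalIntegral.integral_const_mul, integral_exp_mul_complex (neg_ne_zero.2 hs0),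
    expSlope_of_ne (mul_ne_zero hη0 hs0)]
  simp only [Complex.ofReal_zero, mul_zero, Complex.exp_zero, Complex.ofReal_neg, neg_mul_neg]
  rw [mul_comm s]
  field_simp
  ring

theorem integrable_expWeight_iterate {η : ℝ} (hη : 0 < η) {f : ℝ → ℂ}
    (hf : Integrable (expWeight f)) (j : ℕ) : Integrable (expWeight ((shiftAvg η)^[j] f)) := by
  induction j with
  | zero => exact hf
  | succ j ih =>
    rw [Function.iterate_succ_apply']
    exact integrable_expWeight_shiftAvg hη ih

theorem fourier_expWeight_iterate {η : ℝ} (hη : 0 < η) {f : ℝ → ℂ}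
    (hf : Integrable (expWeight f)) (j : ℕ) (ξ : ℝ) :
    𝓕 (expWeight ((shiftAvg η)^[j] f)) ξ =
      expSlope (η * (2 + 2 * Real.pi * ξ * Complex.I)) ^ j * 𝓕 (expWeight f) ξ := by
  induction j with
  | zero => simp
  | succ j ih =>
    rw [Function.iterate_succ_apply', ← avgKernel_convolution hη,
      Real.fourier_mul_convolution_eq (integrable_avgKernel η)
        (integrable_expWeight_iterate hη hf j), ih, fourier_avgKernel hη]
    ring

theorem intervalIntegrable_of_expWeight {f : ℝ → ℂ} (hf : Integrable (expWeight f)) (a b : ℝ) :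
    IntervalIntegrable f volume a b := by
  have h1 : IntervalIntegrable (expWeight f) volume a b := hf.intervalIntegrable
  have h2 := h1.continuousOn_mul (f := expWeight f)
    (g := fun y : ℝ => Complex.exp (2 * y)) (by fun_prop)
  refine h2.congr fun y _ => ?_
  simp only [expWeight]
  rw [← mul_assoc, ← Complex.exp_add, add_neg_cancel, Complex.exp_zero, one_mul]

theorem continuous_shiftAvg (η : ℝ) {f : ℝ → ℂ} (hf : Integrable (expWeight f)) :
    Continuous (shiftAvg η f) := by
  have hi := intervalIntegrable_of_expWeight hf
  have h1 := intervalIntegral.continuous_primitive (fun a b => hi a b) 0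
  have h2 : shiftAvg η f = fun y => (η : ℂ)⁻¹ *
      ((∫ v in (0 : ℝ)..(y + η), f v) - ∫ v in (0 : ℝ)..y, f v) := by
    ext y
    rw [shiftAvg, intervalIntegral.integral_comp_add_left, add_zero,
      intervalIntegral.integral_interval_sub_left (hi _ _) (hi _ _)]
  rw [h2]
  exact continuous_const.mul ((h1.comp (by fun_prop)).sub h1)

/-- Averages preserve lower bounds. The factor u gives upper and lower bounds for real and imaginary
parts from one statement. -/
theorem le_re_mul_shiftAvg {η : ℝ} (hη : 0 < η) {f : ℝ → ℂ} (hf : Integrable (expWeight f))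
    {u : ℂ} {c y : ℝ} (h : ∀ w ∈ Set.Icc y (y + η), c ≤ (u * f w).re) :
    c ≤ (u * shiftAvg η f y).re := by
  have hi : IntervalIntegrable (fun v => u * f (y + v)) volume 0 η := by
    have := (intervalIntegrable_of_expWeight hf y (y + η)).comp_add_left y
    simp only [sub_self, add_sub_cancel_left] at this
    exact this.const_mul u
  have h1 : (u * shiftAvg η f y).re = η⁻¹ * ∫ v in (0 : ℝ)..η, (u * f (y + v)).re := by
    have h2 := Complex.reCLM.intervalIntegral_comp_comm hi
    simp only [Complex.reCLM_apply] at h2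
    rw [h2, intervalIntegral.integral_const_mul, shiftAvg, ← Complex.ofReal_inv,
      ← Complex.re_ofReal_mul]
    congr 1; ring
  have h2 : ∫ v in (0 : ℝ)..η, c ≤ ∫ v in (0 : ℝ)..η, (u * f (y + v)).re := by
    refine intervalIntegral.integral_mono_on hη.le (by simp) ?_ fun v hv =>
      h _ ⟨by linarith [hv.1], by linarith [hv.2]⟩
    have : IntervalIntegrable (fun v => Complex.reCLM (u * f (y + v))) volume 0 η :=
      ⟨Complex.reCLM.integrable_comp hi.1, Complex.reCLM.integrable_comp hi.2⟩
    exact this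
  rw [h1]
  rw [intervalIntegral.integral_const, sub_zero, smul_eq_mul] at h2
  rw [inv_mul_eq_div, le_div_iff₀ hη]
  linarith

theorem le_re_mul_iterate {η : ℝ} (hη : 0 < η) {f : ℝ → ℂ} (hf : Integrable (expWeight f))
    {u : ℂ} {c : ℝ} (j : ℕ) {y : ℝ} (h : ∀ w ∈ Set.Icc y (y + j * η), c ≤ (u * f w).re) :
    c ≤ (u * (shiftAvg η)^[j] f y).re := by
  induction j generalizing y with
  | zero => exact h y ⟨le_rfl, by simp⟩
  | succ j ih =>
    rw [Function.iterate_succ_apply']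
    refine le_re_mul_shiftAvg hη (integrable_expWeight_iterate hη hf j) fun w hw =>
      ih fun w' hw' => h w' ⟨hw.1.trans hw'.1, ?_⟩
    have := hw'.2
    have := hw.2
    push_cast
    linarith

/-- Shifting the line of integration across a strip on which `Φ` decays quadratically. -/
theorem integral_vertical_line_eq {Φ : ℂ → ℂ} (hΦ : Differentiable ℂ Φ) {C : ℝ}
    (hb : ∀ s : ℂ, 0 ≤ s.re → s.re ≤ 2 → 1 ≤ |s.im| → ‖Φ s‖ ≤ C / |s.im| ^ 2)
    (h0 : Integrable fun t : ℝ => Φ (t * Complex.I))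
    (h2 : Integrable fun t : ℝ => Φ (2 + t * Complex.I)) :
    ∫ t : ℝ, Φ (2 + t * Complex.I) = ∫ t : ℝ, Φ (t * Complex.I) := by
  -- Cauchy's theorem on the rectangle with vertices ±iT and 2 ± iT; the horizontal sides are then
  -- O(T^(-2)).
  have hrect : ∀ T : ℝ, (∫ t in (-T)..T, Φ (2 + t * Complex.I)) - ∫ t in (-T)..T, Φ (t * Complex.I)
      = Complex.I * ((∫ x in (0 : ℝ)..2, Φ (x + (-T : ℝ) * Complex.I)) -
        ∫ x in (0 : ℝ)..2, Φ (x + T * Complex.I)) := by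
    intro T
    have h := Complex.integral_boundary_rect_eq_zero_of_differentiableOn Φ
      ((-T : ℝ) * Complex.I) (2 + T * Complex.I) hΦ.differentiableOn
    simp only [Complex.mul_re, Complex.ofReal_re, Complex.I_re, mul_zero, Complex.ofReal_im,
      Complex.I_im, mul_one, sub_zero, Complex.mul_im, zero_add, Complex.add_re,
      Complex.re_ofNat, Complex.add_im, Complex.im_ofNat, add_zero, smul_eq_mul,
      Complex.ofReal_zero, Complex.ofReal_ofNat] at h
    linear_combination (-Complex.I) * h + ((∫ t in (-T)..T, Φ (2 + t * Complex.I)) -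
      ∫ t in (-T)..T, Φ (t * Complex.I)) * Complex.I_sq
  have hlim1 : Filter.Tendsto (fun T : ℝ => (∫ t in (-T)..T, Φ (2 + t * Complex.I)) -
      ∫ t in (-T)..T, Φ (t * Complex.I)) Filter.atTop
      (nhds ((∫ t : ℝ, Φ (2 + t * Complex.I)) - ∫ t : ℝ, Φ (t * Complex.I))) :=
    (intervalIntegral_tendsto_integral h2 Filter.tendsto_neg_atTop_atBot Filter.tendsto_id).sub
      (intervalIntegral_tendsto_integral h0 Filter.tendsto_neg_atTop_atBot Filter.tendsto_id)
  have hlim2 : Filter.Tendsto (fun T : ℝ => (∫ t in (-T)..T, Φ (2 + t * Complex.I)) -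
      ∫ t in (-T)..T, Φ (t * Complex.I)) Filter.atTop (nhds 0) := by
    have hz : Filter.Tendsto (fun T : ℝ => 4 * (C / T ^ 2)) Filter.atTop (nhds 0) := by
      have : Filter.Tendsto (fun T : ℝ => C / T ^ 2) Filter.atTop (nhds 0) :=
        Filter.Tendsto.const_div_atTop (Filter.tendsto_pow_atTop two_ne_zero) C
      simpa using this.const_mul 4
    refine squeeze_zero_norm' ?_ hz
    filter_upwards [Filter.eventually_ge_atTop (1 : ℝ)] with T hT
    have hT0 : 0 < T := by linarith
    have hI : ∀ T' : ℝ, |T'| = T →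
        ‖∫ x in (0 : ℝ)..2, Φ (x + T' * Complex.I)‖ ≤ 2 * (C / T ^ 2) := by
      intro T' hT'
      have h := intervalIntegral.norm_integral_le_of_norm_le_const (a := 0) (b := 2)
        (f := fun x : ℝ => Φ (x + T' * Complex.I)) (C := C / T ^ 2) (fun x hx => by
          rw [Set.uIoc_of_le (by norm_num)] at hx
          have h1 := hb (x + T' * Complex.I) (by simpa using hx.1.le) (by simpa using hx.2)
            (by simpa [hT'] using hT)
          simpa [hT'] using h1)
      have e : |(2 : ℝ) - 0| = 2 := by norm_num
      rw [e] at h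
      linarith
    rw [hrect T, norm_mul, Complex.norm_I, one_mul]
    have e1 := hI (-T) (by rw [abs_neg, abs_of_pos hT0])
    have e2 := hI T (abs_of_pos hT0)
    exact (norm_sub_le _ _).trans (by linarith)
  exact sub_eq_zero.1 (tendsto_nhds_unique hlim1 hlim2)

/-- If the weighted Laplace transform of `f` on `Re s = 2` continues to the entire function `H`
of moderate growth, iterated averages of `f` are integrals of `H` over the imaginary axis. -/
theorem iterate_shiftAvg_eq_integral {η : ℝ} (hη : 0 < η) {f : ℝ → ℂ}
    (hf : Integrable (expWeight f)) {H : ℂ → ℂ} (hH : Differentiable ℂ H)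
    (hL : ∀ ξ : ℝ, 𝓕 (expWeight f) ξ = H (2 + 2 * Real.pi * ξ * Complex.I)) {j m : ℕ}
    (hj : m + 2 ≤ j) {C : ℝ}
    (hb : ∀ s : ℂ, 0 ≤ s.re → s.re ≤ 2 → 1 ≤ |s.im| → ‖H s‖ ≤ C * |s.im| ^ m) (y : ℝ) :
    (shiftAvg η)^[j] f y = (2 * Real.pi : ℂ)⁻¹ * ∫ t : ℝ,
      expSlope (η * (t * Complex.I)) ^ j * H (t * Complex.I) * Complex.exp (t * Complex.I * y) := by
  set Φ : ℂ → ℂ := fun s => expSlope (η * s) ^ j * H s * Complex.exp (s * y) with hΦ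
  have hΦd : Differentiable ℂ Φ := by
    have := differentiable_expSlope
    have h1 : Differentiable ℂ fun s : ℂ => expSlope (η * s) := this.comp (by fun_prop)
    exact ((h1.pow j).mul hH).mul (by fun_prop)
  set B : ℝ := ((Real.exp (2 * η) + 1) / η) ^ j * C * Real.exp (2 * |y|) with hB
  -- Each average contributes a factor 1/|Im s|. As j ≥ m + 2, these absorb the growth |Im s|^m of H
  -- and leave quadratic decay throughout the strip.
  have hΦb : ∀ s : ℂ, 0 ≤ s.re → s.re ≤ 2 → 1 ≤ |s.im| → ‖Φ s‖ ≤ B / |s.im| ^ 2 := by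
    intro s hs0 hs2 ht
    have ht0 : 0 < |s.im| := by linarith
    have hs : s ≠ 0 := fun h => by simp [h] at ht0
    have hη0 : (η : ℂ) ≠ 0 := by exact_mod_cast hη.ne'
    have hC : 0 ≤ C * |s.im| ^ m := (norm_nonneg _).trans (hb s hs0 hs2 ht)
    have h1 : ‖expSlope (η * s)‖ ≤ (Real.exp (2 * η) + 1) / η / |s.im| := by
      refine (norm_expSlope_le (mul_ne_zero hη0 hs)).trans ?_
      rw [norm_mul, Complex.norm_real, Real.norm_of_nonneg hη.le, div_div, Complex.re_ofReal_mul]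
      exact div_le_div₀ (by positivity)
        (add_le_add (Real.exp_le_exp.2 (by nlinarith)) le_rfl) (by positivity)
        (mul_le_mul_of_nonneg_left (Complex.abs_im_le_norm s) hη.le)
    have h2 : ‖Complex.exp (s * y)‖ ≤ Real.exp (2 * |y|) := by
      rw [Complex.norm_exp, Complex.re_mul_ofReal]
      exact Real.exp_le_exp.2 ((mul_le_mul_of_nonneg_left (le_abs_self y) hs0).trans
        (mul_le_mul_of_nonneg_right hs2 (abs_nonneg y)))
    have h3 : ‖expSlope (η * s)‖ ^ j ≤ ((Real.exp (2 * η) + 1) / η) ^ j / |s.im| ^ (m + 2) := by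
      refine (pow_le_pow_left₀ (norm_nonneg _) h1 j).trans ?_
      rw [div_pow]
      gcongr
    calc ‖Φ s‖ = ‖expSlope (η * s)‖ ^ j * ‖H s‖ * ‖Complex.exp (s * y)‖ := by
          rw [hΦ]; simp only [norm_mul, norm_pow]
      _ ≤ ((Real.exp (2 * η) + 1) / η) ^ j / |s.im| ^ (m + 2) * (C * |s.im| ^ m) *
          Real.exp (2 * |y|) := by
          gcongr
          exact hb s hs0 hs2 ht
      _ = B / |s.im| ^ 2 := by
          rw [hB, pow_add]; field_simp
  have hint : ∀ σ : ℝ, 0 ≤ σ → σ ≤ 2 → Integrable fun t : ℝ => Φ (σ + t * Complex.I) := by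
    intro σ h0 h2
    have hcont : Continuous fun t : ℝ => Φ (σ + t * Complex.I) :=
      hΦd.continuous.comp (by fun_prop)
    obtain ⟨K, hK⟩ := (isCompact_Icc (a := (-1 : ℝ)) (b := 1)).exists_bound_of_continuousOn
      hcont.continuousOn
    have hK0 : 0 ≤ K := (norm_nonneg _).trans (hK 0 ⟨by norm_num, by norm_num⟩)
    have hB0 : 0 ≤ B := by
      have := (norm_nonneg _).trans (hΦb Complex.I (by simp) (by simp) (by simp))
      simpa using this
    have hi := integrable_inv_one_add_sq.const_mul (2 * (K + B))
    refine hi.mono' hcont.aestronglyMeasurable (Filter.Eventually.of_forall fun t => ?_)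
    have ht2 : 0 < 1 + t ^ 2 := by positivity
    rw [← div_eq_mul_inv, le_div_iff₀ ht2]
    by_cases ht : |t| ≤ 1
    · have h3 := hK t (abs_le.1 ht)
      have h4 : t ^ 2 ≤ 1 := (sq_le_one_iff_abs_le_one t).2 ht
      nlinarith [norm_nonneg (Φ (σ + t * Complex.I))]
    · have ht1 : 1 ≤ |t| := (not_le.1 ht).le
      have h3 := hΦb (σ + t * Complex.I) (by simpa using h0) (by simpa using h2) (by simpa using ht1)
      have him : (σ + t * Complex.I : ℂ).im = t := by simp
      rw [him, sq_abs, le_div_iff₀ (by nlinarith [sq_abs t])] at h3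
      have h4 : 1 ≤ t ^ 2 := by nlinarith [sq_abs t]
      nlinarith [norm_nonneg (Φ (σ + t * Complex.I))]
  have hF : ∀ ξ : ℝ, 𝓕 (expWeight ((shiftAvg η)^[j] f)) ξ =
      Φ (2 + (2 * Real.pi * ξ : ℝ) * Complex.I) * Complex.exp (-((2 : ℂ) * y)) *
        Complex.exp (-(2 * Real.pi * ξ * y * Complex.I)) := by
    intro ξ
    rw [fourier_expWeight_iterate hη hf, hL, hΦ]
    push_cast
    simp only [mul_assoc, ← Complex.exp_add]
    have : (2 + 2 * (Real.pi * (ξ * Complex.I))) * (y : ℂ) +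
        -(2 * y) + -(2 * (Real.pi * (ξ * (y * Complex.I)))) = 0 := by ring
    rw [this, Complex.exp_zero, mul_one]
  have hpi : (2 * Real.pi) ≠ 0 := by positivity
  have hcontA : Continuous ((shiftAvg η)^[j] f) := by
    obtain ⟨i, rfl⟩ : ∃ i, j = i + 1 := ⟨j - 1, by omega⟩
    rw [Function.iterate_succ_apply']
    exact continuous_shiftAvg η (integrable_expWeight_iterate hη hf i)
  have hcont : Continuous (expWeight ((shiftAvg η)^[j] f)) := by
    unfold expWeight
    exact Continuous.mul (by fun_prop) hcontA
  have h2 := hint 2 (by norm_num) le_rfl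
  rw [Complex.ofReal_ofNat] at h2
  have hFi : Integrable (𝓕 (expWeight ((shiftAvg η)^[j] f))) := by
    have h3 := (h2.comp_mul_left' hpi).mul_const (Complex.exp (-((2 : ℂ) * y)))
    have h4 : Continuous fun ξ : ℝ => Complex.exp (-(2 * Real.pi * ξ * y * Complex.I)) := by
      fun_prop
    have h5 := h3.mul_bdd (c := 1) h4.aestronglyMeasurable (Filter.Eventually.of_forall fun ξ => by
      rw [Complex.norm_exp]
      simp)
    refine h5.congr (Filter.Eventually.of_forall fun ξ => ?_)
    exact (hF ξ).symm
  have hinv := congrFun (hcont.fourierInv_fourier_eq (integrable_expWeight_iterate hη hf j) hFi) y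
  rw [Real.fourierInv_eq'] at hinv
  have h6 : ∀ ξ : ℝ, Complex.exp (↑(2 * Real.pi * inner ℝ ξ y) * Complex.I) •
      𝓕 (expWeight ((shiftAvg η)^[j] f)) ξ =
      Complex.exp (-((2 : ℂ) * y)) * Φ (2 + (2 * Real.pi * ξ : ℝ) * Complex.I) := by
    intro ξ
    rw [hF, smul_eq_mul]
    have h7 : Complex.exp (↑(2 * Real.pi * inner ℝ ξ y) * Complex.I) *
        Complex.exp (-(2 * Real.pi * ξ * y * Complex.I)) = 1 := by
      rw [← Complex.exp_add, Complex.exp_eq_one_iff]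
      refine ⟨0, ?_⟩
      simp
      ring
    linear_combination (Φ (2 + (2 * Real.pi * ξ : ℝ) * Complex.I) *
      Complex.exp (-((2 : ℂ) * y))) * h7
  simp_rw [h6] at hinv
  rw [integral_const_mul, Measure.integral_comp_mul_left
    (fun t : ℝ => Φ (2 + t * Complex.I)) (2 * Real.pi),
    integral_vertical_line_eq hΦd hΦb (by simpa using hint 0 le_rfl (by norm_num)) h2,
    expWeight] at hinv
  have h8 := mul_left_cancel₀ (Complex.exp_ne_zero _) hinv
  rw [← h8, abs_of_pos (by positivity), Complex.real_smul]
  push_cast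
  rfl

end DivisorRamanujan

/-! ### Laplace transform of the error term -/

namespace DivisorRamanujan
open Finset MeasureTheory
open scoped FourierTransform

/-- The summatory function of `d_k`. -/
noncomputable def divisorSum (k : ℕ) (x : ℝ) : ℝ := ∑ n ∈ Icc 1 ⌊x⌋₊, (divisorFn k n : ℝ)

theorem divisorSum_mono (k : ℕ) : Monotone (divisorSum k) := fun _ _ hxy =>
  sum_le_sum_of_subset_of_nonneg (Icc_subset_Icc_right (Nat.floor_le_floor hxy))
    fun _ _ _ => Nat.cast_nonneg _

theorem divisorSum_nonneg (k : ℕ) (x : ℝ) : 0 ≤ divisorSum k x :=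
  sum_nonneg fun _ _ => Nat.cast_nonneg _

/-- Rankin's trick with the convergent series ∑ d_k(n) n^(-3/2). An exponent strictly between 1 and
2 is enough, as the functions are later weighted by e^(-2y). -/
theorem divisorSum_le_rpow (k : ℕ) :
    ∃ C : ℝ, 0 ≤ C ∧ ∀ x : ℝ, 0 < x → divisorSum k x ≤ C * x ^ (3 / 2 : ℝ) := by
  have hs : Summable fun n : ℕ => ‖LSeries.term (fun n => (divisorFn k n : ℂ)) (3 / 2 : ℝ) n‖ :=
    (LSeriesHasSum_divisorFn k (s := ((3 / 2 : ℝ) : ℂ))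
      (by rw [Complex.ofReal_re]; norm_num)).summable.norm
  refine ⟨∑' n, ‖LSeries.term (fun n => (divisorFn k n : ℂ)) (3 / 2 : ℝ) n‖,
    tsum_nonneg fun _ => norm_nonneg _, fun x hx => ?_⟩
  refine le_trans ?_ (mul_le_mul_of_nonneg_right
    (hs.sum_le_tsum (Icc 1 ⌊x⌋₊) fun _ _ => norm_nonneg _) (by positivity))
  rw [sum_mul]
  refine sum_le_sum fun n hn => ?_
  obtain ⟨hn1, hn2⟩ := mem_Icc.1 hn
  have hnx : (n : ℝ) ≤ x := (Nat.le_floor_iff hx.le).1 hn2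
  have hn0 : (0 : ℝ) < n := by exact_mod_cast hn1
  rw [LSeries.norm_term_eq, if_neg (by omega), Complex.norm_natCast, Complex.ofReal_re,
    div_mul_eq_mul_div, le_div_iff₀ (by positivity)]
  gcongr

theorem pow_div_factorial_le (j : ℕ) {y δ : ℝ} (hy : 0 ≤ y) (hδ : 0 < δ) :
    y ^ j / j.factorial ≤ (δ ^ j)⁻¹ * Real.exp (δ * y) := by
  have h := Real.pow_div_factorial_le_exp _ (mul_nonneg hδ.le hy) j
  rw [mul_pow] at h
  rw [inv_mul_eq_div, le_div_iff₀ (by positivity)]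
  calc y ^ j / j.factorial * δ ^ j = δ ^ j * y ^ j / j.factorial := by ring
    _ ≤ _ := h

theorem integrableOn_pow_mul_exp (j : ℕ) {w : ℂ} (hw : 0 < w.re) :
    IntegrableOn (fun y : ℝ => ((y : ℂ) ^ j / j.factorial) * Complex.exp (-w * y))
      (Set.Ioi 0) := by
  have h1 := (integrableOn_exp_mul_Ioi (a := -(w.re / 2)) (by linarith) 0).const_mul
    (((w.re / 2) ^ j)⁻¹)
  refine h1.mono' (Continuous.aestronglyMeasurable (by fun_prop)) ?_
  filter_upwards [ae_restrict_mem measurableSet_Ioi] with y hy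
  have hy0 : (0 : ℝ) ≤ y := le_of_lt hy
  rw [norm_mul, norm_div, norm_pow, Complex.norm_real, Real.norm_of_nonneg hy0,
    Complex.norm_natCast, Complex.norm_exp, Complex.re_mul_ofReal, Complex.neg_re]
  have h2 := pow_div_factorial_le j hy0 (half_pos hw)
  calc y ^ j / j.factorial * Real.exp (-w.re * y)
      ≤ ((w.re / 2) ^ j)⁻¹ * Real.exp (w.re / 2 * y) * Real.exp (-w.re * y) := by gcongr
    _ = _ := by rw [mul_assoc, ← Real.exp_add]; ring_nf

theorem integral_pow_mul_exp (j : ℕ) {w : ℂ} (hw : 0 < w.re) :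
    ∫ y in Set.Ioi (0 : ℝ), ((y : ℂ) ^ j / j.factorial) * Complex.exp (-w * y) =
      1 / w ^ (j + 1) := by
  have hw0 : w ≠ 0 := fun h => by simp [h] at hw
  induction j with
  | zero =>
    have := integral_exp_mul_complex_Ioi (a := -w) (by simpa using hw) 0
    simpa using this
  | succ j ih =>
    set g : ℝ → ℂ := fun y => ((y : ℂ) ^ (j + 1) / (j + 1).factorial) * Complex.exp (-w * y)
    have hd : ∀ y ∈ Set.Ici (0 : ℝ), HasDerivAt g
        (((y : ℂ) ^ j / j.factorial) * Complex.exp (-w * y) -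
          w * (((y : ℂ) ^ (j + 1) / (j + 1).factorial) * Complex.exp (-w * y))) y := by
      intro y _
      have h1 : HasDerivAt (fun z : ℂ => (z ^ (j + 1) / (j + 1).factorial) * Complex.exp (-w * z))
          (((y : ℂ) ^ j / j.factorial) * Complex.exp (-w * y) -
            w * (((y : ℂ) ^ (j + 1) / (j + 1).factorial) * Complex.exp (-w * y))) (y : ℂ) := by
        have h2 : HasDerivAt (fun z : ℂ => Complex.exp (-w * z))
            (Complex.exp (-w * y) * (-w)) (y : ℂ) := by
          have := ((hasDerivAt_id (y : ℂ)).const_mul (-w)).cexp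
          simpa using this
        refine (((hasDerivAt_pow (j + 1) (y : ℂ)).div_const _).mul h2).congr_deriv ?_
        have h3 : ((j + 1).factorial : ℂ) = (j + 1) * j.factorial := by
          rw [Nat.factorial_succ]; push_cast; ring
        have h4 : (j.factorial : ℂ) ≠ 0 := by exact_mod_cast j.factorial_ne_zero
        have h5 : (j + 1 : ℂ) ≠ 0 := by exact_mod_cast j.succ_ne_zero
        rw [h3, Nat.add_sub_cancel]
        push_cast
        field_simp
        ring
      exact h1.comp_ofReal
    have hi1 := integrableOn_pow_mul_exp j hw
    have hi2 := (integrableOn_pow_mul_exp (j + 1) hw).const_mul w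
    have hlim : Filter.Tendsto g Filter.atTop (nhds 0) := by
      have hb : Filter.Tendsto (fun y : ℝ => (((w.re / 2) ^ (j + 1))⁻¹) *
          Real.exp (-(w.re / 2 * y))) Filter.atTop (nhds 0) := by
        have : Filter.Tendsto (fun y : ℝ => Real.exp (-(w.re / 2 * y))) Filter.atTop (nhds 0) :=
          Real.tendsto_exp_neg_atTop_nhds_zero.comp
            (Filter.tendsto_id.const_mul_atTop (half_pos hw))
        simpa using this.const_mul (((w.re / 2) ^ (j + 1))⁻¹)
      refine squeeze_zero_norm' ?_ hb
      filter_upwards [Filter.eventually_ge_atTop (0 : ℝ)] with y hy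
      simp only [g]
      rw [norm_mul, norm_div, norm_pow, Complex.norm_real, Real.norm_of_nonneg hy,
        Complex.norm_natCast, Complex.norm_exp, Complex.re_mul_ofReal, Complex.neg_re]
      calc y ^ (j + 1) / (j + 1).factorial * Real.exp (-w.re * y)
          ≤ ((w.re / 2) ^ (j + 1))⁻¹ * Real.exp (w.re / 2 * y) * Real.exp (-w.re * y) := by
            gcongr; exact pow_div_factorial_le (j + 1) hy (half_pos hw)
        _ = _ := by rw [mul_assoc, ← Real.exp_add]; ring_nf
    have h := integral_Ioi_of_hasDerivAt_of_tendsto' hd (hi1.sub hi2) hlim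
    have h0 : g 0 = 0 := by simp [g]
    rw [integral_sub hi1 hi2, ih, integral_const_mul, h0, sub_zero, sub_eq_zero] at h
    rw [pow_succ, ← div_div, h, mul_div_cancel_left₀ _ hw0]

theorem integrableOn_divisorSum_mul_exp (k : ℕ) {s : ℂ} (hs : 3 / 2 < s.re) :
    IntegrableOn (fun y : ℝ => (divisorSum k (Real.exp y) : ℂ) * Complex.exp (-s * y))
      (Set.Ioi 0) := by
  obtain ⟨C, -, hC⟩ := divisorSum_le_rpow k
  have h1 := (integrableOn_exp_mul_Ioi (a := 3 / 2 - s.re) (by linarith) 0).const_mul C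
  refine h1.mono' ?_ (Filter.Eventually.of_forall fun y => ?_)
  · refine AEStronglyMeasurable.mul ?_ (Continuous.aestronglyMeasurable (by fun_prop))
    exact (Complex.measurable_ofReal.comp ((divisorSum_mono k).measurable.comp
      Real.measurable_exp)).aestronglyMeasurable
  · rw [norm_mul, Complex.norm_real, Real.norm_of_nonneg (divisorSum_nonneg k _),
      Complex.norm_exp, Complex.re_mul_ofReal, Complex.neg_re]
    calc _ ≤ C * Real.exp y ^ (3 / 2 : ℝ) * Real.exp (-s.re * y) := by
          gcongr; exact hC _ (Real.exp_pos y)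
      _ = _ := by
          rw [← Real.exp_mul, mul_assoc, ← Real.exp_add]; ring_nf

/-- Partial summation writes ζ(s)^k as s times the integral of D_k(x) x^(-s-1) over x > 1; then x =
e^y. -/
theorem integral_divisorSum_mul_exp (k : ℕ) {s : ℂ} (hs : 3 / 2 < s.re) :
    ∫ y in Set.Ioi (0 : ℝ), (divisorSum k (Real.exp y) : ℂ) * Complex.exp (-s * y) =
      riemannZeta s ^ k / s := by
  have hs0 : s ≠ 0 := fun h => by rw [h] at hs; norm_num at hs
  have hL := LSeriesHasSum_divisorFn k (s := s) (by linarith)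
  obtain ⟨C, -, hC⟩ := divisorSum_le_rpow k
  have h := LSeries_eq_mul_integral_of_nonneg (fun n => (divisorFn k n : ℝ)) (r := 3 / 2)
    (by norm_num) hs ?_ (fun n => Nat.cast_nonneg _)
  · simp only [Complex.ofReal_natCast] at h
    rw [hL.LSeries_eq] at h
    rw [h, mul_div_cancel_left₀ _ hs0]
    have himg : Real.exp '' Set.Ioi 0 = Set.Ioi 1 := by
      ext x
      constructor
      · rintro ⟨y, hy, rfl⟩
        exact Real.one_lt_exp_iff.2 hy
      · intro hx
        have hx1 : 1 < x := hx
        exact ⟨Real.log x, Real.log_pos hx1, Real.exp_log (by linarith)⟩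
    rw [← himg, integral_image_eq_integral_abs_deriv_smul measurableSet_Ioi
      (fun x _ => (Real.hasDerivAt_exp x).hasDerivWithinAt) Real.exp_injective.injOn]
    refine setIntegral_congr_fun measurableSet_Ioi fun y _ => ?_
    have he : ((Real.exp y : ℝ) : ℂ) ≠ 0 := by exact_mod_cast (Real.exp_pos y).ne'
    rw [abs_of_pos (Real.exp_pos y), Complex.real_smul, divisorSum,
      Complex.cpow_def_of_ne_zero he, ← Complex.ofReal_log (Real.exp_pos y).le, Real.log_exp]
    push_cast
    rw [mul_left_comm, ← Complex.exp_add]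
    congr 2
    ring
  · refine Asymptotics.IsBigO.of_bound C ?_
    filter_upwards [Filter.eventually_gt_atTop 0] with n hn
    have h1 := hC n (by exact_mod_cast hn)
    have h2 := divisorSum_nonneg k n
    rw [divisorSum, Nat.floor_natCast] at h1 h2
    rw [Real.norm_of_nonneg h2, Real.norm_of_nonneg (by positivity)]
    exact h1

theorem mainTerm_exp (k : ℕ) (a : ℕ → ℂ) (y : ℝ) :
    mainTerm k a (Real.exp y) =
      Complex.exp y * ∑ j ∈ range k, a j * ((y : ℂ) ^ j / j.factorial) := by
  rw [mainTerm, Real.log_exp, Complex.ofReal_exp]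

/-- The error term `D_k(e^y) - M(e^y) - c` for `y > 0`, extended by zero. -/
noncomputable def divisorError (k : ℕ) (a : ℕ → ℂ) (c : ℂ) : ℝ → ℂ :=
  (Set.Ioi 0).indicator fun y =>
    (divisorSum k (Real.exp y) : ℂ) - mainTerm k a (Real.exp y) - c

theorem exp_mul_divisorError {k : ℕ} {a : ℕ → ℂ} {c : ℂ} (s : ℂ) (y : ℝ) :
    Complex.exp (-s * y) * divisorError k a c y = (Set.Ioi 0).indicator (fun y : ℝ =>
      (divisorSum k (Real.exp y) : ℂ) * Complex.exp (-s * y) -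
        ∑ j ∈ range k, a j * (((y : ℂ) ^ j / j.factorial) * Complex.exp (-(s - 1) * y)) -
        c * Complex.exp (-s * y)) y := by
  rw [divisorError]
  by_cases hy : y ∈ Set.Ioi (0 : ℝ)
  · rw [Set.indicator_of_mem hy, Set.indicator_of_mem hy, mainTerm_exp, mul_sub, mul_sub,
      ← mul_assoc, ← Complex.exp_add, mul_sum, mul_comm (Complex.exp _) c,
      mul_comm (Complex.exp _) (divisorSum _ _ : ℂ)]
    congr 2
    refine sum_congr rfl fun j _ => ?_
    have : -s * (y : ℂ) + y = -(s - 1) * y := by ring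
    rw [this]; ring
  · rw [Set.indicator_of_notMem hy, Set.indicator_of_notMem hy, mul_zero]

theorem integrable_exp_mul_divisorError (k : ℕ) (a : ℕ → ℂ) (c : ℂ) {s : ℂ} (hs : 3 / 2 < s.re) :
    Integrable fun y : ℝ => Complex.exp (-s * y) * divisorError k a c y := by
  simp_rw [exp_mul_divisorError]
  rw [integrable_indicator_iff measurableSet_Ioi]
  refine ((integrableOn_divisorSum_mul_exp k hs).sub (integrable_finsetSum _ fun j _ =>
    (integrableOn_pow_mul_exp j ?_).const_mul (a j))).sub
    ((integrableOn_exp_mul_complex_Ioi (by simp; linarith) 0).const_mul c)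
  rw [Complex.sub_re, Complex.one_re]; linarith

/-- The three pieces have transforms ζ(s)^k/s, the principal part at 1, and c/s. Their combination
is H, so the later contour shift meets no poles. -/
theorem integral_exp_mul_divisorError {k : ℕ} {a : ℕ → ℂ} {c : ℂ} {H : ℂ → ℂ}
    (h : ∀ s, s ≠ 0 → s ≠ 1 → riemannZeta s ^ k / s =
      c / s + ∑ j ∈ range k, a j / (s - 1) ^ (j + 1) + H s) {s : ℂ} (hs : 3 / 2 < s.re) :
    ∫ y : ℝ, Complex.exp (-s * y) * divisorError k a c y = H s := by
  have hs0 : s ≠ 0 := fun h => by rw [h] at hs; norm_num at hs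
  have hs1 : s ≠ 1 := fun h => by rw [h] at hs; norm_num at hs
  have hre : 0 < (s - 1).re := by rw [Complex.sub_re, Complex.one_re]; linarith
  have hre' : (-s).re < 0 := by rw [Complex.neg_re]; linarith
  have hi : ∀ j ∈ range k, IntegrableOn (fun y : ℝ => a j * (((y : ℂ) ^ j / j.factorial) *
      Complex.exp (-(s - 1) * y))) (Set.Ioi 0) := fun j _ =>
    (integrableOn_pow_mul_exp j hre).const_mul (a j)
  have hi1 := integrableOn_divisorSum_mul_exp k hs
  have hi2 := (integrableOn_exp_mul_complex_Ioi hre' 0).const_mul c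
  have hi12 : IntegrableOn (fun y : ℝ =>
      (divisorSum k (Real.exp y) : ℂ) * Complex.exp (-s * y) -
        ∑ j ∈ range k, a j * (((y : ℂ) ^ j / j.factorial) * Complex.exp (-(s - 1) * y)))
      (Set.Ioi 0) := hi1.sub (integrable_finsetSum _ hi)
  simp_rw [exp_mul_divisorError]
  rw [integral_indicator measurableSet_Ioi, integral_sub hi12 hi2,
    integral_sub hi1 (integrable_finsetSum _ hi), integral_finsetSum _ hi,
    integral_divisorSum_mul_exp k hs, integral_const_mul, integral_exp_mul_complex_Ioi hre',
    h s hs0 hs1]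
  simp_rw [integral_const_mul, integral_pow_mul_exp _ hre]
  simp only [Complex.ofReal_zero, mul_zero, Complex.exp_zero, mul_one_div]
  field_simp
  ring

theorem fourier_expWeight_divisorError {k : ℕ} {a : ℕ → ℂ} {c : ℂ} {H : ℂ → ℂ}
    (h : ∀ s, s ≠ 0 → s ≠ 1 → riemannZeta s ^ k / s =
      c / s + ∑ j ∈ range k, a j / (s - 1) ^ (j + 1) + H s) (ξ : ℝ) :
    𝓕 (expWeight (divisorError k a c)) ξ = H (2 + 2 * Real.pi * ξ * Complex.I) := by
  have hre : (2 + 2 * Real.pi * ξ * Complex.I : ℂ).re = 2 := by simp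
  rw [← integral_exp_mul_divisorError h (by rw [hre]; norm_num),
    Real.fourier_real_eq_integral_exp_smul]
  refine integral_congr_ae (Filter.Eventually.of_forall fun y => ?_)
  simp only [expWeight, smul_eq_mul]
  rw [← mul_assoc, ← Complex.exp_add]
  congr 2
  push_cast
  ring

theorem integrable_expWeight_divisorError (k : ℕ) (a : ℕ → ℂ) (c : ℂ) :
    Integrable (expWeight (divisorError k a c)) := by
  have := integrable_exp_mul_divisorError k a c (s := 2) (by norm_num)
  refine this.congr (Filter.Eventually.of_forall fun y => ?_)
  simp only [expWeight]
  congr 2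
  ring

theorem norm_le_of_zeta_pow_div_eq {k : ℕ} {a : ℕ → ℂ} {c : ℂ} {H : ℂ → ℂ}
    (h : ∀ s, s ≠ 0 → s ≠ 1 → riemannZeta s ^ k / s =
      c / s + ∑ j ∈ range k, a j / (s - 1) ^ (j + 1) + H s) {s : ℂ} (ht : 1 ≤ |s.im|) :
    ‖H s‖ ≤ (‖riemannZeta s‖ ^ k + (‖c‖ + ∑ j ∈ range k, ‖a j‖)) / |s.im| := by
  have ht0 : 0 < |s.im| := by linarith
  have hs0 : s ≠ 0 := fun h => by simp [h] at ht0
  have hs1 := ne_one_of_one_le_abs_im ht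
  have e : H s = riemannZeta s ^ k / s - (c / s + ∑ j ∈ range k, a j / (s - 1) ^ (j + 1)) := by
    rw [h s hs0 hs1]; ring
  have hn : |s.im| ≤ ‖s‖ := Complex.abs_im_le_norm s
  have hn1 : |s.im| ≤ ‖s - 1‖ := by simpa using Complex.abs_im_le_norm (s - 1)
  rw [e, add_div, add_div, sum_div]
  refine (norm_sub_le _ _).trans (add_le_add ?_ ((norm_add_le _ _).trans (add_le_add ?_ ?_)))
  · rw [norm_div, norm_pow]; gcongr
  · rw [norm_div]; gcongr
  · refine (norm_sum_le _ _).trans (sum_le_sum fun j _ => ?_)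
    rw [norm_div, norm_pow]
    gcongr
    calc |s.im| ≤ ‖s - 1‖ := hn1
      _ ≤ ‖s - 1‖ ^ (j + 1) := le_self_pow₀ (ht.trans hn1) (Nat.succ_ne_zero j)

theorem norm_le_pow_of_zeta_pow_div_eq {k : ℕ} {a : ℕ → ℂ} {c : ℂ} {H : ℂ → ℂ}
    (h : ∀ s, s ≠ 0 → s ≠ 1 → riemannZeta s ^ k / s =
      c / s + ∑ j ∈ range k, a j / (s - 1) ^ (j + 1) + H s) :
    ∃ C : ℝ, ∀ s : ℂ, 0 ≤ s.re → s.re ≤ 2 → 1 ≤ |s.im| → ‖H s‖ ≤ C * |s.im| ^ (2 * k) := by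
  obtain ⟨C, hC⟩ := norm_riemannZeta_le_sq
  set B := ‖c‖ + ∑ j ∈ range k, ‖a j‖ with hB
  have hB0 : 0 ≤ B := add_nonneg (norm_nonneg _) (sum_nonneg fun _ _ => norm_nonneg _)
  refine ⟨C ^ k + B, fun s h0 h2 ht => ?_⟩
  have h1 := pow_le_pow_left₀ (norm_nonneg _) (hC s h0 h2 ht) k
  rw [mul_pow, ← pow_mul] at h1
  have h3 : 1 ≤ |s.im| ^ (2 * k) := one_le_pow₀ ht
  refine (norm_le_of_zeta_pow_div_eq h ht).trans ((div_le_self (by positivity) ht).trans ?_)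
  nlinarith

theorem norm_mul_I_le_of_zeta_pow_div_eq {k : ℕ} {a : ℕ → ℂ} {c : ℂ} {H : ℂ → ℂ}
    (h : ∀ s, s ≠ 0 → s ≠ 1 → riemannZeta s ^ k / s =
      c / s + ∑ j ∈ range k, a j / (s - 1) ^ (j + 1) + H s) {ε : ℝ} (hε : 0 < ε) (hε1 : ε ≤ 1) :
    ∃ C : ℝ, ∀ t : ℝ, 1 ≤ |t| →
      ‖H (t * Complex.I)‖ ≤ C * |t| ^ ((k : ℝ) * (1 / 2 + ε) - 1) := by
  obtain ⟨C, hC⟩ := norm_riemannZeta_mul_I_le hε hε1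
  set B := ‖c‖ + ∑ j ∈ range k, ‖a j‖ with hB
  have hB0 : 0 ≤ B := add_nonneg (norm_nonneg _) (sum_nonneg fun _ _ => norm_nonneg _)
  refine ⟨C ^ k + B, fun t ht => ?_⟩
  have ht0 : 0 < |t| := by linarith
  have h1 := pow_le_pow_left₀ (norm_nonneg _) (hC t ht) k
  rw [mul_pow, ← Real.rpow_mul_natCast ht0.le, mul_comm (1 / 2 + ε)] at h1
  have h3 : 1 ≤ |t| ^ ((k : ℝ) * (1 / 2 + ε)) := Real.one_le_rpow ht (by positivity)
  have h4 := norm_le_of_zeta_pow_div_eq h (s := t * Complex.I) (by simpa using ht)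
  have him : |(t * Complex.I : ℂ).im| = |t| := by simp
  rw [him] at h4
  refine h4.trans ?_
  rw [Real.rpow_sub_one ht0.ne', mul_div_assoc']
  gcongr
  nlinarith

end DivisorRamanujan

/-! ### The k-divisor problem -/

namespace DivisorRamanujan
open Finset MeasureTheory

/-- On the imaginary axis H(it) is O(|t|^(k/2-1+kε)) for |t| ≥ 1, and the averaging factor is at
most min(1, 2/(η|t|))^(2k+2), so the integral is governed by |t| up to about 1/η. -/
theorem norm_iterate_divisorError_le {k : ℕ} (hk : 1 ≤ k) {a : ℕ → ℂ} {c : ℂ} {H : ℂ → ℂ}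
    (hH : Differentiable ℂ H)
    (h : ∀ s, s ≠ 0 → s ≠ 1 → riemannZeta s ^ k / s =
      c / s + ∑ j ∈ range k, a j / (s - 1) ^ (j + 1) + H s) {ε : ℝ} (hε : 0 < ε)
    (hε1 : ε ≤ 1 / 2) :
    ∃ C : ℝ, 0 ≤ C ∧ ∀ η : ℝ, 0 < η → η ≤ 1 → ∀ y : ℝ,
      ‖(shiftAvg η)^[2 * k + 2] (divisorError k a c) y‖ ≤
        C * η ^ (-((k : ℝ) / 2 + 2 * k * ε)) := by
  obtain ⟨C₁, hC₁⟩ := norm_le_pow_of_zeta_pow_div_eq h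
  obtain ⟨C₂, hC₂⟩ := norm_mul_I_le_of_zeta_pow_div_eq h hε (by linarith)
  have hC₂0 : 0 ≤ C₂ := by
    have := (norm_nonneg _).trans (hC₂ 1 (by simp))
    simpa using this
  have hHc : Continuous fun t : ℝ => H (t * Complex.I) := hH.continuous.comp (by fun_prop)
  obtain ⟨K, hK⟩ := (isCompact_Icc (a := (-1 : ℝ)) (b := 1)).exists_bound_of_continuousOn
    hHc.continuousOn
  have hK0 : 0 ≤ K := (norm_nonneg _).trans (hK 0 ⟨by norm_num, by norm_num⟩)
  have hk1 : (1 : ℝ) ≤ k := by exact_mod_cast hk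
  set p : ℝ := (k : ℝ) / 2 + 2 * k * ε with hp
  set r : ℝ := 1 + k * ε with hr
  have hp0 : 0 ≤ p := by positivity
  have hr1 : 1 < r := by rw [hr]; nlinarith
  set B : ℝ := 2 ^ r * (2 ^ p * C₂ + K) with hB
  have hB0 : 0 ≤ B := by positivity
  have hint := integrable_one_add_norm (E := ℝ) (μ := volume) (r := r) (by simpa using hr1)
  refine ⟨B * ∫ t : ℝ, (1 + ‖t‖) ^ (-r),
    mul_nonneg hB0 (integral_nonneg fun t => by positivity), fun η hη hη1 y => ?_⟩
  rw [iterate_shiftAvg_eq_integral hη (integrable_expWeight_divisorError k a c) hH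
    (fourier_expWeight_divisorError h) le_rfl hC₁ y]
  have hηp : 1 ≤ η ^ (-p) := Real.one_le_rpow_of_pos_of_le_one_of_nonpos hη hη1 (by linarith)
  have hpt : ∀ t : ℝ, ‖expSlope (η * (t * Complex.I)) ^ (2 * k + 2) * H (t * Complex.I) *
      Complex.exp (t * Complex.I * y)‖ ≤ B * η ^ (-p) * (1 + ‖t‖) ^ (-r) := by
    intro t
    have he : ‖Complex.exp (t * Complex.I * y)‖ = 1 := by
      rw [Complex.norm_exp]; simp
    rw [norm_mul, he, mul_one, norm_mul, norm_pow]
    have hz : (η * (t * Complex.I) : ℂ) = ((η * t : ℝ) : ℂ) * Complex.I := by push_cast; ring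
    rw [hz]
    set e := ‖expSlope (((η * t : ℝ) : ℂ) * Complex.I)‖ with hedef
    have he0 : 0 ≤ e := norm_nonneg _
    have he1 : e ≤ 1 := norm_expSlope_mul_I_le_one _
    rw [Real.norm_eq_abs]
    have ht0 : 0 ≤ |t| := abs_nonneg t
    by_cases ht : |t| ≤ 1
    · have h1 : e ^ (2 * k + 2) ≤ 1 := pow_le_one₀ he0 he1
      have h2 := hK t (abs_le.1 ht)
      have h3 : 1 ≤ 2 ^ r * (1 + |t|) ^ (-r) := by
        rw [Real.rpow_neg (by positivity), ← div_eq_mul_inv, one_le_div (by positivity)]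
        exact Real.rpow_le_rpow (by positivity) (by linarith) (by linarith)
      calc e ^ (2 * k + 2) * ‖H (t * Complex.I)‖ ≤ 1 * K := by gcongr
        _ ≤ (2 ^ p * C₂ + K) * η ^ (-p) * (2 ^ r * (1 + |t|) ^ (-r)) := by
          have h4 : K ≤ (2 ^ p * C₂ + K) * η ^ (-p) := by
            have : 0 ≤ (2 : ℝ) ^ p * C₂ := by positivity
            nlinarith
          nlinarith
        _ = _ := by rw [hB]; ring
    · have ht1 : 1 ≤ |t| := (not_le.1 ht).le
      have htpos : 0 < |t| := by linarith
      have htne : t ≠ 0 := abs_pos.1 htpos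
      have h1 : e ≤ 2 / (η * |t|) := by
        have := norm_expSlope_mul_I_le (η * t) (mul_ne_zero hη.ne' htne)
        rwa [abs_mul, abs_of_pos hη] at this
      -- Since e ≤ 1, the exponent 2k+2 may be lowered to p. This p leaves |t|^(-1-kε) against the
      -- growth of H, which is just integrable, at a cost of η^(-p) only.
      have h2 : e ^ (2 * k + 2) ≤ 2 ^ p * η ^ (-p) * |t| ^ (-p) := by
        calc e ^ (2 * k + 2) = e ^ ((2 * k + 2 : ℕ) : ℝ) := (Real.rpow_natCast _ _).symm
          _ ≤ e ^ p := by
            refine Real.rpow_le_rpow_of_exponent_ge' he0 he1 hp0 ?_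
            rw [hp]; push_cast; nlinarith
          _ ≤ (2 / (η * |t|)) ^ p := Real.rpow_le_rpow he0 h1 hp0
          _ = _ := by
            rw [Real.div_rpow (by norm_num) (by positivity), Real.mul_rpow hη.le ht0,
              Real.rpow_neg hη.le, Real.rpow_neg ht0]
            field_simp
      have h3 : |t| ^ (-p) * |t| ^ ((k : ℝ) * (1 / 2 + ε) - 1) = |t| ^ (-r) := by
        rw [← Real.rpow_add htpos]; congr 1; rw [hp, hr]; ring
      have h4 : |t| ^ (-r) ≤ 2 ^ r * (1 + |t|) ^ (-r) := by
        have h5 : (2 * |t|) ^ (-r) ≤ (1 + |t|) ^ (-r) :=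
          Real.rpow_le_rpow_of_nonpos (by positivity) (by linarith) (by linarith)
        rw [Real.mul_rpow (by norm_num) ht0] at h5
        calc |t| ^ (-r) = 2 ^ r * (2 ^ (-r) * |t| ^ (-r)) := by
              rw [← mul_assoc, ← Real.rpow_add (by norm_num)]; simp
          _ ≤ _ := by gcongr
      calc e ^ (2 * k + 2) * ‖H (t * Complex.I)‖
          ≤ (2 ^ p * η ^ (-p) * |t| ^ (-p)) * (C₂ * |t| ^ ((k : ℝ) * (1 / 2 + ε) - 1)) := by
            gcongr
            exact hC₂ t ht1
        _ = 2 ^ p * C₂ * η ^ (-p) * (|t| ^ (-p) * |t| ^ ((k : ℝ) * (1 / 2 + ε) - 1)) := by ring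
        _ ≤ (2 ^ p * C₂ + K) * η ^ (-p) * (2 ^ r * (1 + |t|) ^ (-r)) := by
            rw [h3]
            gcongr
            linarith
        _ = _ := by rw [hB]; ring
  have hnorm := norm_integral_le_of_norm_le (hint.const_mul (B * η ^ (-p)))
    (Filter.Eventually.of_forall hpt)
  rw [integral_const_mul] at hnorm
  have hpi : ‖(2 * Real.pi : ℂ)⁻¹‖ ≤ 1 := by
    have : (2 * Real.pi : ℂ)⁻¹ = ((2 * Real.pi : ℝ)⁻¹ : ℝ) := by push_cast; rfl
    rw [this, Complex.norm_real, Real.norm_of_nonneg (by positivity)]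
    exact inv_le_one_of_one_le₀ (by linarith [Real.pi_gt_three])
  rw [norm_mul]
  calc _ ≤ 1 * (B * η ^ (-p) * ∫ t : ℝ, (1 + ‖t‖) ^ (-r)) := by gcongr
    _ = _ := by ring

theorem norm_mainTerm_le (k : ℕ) (a : ℕ → ℂ) {δ x : ℝ} (hδ : 0 < δ) (hx : 0 < x) :
    ‖mainTerm k a x‖ ≤
      (∑ j ∈ range k, ‖a j‖ * (δ ^ j)⁻¹) * (x * Real.exp (δ * |Real.log x|)) := by
  rw [mainTerm, norm_mul, Complex.norm_real, Real.norm_of_nonneg hx.le]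
  calc x * ‖∑ j ∈ range k, a j * ((Real.log x : ℂ) ^ j / j.factorial)‖
      ≤ x * ∑ j ∈ range k, ‖a j‖ * ((δ ^ j)⁻¹ * Real.exp (δ * |Real.log x|)) := by
        gcongr
        refine (norm_sum_le _ _).trans (sum_le_sum fun j _ => ?_)
        rw [norm_mul, norm_div, norm_pow, Complex.norm_real, Complex.norm_natCast,
          Real.norm_eq_abs]
        gcongr
        exact pow_div_factorial_le j (abs_nonneg _) hδ
    _ = _ := by
        rw [mul_sum, sum_mul]
        exact sum_congr rfl fun j _ => by ring

theorem abs_exp_mul_pow_sub_le (j : ℕ) {δ : ℝ} (hδ : 0 < δ) : ∃ C : ℝ, 0 ≤ C ∧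
    ∀ u v : ℝ, 0 ≤ u → u ≤ v →
      ‖Real.exp v * (v ^ j / j.factorial) - Real.exp u * (u ^ j / j.factorial)‖ ≤
        C * Real.exp ((1 + δ) * v) * (v - u) := by
  -- One summand for each term of the derivative of e^x x^j/j!. For j = 0 the truncated j - 1 is
  -- harmless, because the second term is zero.
  refine ⟨(δ ^ j)⁻¹ + (δ ^ (j - 1))⁻¹, by positivity, fun u v hu huv => ?_⟩
  have hd : ∀ x ∈ Set.Icc u v, HasDerivWithinAt
      (fun x : ℝ => Real.exp x * (x ^ j / j.factorial))
      (Real.exp x * (x ^ j / j.factorial) + Real.exp x * ((j : ℝ) * x ^ (j - 1) / j.factorial))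
      (Set.Icc u v) x := fun x _ =>
    ((Real.hasDerivAt_exp x).mul ((hasDerivAt_pow j x).div_const _)).hasDerivWithinAt
  refine norm_image_sub_le_of_norm_deriv_le_segment' hd (fun x hx => ?_) v ⟨huv, le_rfl⟩
  have hx0 : 0 ≤ x := hu.trans hx.1
  have h1 := pow_div_factorial_le j hx0 hδ
  have h2 : (j : ℝ) * x ^ (j - 1) / j.factorial ≤ (δ ^ (j - 1))⁻¹ * Real.exp (δ * x) := by
    rcases j with _ | i
    · simp; positivity
    · have h3 := pow_div_factorial_le i hx0 hδ
      have h4 : ((i + 1 : ℕ) : ℝ) * x ^ (i + 1 - 1) / (i + 1).factorial = x ^ i / i.factorial := by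
        rw [Nat.factorial_succ]
        push_cast
        have : (i.factorial : ℝ) ≠ 0 := by exact_mod_cast i.factorial_ne_zero
        field_simp
      rw [h4]
      exact h3
  rw [Real.norm_of_nonneg (by positivity)]
  calc _ ≤ Real.exp x * ((δ ^ j)⁻¹ * Real.exp (δ * x)) +
        Real.exp x * ((δ ^ (j - 1))⁻¹ * Real.exp (δ * x)) := by gcongr
    _ = ((δ ^ j)⁻¹ + (δ ^ (j - 1))⁻¹) * Real.exp ((1 + δ) * x) := by
        rw [one_add_mul, Real.exp_add]; ring
    _ ≤ _ := by gcongr; exact hx.2.le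

theorem norm_mainTerm_exp_sub_le (k : ℕ) (a : ℕ → ℂ) {δ : ℝ} (hδ : 0 < δ) : ∃ C : ℝ, 0 ≤ C ∧
    ∀ u v : ℝ, 0 ≤ u → u ≤ v →
      ‖mainTerm k a (Real.exp v) - mainTerm k a (Real.exp u)‖ ≤
        C * Real.exp ((1 + δ) * v) * (v - u) := by
  choose C hC0 hC using fun j => abs_exp_mul_pow_sub_le j hδ
  refine ⟨∑ j ∈ range k, ‖a j‖ * C j,
    sum_nonneg fun j _ => mul_nonneg (norm_nonneg _) (hC0 j), fun u v hu huv => ?_⟩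
  have h1 : mainTerm k a (Real.exp v) - mainTerm k a (Real.exp u) = ∑ j ∈ range k, a j *
      ((Real.exp v * (v ^ j / j.factorial) - Real.exp u * (u ^ j / j.factorial) : ℝ) : ℂ) := by
    rw [mainTerm_exp, mainTerm_exp, mul_sum, mul_sum, ← sum_sub_distrib]
    refine sum_congr rfl fun j _ => ?_
    push_cast; ring
  rw [h1, mul_assoc, sum_mul]
  refine (norm_sum_le _ _).trans (sum_le_sum fun j _ => ?_)
  rw [norm_mul, Complex.norm_real, mul_assoc (‖a j‖), ← mul_assoc (C j)]
  gcongr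
  exact hC j u v hu huv

/-- The summatory function only increases, so the error can drop only as fast as the main term
moves. The value u = I covers imaginary parts, to which the real-valued summatory function
contributes nothing. -/
theorem re_mul_divisorError_le {k : ℕ} {a : ℕ → ℂ} {c u : ℂ} (hu : u = 1 ∨ u = Complex.I)
    {w w' ω : ℝ} (hw : 0 < w) (hww : w ≤ w')
    (hω : ‖mainTerm k a (Real.exp w') - mainTerm k a (Real.exp w)‖ ≤ ω) :
    (u * divisorError k a c w).re ≤ (u * divisorError k a c w').re + ω := by
  have hu1 : ‖u‖ = 1 := by rcases hu with rfl | rfl <;> simp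
  rw [divisorError, Set.indicator_of_mem (Set.mem_Ioi.2 hw),
    Set.indicator_of_mem (Set.mem_Ioi.2 (hw.trans_le hww))]
  have hD := divisorSum_mono k (Real.exp_le_exp.2 hww)
  have h1 : (u * ((divisorSum k (Real.exp w) : ℂ) - divisorSum k (Real.exp w'))).re ≤ 0 := by
    rcases hu with rfl | rfl
    · simpa using hD
    · simp
  have h2 : (u * (mainTerm k a (Real.exp w') - mainTerm k a (Real.exp w))).re ≤ ω :=
    (Complex.re_le_norm _).trans (by rwa [norm_mul, hu1, one_mul])
  have h3 : u * ((divisorSum k (Real.exp w) : ℂ) - mainTerm k a (Real.exp w) - c) =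
      u * ((divisorSum k (Real.exp w') : ℂ) - mainTerm k a (Real.exp w') - c) +
      u * ((divisorSum k (Real.exp w) : ℂ) - divisorSum k (Real.exp w')) +
      u * (mainTerm k a (Real.exp w') - mainTerm k a (Real.exp w)) := by ring
  rw [h3, Complex.add_re, Complex.add_re]
  linarith

/-- Sandwiching the error term between its iterated averages. -/
theorem abs_re_mul_divisorError_le {k : ℕ} {a : ℕ → ℂ} {c u : ℂ} (hu : u = 1 ∨ u = Complex.I)
    {η y ω B : ℝ} {J : ℕ} (hη : 0 < η) (hy : J * η < y)
    (hω : ∀ w w' : ℝ, y - J * η ≤ w → w ≤ w' → w' ≤ y + J * η → w' - w ≤ J * η →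
      ‖mainTerm k a (Real.exp w') - mainTerm k a (Real.exp w)‖ ≤ ω)
    (hB : ∀ y, ‖(shiftAvg η)^[J] (divisorError k a c) y‖ ≤ B) :
    |(u * divisorError k a c y).re| ≤ B + ω := by
  have hu1 : ‖u‖ = 1 := by rcases hu with rfl | rfl <;> simp
  have hf := integrable_expWeight_divisorError k a c
  have hJ : 0 ≤ J * η := by positivity
  have hBu : ∀ y, |(u * (shiftAvg η)^[J] (divisorError k a c) y).re| ≤ B := fun y =>
    (Complex.abs_re_le_norm _).trans (by rw [norm_mul, hu1, one_mul]; exact hB y)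
  rw [abs_le]
  constructor
  -- Lower bound: the iterated average started at y - Jη uses only arguments in [y - Jη, y], where
  -- the error is at most its value at y plus ω.
  · have h1 := le_re_mul_iterate (u := -u) (c := -(u * divisorError k a c y).re - ω)
      hη hf J (y := y - J * η) fun w hw => by
        have hwy : w ≤ y := by linarith [hw.2]
        have := re_mul_divisorError_le (c := c) hu (by linarith [hw.1]) hwy
          (hω w y hw.1 hwy (by linarith) (by linarith [hw.1]))
        rw [neg_mul, Complex.neg_re]
        linarith
    rw [neg_mul, Complex.neg_re] at h1
    have := (abs_le.1 (hBu (y - J * η))).1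
    linarith
  -- Upper bound: on the forward window [y, y + Jη] the error is at least its value at y minus ω.
  · have h1 := le_re_mul_iterate (u := u) (c := (u * divisorError k a c y).re - ω)
      hη hf J (y := y) fun w hw => by
        have := re_mul_divisorError_le (c := c) hu (by linarith) hw.1
          (hω y w (by linarith) hw.1 hw.2 (by linarith [hw.2]))
        linarith
    have := (abs_le.1 (hBu y)).2
    linarith

/-- The `k`-divisor problem with the exponent `k / (k + 2)`. -/
theorem norm_divisorSum_sub_mainTerm_le {k : ℕ} (hk : 1 ≤ k) {a : ℕ → ℂ} {c : ℂ} {H : ℂ → ℂ}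
    (hH : Differentiable ℂ H)
    (h : ∀ s, s ≠ 0 → s ≠ 1 → riemannZeta s ^ k / s =
      c / s + ∑ j ∈ range k, a j / (s - 1) ^ (j + 1) + H s) {δ : ℝ} (hδ : 0 < δ)
    (hδ1 : δ ≤ 1 / ((k : ℝ) + 2)) :
    ∃ C : ℝ, 0 ≤ C ∧ ∀ x : ℝ, 0 < x →
      ‖(divisorSum k x : ℂ) - mainTerm k a x‖ ≤ C * x ^ ((k : ℝ) / ((k : ℝ) + 2) + δ) := by
  have hk1 : (1 : ℝ) ≤ k := by exact_mod_cast hk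
  have hk2 : (0 : ℝ) < (k : ℝ) + 2 := by linarith
  have hδ3 : δ ≤ 1 / 3 := hδ1.trans (by gcongr; linarith)
  set θ : ℝ := (k : ℝ) / ((k : ℝ) + 2) with hθ
  have hθ0 : 0 ≤ θ := by positivity
  have hθ1 : θ = 1 - 2 / ((k : ℝ) + 2) := by rw [hθ]; field_simp; ring
  have hδ2 : 2 * δ ≤ 2 / ((k : ℝ) + 2) := by
    calc 2 * δ ≤ 2 * (1 / ((k : ℝ) + 2)) := by gcongr
      _ = _ := by ring
  set A := ∑ j ∈ range k, ‖a j‖ * (δ ^ j)⁻¹ with hA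
  have hA0 : 0 ≤ A := sum_nonneg fun j _ => by positivity
  obtain ⟨C₁, hC₁0, hC₁⟩ := divisorSum_le_rpow k
  -- With ε = δ/4 the exponent is p = k/2 + kδ/2, and 2p/(k+2) = θ + θδ ≤ θ + δ.
  obtain ⟨C₂, hC₂0, hC₂⟩ := norm_iterate_divisorError_le hk hH h (ε := δ / 4) (by linarith)
    (by linarith)
  obtain ⟨C₃, hC₃0, hC₃⟩ := norm_mainTerm_exp_sub_le k a hδ
  set J : ℕ := 2 * k + 2 with hJ
  have hJ0 : (0 : ℝ) < J := by rw [hJ]; positivity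
  have hJ1 : (1 : ℝ) ≤ J := by rw [hJ]; push_cast; linarith
  set p : ℝ := (k : ℝ) / 2 + 2 * k * (δ / 4) with hp
  set E₁ : ℝ := C₁ * Real.exp 2 + A * Real.exp 2 with hE₁
  set E₂ : ℝ := 2 * (C₂ * (2 * J) ^ p + C₃ * Real.exp 1) + ‖c‖ with hE₂
  have hE₁0 : 0 ≤ E₁ := by positivity
  have hE₂0 : 0 ≤ E₂ := by positivity
  refine ⟨A + E₁ + E₂, by positivity, fun x hx => ?_⟩
  have hxp : 0 ≤ x ^ (θ + δ) := by positivity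
  have hmain := norm_mainTerm_le k a hδ hx
  rcases lt_or_ge x 1 with hx1 | hx1
  -- Small x must be included because the convolution identity evaluates the estimate at x/p^i. Here
  -- the main term is O(x^(1-δ)), and θ + δ ≤ 1 - δ by the restriction on δ.
  · have hD : divisorSum k x = 0 := by
      rw [divisorSum, Nat.floor_eq_zero.2 hx1]; simp
    rw [hD, Complex.ofReal_zero, zero_sub, norm_neg]
    have hlog : Real.log x < 0 := Real.log_neg hx hx1
    have h1 : x * Real.exp (δ * |Real.log x|) ≤ x ^ (θ + δ) := by
      rw [abs_of_neg hlog]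
      nth_rewrite 1 [← Real.exp_log hx]
      rw [← Real.exp_add, Real.rpow_def_of_pos hx]
      refine Real.exp_le_exp.2 ?_
      nlinarith
    calc _ ≤ A * (x * Real.exp (δ * |Real.log x|)) := hmain
      _ ≤ A * x ^ (θ + δ) := by gcongr
      _ ≤ _ := by gcongr; linarith
  have hxp1 : 1 ≤ x ^ (θ + δ) := Real.one_le_rpow hx1 (by linarith)
  have hlog0 : 0 ≤ Real.log x := Real.log_nonneg hx1
  rcases lt_or_ge x (Real.exp 1) with hxe | hxe
  · have hlog1 : Real.log x ≤ 1 := (Real.log_le_iff_le_exp hx).2 hxe.le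
    have h1 : divisorSum k x ≤ C₁ * Real.exp 2 := by
      refine (hC₁ x hx).trans ?_
      gcongr
      rw [Real.rpow_def_of_pos hx]
      exact Real.exp_le_exp.2 (by nlinarith)
    have h2 : ‖mainTerm k a x‖ ≤ A * Real.exp 2 := by
      refine hmain.trans ?_
      gcongr
      rw [abs_of_nonneg hlog0]
      nth_rewrite 1 [← Real.exp_log hx]
      rw [← Real.exp_add]
      exact Real.exp_le_exp.2 (by nlinarith)
    calc _ ≤ ‖(divisorSum k x : ℂ)‖ + ‖mainTerm k a x‖ := norm_sub_le _ _
      _ ≤ E₁ := by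
        rw [Complex.norm_real, Real.norm_of_nonneg (divisorSum_nonneg k x)]
        exact add_le_add h1 h2
      _ ≤ (A + E₁ + E₂) * 1 := by linarith
      _ ≤ _ := by gcongr
  · set y := Real.log x with hy
    have hxy : Real.exp y = x := Real.exp_log hx
    have hy1 : 1 ≤ y := (Real.le_log_iff_exp_le hx).2 hxe
    -- Here g = x^(-2/(k+2)), the balancing scale: both g·x and g^(-k/2) equal x^θ. The total window
    -- Jη = g/2 ≤ 1/2 keeps y - Jη positive, since y ≥ 1.
    set g : ℝ := Real.exp (-(2 / ((k : ℝ) + 2)) * y) with hg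
    have hg0 : 0 < g := Real.exp_pos _
    have hg1 : g ≤ 1 := by
      rw [hg, Real.exp_le_one_iff]
      have : 0 ≤ 2 / ((k : ℝ) + 2) * y := by positivity
      linarith
    set η : ℝ := g / (2 * J) with hη
    have hη0 : 0 < η := by positivity
    have hJη : J * η = g / 2 := by rw [hη]; field_simp
    have hη1 : η ≤ 1 := by nlinarith
    have hxθ : x ^ (θ + δ) = Real.exp ((θ + δ) * y) := by
      rw [Real.rpow_def_of_pos hx, mul_comm]
    have hηp : η ^ (-p) ≤ (2 * J) ^ p * x ^ (θ + δ) := by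
      rw [hη, Real.rpow_neg (by positivity), Real.div_rpow hg0.le (by positivity), inv_div,
        div_eq_mul_inv, ← Real.rpow_neg hg0.le, hg, ← Real.exp_mul, hxθ]
      have e1 : -(2 / ((k : ℝ) + 2)) * y * -p = (θ + θ * δ) * y := by
        rw [hp, hθ]; field_simp; ring
      have e2 : θ * δ ≤ δ := by
        have h1 : θ ≤ 1 := by rw [hθ1]; linarith [div_pos two_pos hk2]
        exact mul_le_of_le_one_left hδ.le h1
      rw [e1]
      exact mul_le_mul_of_nonneg_left (Real.exp_le_exp.2 (mul_le_mul_of_nonneg_right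
        (by linarith only [e2]) (by linarith only [hy1]))) (by positivity)
    have hω : ∀ w w' : ℝ, y - J * η ≤ w → w ≤ w' → w' ≤ y + J * η → w' - w ≤ J * η →
        ‖mainTerm k a (Real.exp w') - mainTerm k a (Real.exp w)‖ ≤
          C₃ * Real.exp 1 * x ^ (θ + δ) := by
      intro w w' h1 h2 h3 h4
      rw [hJη] at h1 h3 h4
      refine (hC₃ w w' (by linarith) h2).trans ?_
      have h5 : Real.exp ((1 + δ) * w') ≤ Real.exp 1 * Real.exp ((1 + δ) * y) := by
        rw [← Real.exp_add]
        refine Real.exp_le_exp.2 ?_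
        have h6 : (1 + δ) * (w' - y) ≤ (1 + 1 / 3) * (1 / 2) :=
          (mul_le_mul_of_nonneg_left (by linarith only [h3, hg1]) (by positivity)).trans
            (mul_le_mul_of_nonneg_right (by linarith only [hδ3]) (by norm_num))
        linarith only [h6, mul_sub (1 + δ) w' y]
      calc C₃ * Real.exp ((1 + δ) * w') * (w' - w)
          ≤ C₃ * (Real.exp 1 * Real.exp ((1 + δ) * y)) * g := by
            gcongr
            linarith only [h4, hg0]
        _ = C₃ * Real.exp 1 * x ^ (θ + δ) := by
            rw [hxθ, hg, mul_assoc, mul_assoc, ← Real.exp_add, mul_assoc]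
            congr 3
            rw [hθ1]; ring_nf
    have hsand : ∀ u : ℂ, u = 1 ∨ u = Complex.I → |(u * divisorError k a c y).re| ≤
        C₂ * ((2 * J) ^ p * x ^ (θ + δ)) + C₃ * Real.exp 1 * x ^ (θ + δ) := fun u hu =>
      abs_re_mul_divisorError_le hu hη0 (by rw [hJη]; linarith) hω fun z =>
        (hC₂ η hη0 hη1 z).trans (by gcongr)
    have e1 := hsand 1 (Or.inl rfl)
    have e2 := hsand Complex.I (Or.inr rfl)
    rw [one_mul] at e1
    rw [Complex.I_mul_re, abs_neg] at e2
    have hf : divisorError k a c y = (divisorSum k x : ℂ) - mainTerm k a x - c := by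
      rw [divisorError, Set.indicator_of_mem (Set.mem_Ioi.2 (by linarith)), hxy]
    have e3 : (divisorSum k x : ℂ) - mainTerm k a x = divisorError k a c y + c := by
      rw [hf]; ring
    rw [e3]
    have e4 := Complex.norm_le_abs_re_add_abs_im (divisorError k a c y)
    calc ‖divisorError k a c y + c‖ ≤ ‖divisorError k a c y‖ + ‖c‖ * 1 := by
          rw [mul_one]; exact norm_add_le _ _
      _ ≤ 2 * (C₂ * ((2 * J) ^ p * x ^ (θ + δ)) + C₃ * Real.exp 1 * x ^ (θ + δ)) +
          ‖c‖ * x ^ (θ + δ) := by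
          refine add_le_add (by linarith) (by gcongr)
      _ = E₂ * x ^ (θ + δ) := by rw [hE₂]; ring
      _ ≤ _ := by gcongr; linarith

end DivisorRamanujan

/-! ### Dependence on q and conclusion -/

namespace DivisorRamanujan
open Finset

/-- Only u ≥ a-1 contributes. At u = a-1 the value p^(a-1) t^(a-1) is below (pt)^a because pt ≥ 1;
for u ≥ a it is at most p^a t^a because t ≤ 1. -/
theorem norm_ramanujanSeries_mul_pow_le (k : ℕ) {p a u : ℕ} (hp : p.Prime) (ha : 1 ≤ a)
    (hu : u < a + k) {t : ℝ} (ht0 : 0 ≤ t) (ht1 : t ≤ 1) (hpt : 1 ≤ p * t) :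
    ‖(ramanujanSeries k p a).coeff u‖ * t ^ u ≤ ((a : ℝ) + k) ^ k * (p * t) ^ a := by
  obtain ⟨a, rfl⟩ := Nat.exists_eq_add_of_le' ha
  have hp1 : (1 : ℝ) ≤ p := by exact_mod_cast hp.one_lt.le
  have hd : (divisorFn k (p ^ u) : ℝ) ≤ ((a + 1 : ℕ) + (k : ℝ)) ^ k := by
    calc (divisorFn k (p ^ u) : ℝ) ≤ ((u : ℝ) + 1) ^ k := by
          exact_mod_cast divisorFn_prime_pow_le k hp u
      _ ≤ _ := pow_le_pow_left₀ (by positivity) (by exact_mod_cast hu) k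
  suffices h : ‖ramanujanSum (p ^ (a + 1)) (p ^ u)‖ * t ^ u ≤ (p * t) ^ (a + 1) by
    rw [ramanujanSeries, PowerSeries.coeff_mk, norm_mul, Complex.norm_natCast, mul_assoc]
    exact mul_le_mul hd h (by positivity) (by positivity)
  rw [ramanujanSum_prime_pow hp]
  simp only [Nat.pow_dvd_pow_iff_le_right hp.one_lt]
  rcases lt_trichotomy u a with h | rfl | h
  · rw [if_neg (by omega), if_neg (by omega), sub_zero, norm_zero, zero_mul]
    positivity
  · rw [if_neg (by omega), if_pos le_rfl, zero_sub, norm_neg, norm_pow, Complex.norm_natCast,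
      ← mul_pow]
    exact pow_le_pow_right₀ hpt (Nat.le_succ _)
  · rw [if_pos (Nat.succ_le_of_lt h), if_pos h.le]
    have h1 : (p : ℝ) ^ a ≤ (p : ℝ) ^ (a + 1) := pow_le_pow_right₀ hp1 (Nat.le_succ _)
    have h2 : ‖(p : ℂ) ^ (a + 1) - (p : ℂ) ^ a‖ ≤ (p : ℝ) ^ (a + 1) := by
      have : (p : ℂ) ^ (a + 1) - (p : ℂ) ^ a = (((p : ℝ) ^ (a + 1) - (p : ℝ) ^ a : ℝ) : ℂ) := by
        push_cast; rfl
      rw [this, Complex.norm_real, Real.norm_of_nonneg (sub_nonneg.2 h1)]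
      linarith [pow_nonneg (zero_le_one.trans hp1) a]
    rw [mul_pow]
    exact mul_le_mul h2 (pow_le_pow_of_le_one ht0 ht1 h) (by positivity) (by positivity)

theorem coe_localPoly_eq (k : ℕ) {p a : ℕ} (hp : p.Prime) (ha : 1 ≤ a) :
    (localPoly k p a : PowerSeries ℂ) =
      ramanujanSeries k p a * (((1 - Polynomial.X) ^ k : Polynomial ℂ) : PowerSeries ℂ) := by
  have h : (((1 - Polynomial.X) ^ k : Polynomial ℂ) : PowerSeries ℂ) =
      (1 - PowerSeries.X) ^ k := by simp
  rw [← localPoly_mul_divisorSeries k hp ha, h, mul_assoc, mul_comm (divisorSeries k p),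
    one_sub_pow_mul_divisorSeries k hp, mul_one]

/-- The polynomial is the Ramanujan series times (1-X)^k, whose coefficients are bounded in terms of
k. Two of the k+2 powers of a+k count the terms of the Cauchy product and of the outer sum. For t =
p^(-τ) the last factor becomes p^(a(1-τ)). -/
theorem sum_norm_coeff_localPoly_mul_pow_le (k : ℕ) : ∃ K : ℝ, 1 ≤ K ∧
    ∀ (p a : ℕ) (t : ℝ), p.Prime → 1 ≤ a → 0 ≤ t → t ≤ 1 → 1 ≤ p * t →
      ∑ i ∈ range (a + k), ‖(localPoly k p a).coeff i‖ * t ^ i ≤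
        K * ((a : ℝ) + k) ^ (k + 2) * (p * t) ^ a := by
  set Q : Polynomial ℂ := (1 - Polynomial.X) ^ k with hQ
  set M : ℝ := ∑ v ∈ range (k + 1), ‖Q.coeff v‖ with hM
  have hM0 : 0 ≤ M := sum_nonneg fun _ _ => norm_nonneg _
  have hQM : ∀ v, ‖Q.coeff v‖ ≤ M := by
    intro v
    rcases lt_or_ge v (k + 1) with h | h
    · exact single_le_sum (f := fun v => ‖Q.coeff v‖) (fun _ _ => norm_nonneg _)
        (mem_range.2 h)
    · rw [Polynomial.coeff_eq_zero_of_natDegree_lt ((natDegree_one_sub_X_pow_le k).trans_lt h),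
        norm_zero]
      exact hM0
  refine ⟨M + 1, by linarith, fun p a t hp ha ht0 ht1 hpt => ?_⟩
  set B : ℝ := ((a : ℝ) + k) ^ k * (p * t) ^ a with hB
  have hB0 : 0 ≤ B := by positivity
  have hi : ∀ i ∈ range (a + k), ‖(localPoly k p a).coeff i‖ * t ^ i ≤
      ((a : ℝ) + k) * (B * (M + 1)) := by
    intro i hi
    have hik : i + 1 ≤ a + k := mem_range.1 hi
    rw [← Polynomial.coeff_coe, coe_localPoly_eq k hp ha, PowerSeries.coeff_mul]
    calc _ ≤ (∑ x ∈ antidiagonal i, ‖(ramanujanSeries k p a).coeff x.1 *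
          (Q : PowerSeries ℂ).coeff x.2‖) * t ^ i := by gcongr; exact norm_sum_le _ _
      _ ≤ ∑ x ∈ antidiagonal i, B * (M + 1) := by
        rw [sum_mul]
        refine sum_le_sum fun x hx => ?_
        have hx := mem_antidiagonal.1 hx
        rw [← hx, pow_add, norm_mul, Polynomial.coeff_coe]
        calc _ = (‖(ramanujanSeries k p a).coeff x.1‖ * t ^ x.1) *
              (‖Q.coeff x.2‖ * t ^ x.2) := by ring
          _ ≤ B * ((M + 1) * 1) := by
            gcongr
            · exact norm_ramanujanSeries_mul_pow_le k hp ha (by omega) ht0 ht1 hpt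
            · linarith [hQM x.2]
            · exact pow_le_one₀ ht0 ht1
          _ = _ := by ring
      _ = ((i + 1 : ℕ) : ℝ) * (B * (M + 1)) := by
        rw [sum_const, Nat.card_antidiagonal, nsmul_eq_mul]
      _ ≤ _ := by
        gcongr
        exact_mod_cast hik
  calc _ ≤ ∑ _i ∈ range (a + k), ((a : ℝ) + k) * (B * (M + 1)) := sum_le_sum hi
    _ = _ := by
      rw [sum_const, card_range, nsmul_eq_mul, hB]
      push_cast
      ring

theorem prod_primeFactors_rpow (q : ℕ) (hq : 1 ≤ q) (r : ℝ) :
    ∏ p ∈ q.primeFactors, ((p : ℝ) ^ q.factorization p) ^ r = (q : ℝ) ^ r := by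
  rw [Real.finsetProd_rpow _ _ (fun _ _ => by positivity)]
  congr 1
  conv_rhs => rw [← Nat.prod_factorization_pow_eq_self (by omega : q ≠ 0)]
  rw [Finsupp.prod, Nat.support_factorization]
  push_cast
  rfl

/-- The usual divisor-bound argument: a polynomial in the exponent a is at most B·2^(εa), and B can
be absorbed into p^(εa) for all but boundedly many primes. -/
theorem prod_primeFactors_add_pow_le (k j : ℕ) {K ε : ℝ} (hK : 1 ≤ K) (hε : 0 < ε) :
    ∃ C : ℝ, 0 ≤ C ∧ ∀ q : ℕ, 1 ≤ q →
      ∏ p ∈ q.primeFactors, (K * ((q.factorization p : ℝ) + k) ^ j) ≤ C * (q : ℝ) ^ ε := by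
  have hl : 0 < ε * Real.log 2 := mul_pos hε (Real.log_pos one_lt_two)
  obtain ⟨B, hB1, hB⟩ : ∃ B : ℝ, 1 ≤ B ∧ ∀ a : ℕ,
      K * ((a : ℝ) + k) ^ j ≤ B * ((2 : ℝ) ^ ε) ^ a := by
    set B : ℝ := K * (j.factorial * ((ε * Real.log 2) ^ j)⁻¹ * Real.exp (ε * Real.log 2 * k))
    refine ⟨max 1 B, le_max_left _ _, fun a => ?_⟩
    have h := pow_div_factorial_le j (y := (a : ℝ) + k) (by positivity) hl
    rw [div_le_iff₀ (by positivity)] at h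
    have h2 : ((2 : ℝ) ^ ε) ^ a = Real.exp (ε * Real.log 2 * a) := by
      rw [Real.rpow_def_of_pos two_pos, ← Real.exp_nat_mul]
      congr 1; ring
    calc _ ≤ K * (((ε * Real.log 2) ^ j)⁻¹ * Real.exp (ε * Real.log 2 * (a + k)) *
          j.factorial) := by gcongr
      _ = B * ((2 : ℝ) ^ ε) ^ a := by rw [h2, mul_add, Real.exp_add]; ring
      _ ≤ _ := by gcongr; exact le_max_right _ _
  -- Primes p ≥ P satisfy p^ε ≥ B·2^ε; the fewer than P smaller values of p cost at most B^P in
  -- total.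
  obtain ⟨P, hP⟩ := exists_nat_ge ((B * (2 : ℝ) ^ ε) ^ ε⁻¹)
  have h2ε : 1 ≤ (2 : ℝ) ^ ε := Real.one_le_rpow one_le_two hε.le
  refine ⟨B ^ P, by positivity, fun q hq => ?_⟩
  have hterm : ∀ p ∈ q.primeFactors, K * ((q.factorization p : ℝ) + k) ^ j ≤
      (if p < P then B else 1) * ((p : ℝ) ^ q.factorization p) ^ ε := by
    intro p hp
    have hpp := Nat.prime_of_mem_primeFactors hp
    have hp2 : (2 : ℝ) ≤ p := by exact_mod_cast hpp.two_le
    have hv : 1 ≤ q.factorization p :=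
      (hpp.dvd_iff_one_le_factorization (by omega)).1 (Nat.dvd_of_mem_primeFactors hp)
    refine (hB _).trans ?_
    rw [← Real.rpow_natCast, ← Real.rpow_natCast, ← Real.rpow_mul (by positivity),
      ← Real.rpow_mul (by positivity), mul_comm ((_ : ℕ) : ℝ) ε, Real.rpow_mul (by positivity),
      Real.rpow_mul (by positivity), Real.rpow_natCast, Real.rpow_natCast]
    split_ifs with h
    · gcongr
    · have hpP : (B * (2 : ℝ) ^ ε) ^ ε⁻¹ ≤ p := hP.trans (by exact_mod_cast not_lt.1 h)
      have hpε : B * (2 : ℝ) ^ ε ≤ (p : ℝ) ^ ε := by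
        have := Real.rpow_le_rpow (by positivity) hpP hε.le
        rwa [← Real.rpow_mul (by positivity), inv_mul_cancel₀ hε.ne', Real.rpow_one] at this
      calc B * ((2 : ℝ) ^ ε) ^ q.factorization p
          ≤ B ^ q.factorization p * ((2 : ℝ) ^ ε) ^ q.factorization p := by
            gcongr
            exact le_self_pow₀ hB1 (by omega)
        _ = (B * (2 : ℝ) ^ ε) ^ q.factorization p := (mul_pow _ _ _).symm
        _ ≤ 1 * ((p : ℝ) ^ ε) ^ q.factorization p := by rw [one_mul]; gcongr
  calc _ ≤ ∏ p ∈ q.primeFactors, (if p < P then B else 1) *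
        ((p : ℝ) ^ q.factorization p) ^ ε :=
        prod_le_prod (fun _ _ => by positivity) hterm
    _ = (∏ p ∈ q.primeFactors, if p < P then B else 1) * (q : ℝ) ^ ε := by
        rw [prod_mul_distrib, prod_primeFactors_rpow q hq]
    _ ≤ _ := by
        gcongr
        rw [← prod_filter, prod_const]
        refine pow_le_pow_right₀ hB1 ?_
        calc _ ≤ #(range P) := card_le_card fun p hp => mem_range.2 (mem_filter.1 hp).2
          _ = P := card_range P

theorem sum_Icc_floor_dvd (f : ℕ → ℂ) (x : ℝ) {m : ℕ} (hm : 0 < m) :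
    ∑ n ∈ Icc 1 ⌊x⌋₊, (if m ∣ n then f (n / m) else 0) = ∑ n ∈ Icc 1 ⌊x / m⌋₊, f n := by
  rw [Nat.floor_div_natCast, ← sum_filter]
  refine sum_bij' (fun n _ => n / m) (fun n _ => m * n) ?_ ?_ ?_ ?_ ?_
  · intro n hn
    rw [mem_filter, mem_Icc] at hn
    rw [mem_Icc]
    exact ⟨Nat.div_pos (Nat.le_of_dvd hn.1.1 hn.2) hm, Nat.div_le_div_right hn.1.2⟩
  · intro n hn
    rw [mem_Icc] at hn
    rw [mem_filter, mem_Icc]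
    exact ⟨⟨Nat.mul_pos hm hn.1, by rw [mul_comm]; exact (Nat.le_div_iff_mul_le hm).1 hn.2⟩,
      Nat.dvd_mul_right _ _⟩
  · intro n hn
    exact Nat.mul_div_cancel' (mem_filter.1 hn).2
  · intro n _
    exact Nat.mul_div_cancel_left n hm
  · intro n _
    rfl

/-- Since (x/p^i)^s = x^s p^(-is), the local factor acts on residues and on partial sums alike,
replacing x by x/p^i with weights the coefficients of the local polynomial. The errors (x/p^i)^τ
therefore accumulate the stated product. -/
theorem exists_residue_twistedDivisor (k : ℕ) {C τ : ℝ} {M : ℝ → ℂ}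
    (hM : ∀ x : ℝ, 0 < x →
      HasResidueAt (fun s : ℂ => riemannZeta s ^ k * ((x : ℂ) ^ s / s)) 1 (M x))
    (hC : ∀ x : ℝ, 0 < x → ‖(divisorSum k x : ℂ) - M x‖ ≤ C * x ^ τ) (q : ℕ) (hq : 1 ≤ q) :
    ∃ R : ℝ → ℂ,
      (∀ x : ℝ, 0 < x → HasResidueAt
        (fun s : ℂ => riemannZeta s ^ k * eulerF k q s * ((x : ℂ) ^ s / s)) 1 (R x)) ∧
      ∀ x : ℝ, 0 < x → ‖∑ n ∈ Icc 1 ⌊x⌋₊, twistedDivisor k q n - R x‖ ≤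
        C * (∏ p ∈ q.primeFactors, ∑ i ∈ range (q.factorization p + k),
          ‖(localPoly k p (q.factorization p)).coeff i‖ * ((p : ℝ) ^ (-τ)) ^ i) * x ^ τ := by
  refine induction_prime_pow_mul (P := fun q => ∃ R : ℝ → ℂ,
      (∀ x : ℝ, 0 < x → HasResidueAt
        (fun s : ℂ => riemannZeta s ^ k * eulerF k q s * ((x : ℂ) ^ s / s)) 1 (R x)) ∧
      ∀ x : ℝ, 0 < x → ‖∑ n ∈ Icc 1 ⌊x⌋₊, twistedDivisor k q n - R x‖ ≤
        C * (∏ p ∈ q.primeFactors, ∑ i ∈ range (q.factorization p + k),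
          ‖(localPoly k p (q.factorization p)).coeff i‖ * ((p : ℝ) ^ (-τ)) ^ i) * x ^ τ)
    ?_ ?_ q hq
  · refine ⟨M, fun x hx => ?_, fun x hx => ?_⟩
    · simpa only [eulerF_one, mul_one] using hM x hx
    · have h : ∑ n ∈ Icc 1 ⌊x⌋₊, twistedDivisor k 1 n = (divisorSum k x : ℂ) := by
        simp [twistedDivisor, ramanujanSum_one, divisorSum]
      rw [h, Nat.primeFactors_one, prod_empty, mul_one]
      exact hC x hx
  · rintro p a q hp ha hpq ⟨R, hR, hb⟩
    have hp0 : (0 : ℝ) < p := by exact_mod_cast hp.pos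
    have hpi : ∀ i : ℕ, (0 : ℝ) < (p ^ i : ℕ) := fun i => by exact_mod_cast pow_pos hp.pos i
    refine ⟨fun x => ∑ i ∈ range (a + k), (localPoly k p a).coeff i * R (x / (p ^ i : ℕ)),
      fun x hx => ?_, fun x hx => ?_⟩
    · refine (HasResidueAt.sum (range (a + k)) fun i _ =>
        (hR (x / (p ^ i : ℕ)) (div_pos hx (hpi i))).const_mul _).congr ?_
      have hre : ∀ᶠ s : ℂ in nhdsWithin 1 {1}ᶜ, 0 < s.re :=
        (Complex.continuous_re.continuousAt.eventually_const_lt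
          (by simp : (0 : ℝ) < (1 : ℂ).re)).filter_mono nhdsWithin_le_nhds
      filter_upwards [hre] with s hs
      have hx1 : ∀ i : ℕ, (((x / (p ^ i : ℕ) : ℝ)) : ℂ) ^ s =
          (x : ℂ) ^ s * ((p ^ i : ℕ) : ℂ) ^ (-s) := by
        intro i
        have h1 := Complex.mul_cpow_ofReal_nonneg (div_pos hx (hpi i)).le (hpi i).le s
        rw [← Complex.ofReal_mul, div_mul_cancel₀ _ (hpi i).ne', Complex.ofReal_natCast] at h1
        have h2 : ((p ^ i : ℕ) : ℂ) ^ s ≠ 0 := by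
          rw [Complex.cpow_ne_zero_iff]
          exact Or.inl (by exact_mod_cast (hpi i).ne')
        rw [h1, Complex.cpow_neg, mul_assoc, mul_inv_cancel₀ h2, mul_one]
      rw [eulerF_prime_pow_mul k hp ha hpq, localFactor_eq_sum k hp ha hs, sum_mul, mul_sum,
        sum_mul]
      refine sum_congr rfl fun i _ => ?_
      rw [hx1]
      ring
    · have hsum : ∑ n ∈ Icc 1 ⌊x⌋₊, twistedDivisor k (p ^ a * q) n =
          ∑ i ∈ range (a + k), (localPoly k p a).coeff i *
            ∑ n ∈ Icc 1 ⌊x / (p ^ i : ℕ)⌋₊, twistedDivisor k q n := by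
        rw [sum_congr rfl fun n hn =>
          twistedDivisor_prime_pow_mul k hp ha hpq (by have := (mem_Icc.1 hn).1; omega), sum_comm]
        refine sum_congr rfl fun i _ => ?_
        rw [← mul_sum, sum_Icc_floor_dvd _ _ (pow_pos hp.pos i)]
      rw [hsum, ← sum_sub_distrib, prod_primeFactors_prime_pow_mul
        (fun p a => ∑ i ∈ range (a + k), ‖(localPoly k p a).coeff i‖ * ((p : ℝ) ^ (-τ)) ^ i)
        hp ha hpq, sum_mul, mul_sum, sum_mul]
      refine (norm_sum_le _ _).trans (sum_le_sum fun i _ => ?_)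
      rw [← mul_sub, norm_mul]
      have h1 : (x / (p ^ i : ℕ)) ^ τ = x ^ τ * ((p : ℝ) ^ (-τ)) ^ i := by
        rw [Real.div_rpow hx.le (hpi i).le, Real.rpow_neg hp0.le, inv_pow, Nat.cast_pow,
          ← Real.rpow_natCast, ← Real.rpow_natCast, ← Real.rpow_mul hp0.le,
          ← Real.rpow_mul hp0.le, mul_comm τ, div_eq_mul_inv]
      calc _ ≤ _ := mul_le_mul_of_nonneg_left (hb _ (div_pos hx (hpi i))) (norm_nonneg _)
        _ = _ := by rw [h1]; ring

theorem exists_residue_norm_sub_le {k : ℕ} (hk : 1 ≤ k) {ε : ℝ} (hε : 0 < ε) :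
    ∃ C : ℝ, ∀ q : ℕ, 1 ≤ q → ∀ N : ℝ, (q : ℝ) ≤ N → ∃ ρ : ℂ,
      HasResidueAt (fun s : ℂ => riemannZeta s ^ k * eulerF k q s * ((N : ℂ) ^ s / s)) 1 ρ ∧
      ‖∑ n ∈ Icc 1 ⌊N⌋₊, twistedDivisor k q n - ρ‖ ≤
        C * (N ^ (1 + ε) * ((q : ℝ) / N) ^ ((2 : ℝ) / ((k : ℝ) + 2))) := by
  have hk2 : (0 : ℝ) < (k : ℝ) + 2 := by positivity
  set δ : ℝ := min ε (1 / ((k : ℝ) + 2)) with hδ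
  have hδ0 : 0 < δ := lt_min hε (by positivity)
  have hδε : δ ≤ ε := min_le_left _ _
  have hδk : δ ≤ 1 / ((k : ℝ) + 2) := min_le_right _ _
  set α : ℝ := 2 / ((k : ℝ) + 2) with hα
  have hα0 : 0 < α := by positivity
  have hδα : δ ≤ α := hδk.trans (by rw [hα]; gcongr; norm_num)
  set τ : ℝ := (k : ℝ) / ((k : ℝ) + 2) + δ with hτ
  have hτ0 : 0 ≤ τ := by positivity
  have hτα : τ = 1 - α + δ := by rw [hτ, hα]; field_simp; ring
  obtain ⟨c, a, H, hH, h⟩ := exists_zeta_pow_div_eq k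
  obtain ⟨C₁, hC₁0, hC₁⟩ := norm_divisorSum_sub_mainTerm_le hk hH h hδ0 hδk
  obtain ⟨K, hK1, hK⟩ := sum_norm_coeff_localPoly_mul_pow_le k
  obtain ⟨C₂, hC₂0, hC₂⟩ := prod_primeFactors_add_pow_le k (k + 2) hK1 hδ0
  refine ⟨C₁ * C₂, fun q hq N hqN => ?_⟩
  have hq0 : (0 : ℝ) < q := by exact_mod_cast hq
  have hN1 : 1 ≤ N := le_trans (by exact_mod_cast hq) hqN
  have hN0 : 0 < N := zero_lt_one.trans_le hN1
  obtain ⟨R, hR, hb⟩ := exists_residue_twistedDivisor k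
    (fun x hx => hasResidueAt_mainTerm hH h hx) hC₁ q hq
  refine ⟨R N, hR N hN0, (hb N hN0).trans ?_⟩
  have hprod : ∏ p ∈ q.primeFactors, ∑ i ∈ range (q.factorization p + k),
      ‖(localPoly k p (q.factorization p)).coeff i‖ * ((p : ℝ) ^ (-τ)) ^ i ≤
        C₂ * (q : ℝ) ^ δ * (q : ℝ) ^ (1 - τ) := by
    calc _ ≤ ∏ p ∈ q.primeFactors, (K * ((q.factorization p : ℝ) + k) ^ (k + 2)) *
          ((p : ℝ) ^ q.factorization p) ^ (1 - τ) := by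
          refine prod_le_prod (fun _ _ => by positivity) fun p hp => ?_
          have hpp := Nat.prime_of_mem_primeFactors hp
          have hp0 : (0 : ℝ) < p := by exact_mod_cast hpp.pos
          have hp1 : (1 : ℝ) ≤ p := by exact_mod_cast hpp.one_lt.le
          have hv : 1 ≤ q.factorization p :=
            (hpp.dvd_iff_one_le_factorization (by omega)).1 (Nat.dvd_of_mem_primeFactors hp)
          have hpt : (p : ℝ) * (p : ℝ) ^ (-τ) = (p : ℝ) ^ (1 - τ) := by
            rw [sub_eq_add_neg, Real.rpow_add hp0, Real.rpow_one]
          have := hK p (q.factorization p) ((p : ℝ) ^ (-τ)) hpp hv (by positivity)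
            (Real.rpow_le_one_of_one_le_of_nonpos hp1 (by linarith))
            (by rw [hpt]; exact Real.one_le_rpow hp1 (by linarith))
          rwa [hpt, ← Real.rpow_natCast ((p : ℝ) ^ (1 - τ)), ← Real.rpow_mul hp0.le,
            mul_comm (1 - τ), Real.rpow_mul hp0.le, Real.rpow_natCast] at this
      _ = (∏ p ∈ q.primeFactors, (K * ((q.factorization p : ℝ) + k) ^ (k + 2))) *
          (q : ℝ) ^ (1 - τ) := by
          rw [prod_mul_distrib, prod_primeFactors_rpow q hq]
      _ ≤ _ := by gcongr; exact hC₂ q hq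
  -- The q^δ lost in the product over primes is exactly regained from 1 - τ = α - δ.
  have hqδ : (q : ℝ) ^ δ * (q : ℝ) ^ (1 - τ) = (q : ℝ) ^ α := by
    rw [← Real.rpow_add hq0]
    congr 1
    rw [hτα]; ring
  have hNδ : N ^ τ = N ^ (1 + δ) * (N ^ α)⁻¹ := by
    rw [← Real.rpow_neg hN0.le, ← Real.rpow_add hN0]
    congr 1
    rw [hτα]; ring
  calc C₁ * (∏ p ∈ q.primeFactors, ∑ i ∈ range (q.factorization p + k),
        ‖(localPoly k p (q.factorization p)).coeff i‖ * ((p : ℝ) ^ (-τ)) ^ i) * N ^ τ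
      ≤ C₁ * (C₂ * (q : ℝ) ^ δ * (q : ℝ) ^ (1 - τ)) * N ^ τ := by gcongr
    _ = C₁ * C₂ * (N ^ (1 + δ) * ((q : ℝ) / N) ^ α) := by
        rw [mul_assoc C₂, hqδ, hNδ, Real.div_rpow hq0.le hN0.le]; ring
    _ ≤ _ := by
        gcongr

theorem summable_localTerm (k a : ℕ) {p : ℕ} (hp : p.Prime) {s : ℂ} (hs : 0 < s.re) :
    Summable fun j : ℕ => ‖localTerm k p (a + j) s‖ := by
  have h := (summable_nat_add_iff a).2
    (summable_divisorFn_prime_pow k hp (norm_prime_cpow_neg_lt_one hp hs))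
  refine h.congr fun j => ?_
  rw [localTerm_eq, add_comm]

end DivisorRamanujan

theorem proposition6p1 (k : ℕ) (hk : 1 ≤ k) :
    (∀ q : ℕ, 1 ≤ q →
      (∀ s : ℂ, 0 < s.re → ∀ p ∈ q.primeFactors,
        Summable (fun j : ℕ =>
          ‖DivisorRamanujan.localTerm k p (q.factorization p + j) s‖)) ∧
      (∀ s : ℂ, 1 < s.re →
        LSeriesHasSum
          (fun n : ℕ => (DivisorRamanujan.divisorFn k n : ℂ) * DivisorRamanujan.ramanujanSum q n)
          s (riemannZeta s ^ k * DivisorRamanujan.eulerF k q s))) ∧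
    (∀ ε : ℝ, 0 < ε → ∃ C : ℝ, ∀ q : ℕ, 1 ≤ q → ∀ N : ℝ, (q : ℝ) ≤ N →
      ∃ ρ : ℂ,
        DivisorRamanujan.HasResidueAt
          (fun s : ℂ =>
            riemannZeta s ^ k * DivisorRamanujan.eulerF k q s * ((N : ℂ) ^ s / s)) 1 ρ ∧
        ‖∑ n ∈ Finset.Icc 1 ⌊N⌋₊,
            (DivisorRamanujan.divisorFn k n : ℂ) * DivisorRamanujan.ramanujanSum q n - ρ‖ ≤
          C * (N ^ (1 + ε) * ((q : ℝ) / N) ^ ((2 : ℝ) / ((k : ℝ) + 2)))) := by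
  exact ⟨fun q hq => ⟨fun s hs p hp => DivisorRamanujan.summable_localTerm k _
      (Nat.prime_of_mem_primeFactors hp) hs,
    fun s hs => DivisorRamanujan.LSeriesHasSum_twistedDivisor k hs q hq⟩,
    fun ε hε => DivisorRamanujan.exists_residue_norm_sub_le hk hε⟩
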